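/- Let $n\ge 4$, $1\le \ell\le n-2$, $0\le r\le n-\ell-1$ and $0\le h\le \ell$, and let $I_0=\{1,\dots,n\}$ be the vertex set of the Dynkin diagram $D_n$, where $n-2$ is joined to $n-1$ and to $n$, with Cartan matrix $(C_{i,j})$, fundamental weights $\Lambda_i$ and simple roots $\alpha_i=\sum_j C_{j,i}\Lambda_j$. **Monomial crystal.** For a Laurent monomial $m=\prod_{i\in I_0,\,l\in\mathbb Z}Y_{i,l}^{u_{i,l}}$ put $\mathrm{wt}(m)=\sum_i\big(\sum_l u_{i,l}\big)\Lambda_i$, $\varphi_i(m)=\max_L\sum_{l\le L}u_{i,l}$, $\varepsilon_i(m)=\max_L\big(-\sum_{l\ge L}u_{i,l}\big)$, and let $q_i(m)$ (resp. $p_i(m)$) be the smallest (resp. largest) $L$ at which the first (resp. second) maximum is attained. With $A_{i,l}=Y_{i,l-1}Y_{i,l+1}\prod_{j\ne i}Y_{j,l}^{C_{j,i}}$ put $\tilde f_i m=mA_{i,q_i(m)+1}^{-1}$ if $\varphi_i(m)>0$ and $\tilde f_i m=0$ otherwise; $\tilde e_i m=mA_{i,p_i(m)-1}$ if $\varepsilon_i(m)>0$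 and $\tilde e_i m=0$ otherwise. Let $\mathcal M_{I_0}(M)$ be the set of monomials obtained from $M$ by applying the operators $\tilde e_i,\tilde f_i$ ($i\in I_0$), and, with $Y_{0,*}=1$, let $$M_{\ell,h,r}=Y_{h,\ell-h}\,Y_{h,\ell-h-2r}^{-1}\,Y_{\ell,-2r}.$$ **Boxes.** Let $\mathbf B=\{1,\dots,n,\overline n,\dots,\overline 1\}$ be ordered by $1\prec\dots\prec n-1\prec n,\overline n\prec\overline{n-1}\prec\dots\prec\overline 1$, with $n$ and $\overline n$ incomparable. For $s\in\mathbb Z$ put (with $Y_{0,*}=1$) $$[i]_s=Y_{i-1,s+i}^{-1}Y_{i,s+i-1},\qquad [\overline i]_s=Y_{i-1,s+2n-2-i}Y_{i,s+2n-1-i}^{-1}\qquad(1\le i\le n-2),$$ $$[n-1]_s=Y_{n-2,s+n-1}^{-1}Y_{n-1,s+n-2}Y_{n,s+n-2},\qquad [\overline{n-1}]_s=Y_{n-2,s+n-1}Y_{n-1,s+n}^{-1}Y_{n,s+n}^{-1},$$ $$[n]_s=Y_{n-1,s+n}^{-1}Y_{n,s+n-2},\qquad [\overline n]_s=Y_{n-1,s+n-2}Y_{n,s+n}^{-1}.$$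 For $T=((i_1,\dots,i_h),(i_{h+1},\dots,i_\ell))$ with entries in $\mathbf B$ put $$m_T=\prod_{a=1}^{h}[i_a]_{\ell+1-2a}\;\prod_{a=h+1}^{\ell}[i_a]_{\ell+1-2a-2r}.$$ **Tableaux.** Let $D_{\ell,h,r}$ be the set of such $T$ satisfying * (D.1) $i_1\nsucceq i_2\nsucceq\cdots\nsucceq i_h$ and $i_{h+1}\nsucceq\cdots\nsucceq i_\ell$. * (D.2) There are no $1\le a<b\le h$ and $k$ with $i_a=k$, $i_b=\overline k$, $b-a=n-1-k$. * (D.3) There are no $h+1\le a<b\le\ell$ and $k$ with $i_a=k$, $i_b=\overline k$, $b-a=n-1-k$. * (D.4) There are no $a\le h<b$ and $k$ with $i_a=k$, $i_b=\overline k$, $b-a=n-\max(r,1)-k$. * (D.5) If $i_{h+1}=k\in\{1,\dots,n-1\}$ and $i_h\succeq i_{h+1}$, then $i_h=k'\in\{1,\dots,n-1\}$ and $(\overline{k'},\overline{k'-1},\dots,\overline k)=(i_{b'},i_{b'+1},\dots,i_b)$ for some $b'\le b$ with $n-r-k<b-h\le n-k-1$. * (D.6) If $i_{h+1}=\overline k\in\{\overline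 1,\dots,\overline{n-1}\}$ and $i_h\succeq i_{h+1}$, then $i_h=\overline{k'}\in\{\overline 1,\dots,\overline{n-1}\}$ and $(k',k'+1,\dots,k)=(i_{a'},i_{a'+1},\dots,i_a)$ for some $a'\le a$ with $n-r-k\le h-a<n-k-1$. * (D.7) If $i_{h+1}\in\{n,\overline n\}$, then $i_h\nsucceq i_{h+1}$. (Conditions (D.5)–(D.7) are void if $h=0$ or $h=\ell$.) **Crystal structure on tableaux.** Put $\mathrm{wt}(T)=\mathrm{wt}(m_T)$, $\varepsilon_i(T)=\varepsilon_i(m_T)$, $\varphi_i(T)=\varphi_i(m_T)$. Draw arrows labelled $i$ between letters: $i\to i+1$ and $\overline{i+1}\to\overline i$ for $i<n$, and $n-1\to\overline n$, $n\to\overline{n-1}$ for $i=n$. If $\varphi_i(T)>0$, then $\tilde f_iT$ is obtained by replacing one entry whose box contains $Y_{i,q_i(m_T)}$ with exponent $1$ by the target of its arrow labelled $i$; if there are two such entries, the first one is replaced, unless $r\ge1$ and they lie in different columns, when the second one is replaced. If $\varepsilon_i(T)>0$, then $\tilde e_iT$ is obtained by replacing one entry whose box contains $Y_{i,p_i(m_T)}$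 with exponent $-1$ by the source of its arrow labelled $i$; if there are two such entries, the second one is replaced, unless $r\ge 1$ and they lie in different columns, when the first one is replaced. In the remaining cases $\tilde f_iT=0$, resp. $\tilde e_iT=0$. **Theorem.** The sets $D_{\ell,h,r}$ and $\mathcal M_{I_0}(M_{\ell,h,r})$ with these structures are crystals of type $D_n$ (in particular $D_{\ell,h,r}$ is stable under all $\tilde e_i,\tilde f_i$), and $T\mapsto m_T$ is an isomorphism of crystals from $D_{\ell,h,r}$ onto $\mathcal M_{I_0}(M_{\ell,h,r})$: it is a bijection, preserves $\mathrm{wt}$, $\varepsilon_i$, $\varphi_i$, and commutes with all $\tilde e_i$, $\tilde f_i$. -/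

import Mathlib

namespace TypeD

/-- The index type `{1, …, N}`.  `Idx n` is the vertex set `I₀` of the Dynkin diagram `D_n`, and
`Idx ℓ` is the set of positions of a tableau with `ℓ` boxes. -/
abbrev Idx (N : ℕ) : Type := ↥(Set.Icc (1 : ℕ) N)

/-- The Cartan matrix of type `D_n`, with rows and columns numbered by `1, …, n`
(the vertex `n - 2` is joined to both `n - 1` and `n`). -/
def cartan (n : ℕ) (i j : Idx n) : ℤ :=
  CartanMatrix.D n
    ⟨i.1 - 1, by have h₁ := i.2.1; have h₂ := i.2.2; omega⟩
    ⟨j.1 - 1, by have h₁ := j.2.1; have h₂ := j.2.2; omega⟩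

/-! ### Crystals -/

/-- The weight lattice `P = ⨁ ℤ Λ_i` of type `D_n`: `w i` is the value `w (α_i^∨)`, that is, the
coefficient of the fundamental weight `Λ_i`. -/
abbrev Weight (n : ℕ) : Type := Idx n → ℤ

/-- The simple root `α_i`, that is, `α_i (α_j^∨) = C_{j,i}`. -/
def simpleRoot (n : ℕ) (i : Idx n) : Weight n := fun j => cartan n j i

/-- The data of a crystal of type `D_n` on a set `B`.  The value `none` of `e`, `f` stands
for `0`.  The axioms are in `CrystalData.IsCrystalOn`. -/
structure CrystalData (n : ℕ) (B : Type) where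
  wt : B → Weight n
  ε : Idx n → B → ℤ
  φ : Idx n → B → ℤ
  e : Idx n → B → Option B
  f : Idx n → B → Option B

namespace CrystalData

variable {n : ℕ} {B B' : Type}

/-- `S` is stable under all operators `ẽ_i`, `f̃_i` (where they are not `0`), and `S` with the
restricted data satisfies the axioms of a crystal (with finite `ε_i`, `φ_i`). -/
structure IsCrystalOn (X : CrystalData n B) (S : Set B) : Prop where
  e_mem : ∀ i, ∀ b ∈ S, ∀ b', X.e i b = some b' → b' ∈ S
  f_mem : ∀ i, ∀ b ∈ S, ∀ b', X.f i b = some b' → b' ∈ S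
  φ_eq : ∀ i, ∀ b ∈ S, X.φ i b = X.ε i b + X.wt b i
  wt_e : ∀ i, ∀ b ∈ S, ∀ b', X.e i b = some b' → X.wt b' = X.wt b + simpleRoot n i
  ε_e : ∀ i, ∀ b ∈ S, ∀ b', X.e i b = some b' → X.ε i b' = X.ε i b - 1
  φ_e : ∀ i, ∀ b ∈ S, ∀ b', X.e i b = some b' → X.φ i b' = X.φ i b + 1
  wt_f : ∀ i, ∀ b ∈ S, ∀ b', X.f i b = some b' → X.wt b' = X.wt b - simpleRoot n i
  ε_f : ∀ i, ∀ b ∈ S, ∀ b', X.f i b = some b' → X.ε i b' = X.ε i b + 1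
  φ_f : ∀ i, ∀ b ∈ S, ∀ b', X.f i b = some b' → X.φ i b' = X.φ i b - 1
  e_iff_f : ∀ i, ∀ b ∈ S, ∀ b' ∈ S, X.e i b = some b' ↔ X.f i b' = some b

/-- The map `g` restricts to an isomorphism of crystals from `S` onto `S'`: both are crystals, and
`g` restricts to a bijection that preserves `wt`, `ε_i`, `φ_i` and commutes with all
operators `ẽ_i`, `f̃_i` (including the cases when these are `0`). -/
structure IsCrystalIso (X : CrystalData n B) (S : Set B) (X' : CrystalData n B') (S' : Set B')
    (g : B → B') : Prop where
  source : X.IsCrystalOn S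
  target : X'.IsCrystalOn S'
  bijOn : Set.BijOn g S S'
  wt_map : ∀ b ∈ S, X'.wt (g b) = X.wt b
  ε_map : ∀ i, ∀ b ∈ S, X'.ε i (g b) = X.ε i b
  φ_map : ∀ i, ∀ b ∈ S, X'.φ i (g b) = X.φ i b
  e_map : ∀ i, ∀ b ∈ S, X'.e i (g b) = (X.e i b).map g
  f_map : ∀ i, ∀ b ∈ S, X'.f i (g b) = (X.f i b).map g

/-- The set of all elements obtained from `b₀` by applying operators `ẽ_i`, `f̃_i`. -/
inductive Component (X : CrystalData n B) (b₀ : B) : B → Prop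
  | base : Component X b₀ b₀
  | e_step {b b' : B} (i : Idx n) : Component X b₀ b → X.e i b = some b' → Component X b₀ b'
  | f_step {b b' : B} (i : Idx n) : Component X b₀ b → X.f i b = some b' → Component X b₀ b'

end CrystalData

/-! ### The monomial crystal -/

/-- Laurent monomials in the variables `Y_{i,l}` (`i ∈ I₀`, `l ∈ ℤ`), written additively: the
monomial `∏ Y_{i,l}^{u_{i,l}}` is the finitely supported function `(i, l) ↦ u_{i,l}`. -/
abbrev Mono (n : ℕ) : Type := (Idx n × ℤ) →₀ ℤ

namespace Mono

variable {n : ℕ}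

/-- The variable `Y_{i,l}` for `1 ≤ i ≤ n`; for other `i` (in particular for `i = 0`) it is `1`. -/
noncomputable def Y (n i : ℕ) (l : ℤ) : Mono n :=
  if hi : i ∈ Set.Icc 1 n then Finsupp.single (⟨i, hi⟩, l) 1 else 0

/-- `A_{i,l} = Y_{i,l-1} Y_{i,l+1} ∏_{j ≠ i} Y_{j,l}^{C_{j,i}}`. -/
noncomputable def A (i : Idx n) (l : ℤ) : Mono n :=
  Finsupp.single (i, l - 1) 1 + Finsupp.single (i, l + 1) 1 +
    ∑ j : Idx n, if j = i then 0 else Finsupp.single (j, l) (cartan n j i)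

/-- The weight: `wt m = ∑_i (∑_l u_{i,l}) Λ_i`. -/
noncomputable def wt (m : Mono n) : Weight n :=
  fun i => m.sum fun x u => if x.1 = i then u else 0

/-- `φ_{i,L} = ∑_{l ≤ L} u_{i,l}`. -/
noncomputable def φPart (i : Idx n) (m : Mono n) (L : ℤ) : ℤ :=
  m.sum fun x u => if x.1 = i ∧ x.2 ≤ L then u else 0

/-- `ε_{i,L} = - ∑_{l ≥ L} u_{i,l}`. -/
noncomputable def εPart (i : Idx n) (m : Mono n) (L : ℤ) : ℤ :=
  -(m.sum fun x u => if x.1 = i ∧ L ≤ x.2 then u else 0)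

/-- `φ_i = max_L φ_{i,L}` (only finitely many values occur). -/
noncomputable def φ (i : Idx n) (m : Mono n) : ℤ := sSup (Set.range (φPart i m))

/-- `ε_i = max_L ε_{i,L}` (only finitely many values occur). -/
noncomputable def ε (i : Idx n) (m : Mono n) : ℤ := sSup (Set.range (εPart i m))

/-- `p_i = max {L | ε_{i,L} = ε_i}`; used only when `ε_i > 0`, and then the maximum exists. -/
noncomputable def p (i : Idx n) (m : Mono n) : ℤ := sSup {L | εPart i m L = ε i m}

/-- `q_i = min {L | φ_{i,L} = φ_i}`; used only when `φ_i > 0`, and then the minimum exists. -/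
noncomputable def q (i : Idx n) (m : Mono n) : ℤ := sInf {L | φPart i m L = φ i m}

end Mono

/-- The monomial crystal of type `D_n`. -/
noncomputable def monomialCrystal (n : ℕ) : CrystalData n (Mono n) where
  wt := Mono.wt
  ε := Mono.ε
  φ := Mono.φ
  e i m := if Mono.ε i m = 0 then none else some (m + Mono.A i (Mono.p i m - 1))
  f i m := if Mono.φ i m = 0 then none else some (m - Mono.A i (Mono.q i m + 1))

/-- `𝓜_{I₀}(M)`: all monomials obtained from `M` by applying `ẽ_i`, `f̃_i` with `i ∈ I₀`. -/
def monomialComponent (n : ℕ) (M : Mono n) : Set (Mono n) :=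
  {m | (monomialCrystal n).Component M m}

/-! ### Letters and boxes -/

/-- Letters `k` (`num k`) and `k̄` (`bar k`). -/
inductive Letter : Type
  | num (k : ℕ)
  | bar (k : ℕ)

open Letter

/-- The set `𝐁 = {1, …, n, n̄, …, 1̄}`. -/
def alphabet (n : ℕ) : Set Letter :=
  {x | ∃ k, 1 ≤ k ∧ k ≤ n ∧ (x = num k ∨ x = bar k)}

/-- The height of a letter; `n` and `n̄` have the same height. -/
def height (n : ℕ) : Letter → ℤ
  | num k => k
  | bar k => 2 * n - k

/-- The order `1 ≺ ⋯ ≺ n-1 ≺ {n, n̄} ≺ (n-1)‾ ≺ ⋯ ≺ 1̄`, in which `n` and `n̄` are not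
comparable: `prec n x y` is `x ≺ y`. -/
def prec (n : ℕ) (x y : Letter) : Prop := height n x < height n y

/-- `succeq n x y` is `x ⪰ y`. -/
def succeq (n : ℕ) (x y : Letter) : Prop := x = y ∨ prec n y x

open Mono in
/-- The monomial of the box with entry `x` and suffix `s`, with all variables `Y_{0,*}` set
to `1`. -/
noncomputable def box (n : ℕ) (x : Letter) (s : ℤ) : Mono n :=
  match x with
  | num k =>
      if k + 2 ≤ n then Y n k (s + k - 1) - Y n (k - 1) (s + k)
      else if k + 1 = n then Y n (n - 1) (s + n - 2) + Y n n (s + n - 2) - Y n (n - 2) (s + n - 1)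
      else Y n n (s + n - 2) - Y n (n - 1) (s + n)
  | bar k =>
      if k + 2 ≤ n then Y n (k - 1) (s + 2 * n - 2 - k) - Y n k (s + 2 * n - 1 - k)
      else if k + 1 = n then Y n (n - 2) (s + n - 1) - Y n (n - 1) (s + n) - Y n n (s + n)
      else Y n (n - 1) (s + n - 2) - Y n n (s + n)

/-- The target of the arrow with label `i` that starts at a letter, in the crystal graph of the
vector representation: `i → i+1` and `(i+1)‾ → i̅` for `i < n`; `n-1 → n̄` and `n → (n-1)‾` for
`i = n`.  (Letters where no such arrow starts are left unchanged.) -/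
def fLetter (n i : ℕ) : Letter → Letter
  | num k =>
      if i < n then (if k = i then num (i + 1) else num k)
      else if k = n - 1 then bar n
      else if k = n then bar (n - 1)
      else num k
  | bar k => if i < n ∧ k = i + 1 then bar i else bar k

/-- The source of the arrow with label `i` that ends at a letter.  (Letters where no such arrow
ends are left unchanged.) -/
def eLetter (n i : ℕ) : Letter → Letter
  | num k => if i < n ∧ k = i + 1 then num i else num k
  | bar k =>
      if i < n then (if k = i then bar (i + 1) else bar k)
      else if k = n then num (n - 1)
      else if k = n - 1 then num n
      else bar k

/-! ### Tableaux -/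

/-- Fillings `T = (i_1, …, i_ℓ)`.  The first column is `(i_1, …, i_h)`, the second one is
`(i_{h+1}, …, i_ℓ)`. -/
abbrev Tableau (ℓ : ℕ) : Type := Idx ℓ → Letter

/-- The suffix of the `a`-th box: `ℓ + 1 - 2a` in the first column and `ℓ + 1 - 2a - 2r` in the
second one. -/
def suffix (ℓ h r : ℕ) (a : Idx ℓ) : ℤ :=
  if a.1 ≤ h then (ℓ : ℤ) + 1 - 2 * a.1 else (ℓ : ℤ) + 1 - 2 * a.1 - 2 * r

/-- The monomial `m_T`. -/
noncomputable def mT (n ℓ h r : ℕ) (T : Tableau ℓ) : Mono n :=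
  ∑ a : Idx ℓ, box n (T a) (suffix ℓ h r a)

/-- `M_{ℓ,h,r} = Y_{h,ℓ-h} Y_{h,ℓ-h-2r}⁻¹ Y_{ℓ,-2r}` (with `Y_{0,*} = 1`). -/
noncomputable def highestMono (n ℓ h r : ℕ) : Mono n :=
  Mono.Y n h ((ℓ : ℤ) - h) - Mono.Y n h ((ℓ : ℤ) - h - 2 * r) + Mono.Y n ℓ (-(2 * (r : ℤ)))

/-- The positions whose box contains `Y_{i,q}` with exponent `1`, where `q = q_i(m_T)`. -/
noncomputable def fPositions (n ℓ h r : ℕ) (i : Idx n) (T : Tableau ℓ) : Finset (Idx ℓ) :=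
  Finset.univ.filter fun a =>
    box n (T a) (suffix ℓ h r a) (i, Mono.q i (mT n ℓ h r T)) = 1

/-- The positions whose box contains `Y_{i,p}` with exponent `-1`, where `p = p_i(m_T)`. -/
noncomputable def ePositions (n ℓ h r : ℕ) (i : Idx n) (T : Tableau ℓ) : Finset (Idx ℓ) :=
  Finset.univ.filter fun a =>
    box n (T a) (suffix ℓ h r a) (i, Mono.p i (mT n ℓ h r T)) = -1

/-- `r ≠ 0` and the set `s` of positions contains positions of both columns. -/
def Crossing {ℓ : ℕ} (h r : ℕ) (s : Finset (Idx ℓ)) : Prop :=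
  r ≠ 0 ∧ ∃ a ∈ s, ∃ b ∈ s, a.1 ≤ h ∧ h < b.1

open scoped Classical in
/-- The crystal structure on tableaux.  The data `wt`, `ε_i`, `φ_i` are those of `m_T`.  The
operator `f̃_i` replaces one entry that contributes the factor `Y_{i,q}` changed by `f̃_i` in `m_T`,
according to the arrows labelled `i` of the vector representation.  If there are two such
entries (they are then `i` and `(i+1)‾`, in this order), then the first one is replaced,
unless `r ≠ 0` and they lie in different columns; in that case the second one is replaced.  The
operator `ẽ_i` is described in the same way, the two entries then being `i+1` and `i̅`, with the
opposite choices. -/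
noncomputable def tableauCrystal (n ℓ h r : ℕ) : CrystalData n (Tableau ℓ) where
  wt T := Mono.wt (mT n ℓ h r T)
  ε i T := Mono.ε i (mT n ℓ h r T)
  φ i T := Mono.φ i (mT n ℓ h r T)
  e i T :=
    if hs : Mono.ε i (mT n ℓ h r T) ≠ 0 ∧ (ePositions n ℓ h r i T).Nonempty then
      let a := if Crossing h r (ePositions n ℓ h r i T) then (ePositions n ℓ h r i T).min' hs.2
        else (ePositions n ℓ h r i T).max' hs.2
      some (Function.update T a (eLetter n i (T a)))
    else none
  f i T :=
    if hs : Mono.φ i (mT n ℓ h r T) ≠ 0 ∧ (fPositions n ℓ h r i T).Nonempty then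
      let a := if Crossing h r (fPositions n ℓ h r i T) then (fPositions n ℓ h r i T).max' hs.2
        else (fPositions n ℓ h r i T).min' hs.2
      some (Function.update T a (fLetter n i (T a)))
    else none

/-- The set `D_{ℓ,h,r}`: tableaux with entries in `𝐁` satisfying the seven conditions below. -/
structure IsD (n ℓ h r : ℕ) (T : Tableau ℓ) : Prop where
  mem : ∀ a, T a ∈ alphabet n
  /-- `i_a ⋡ i_{a+1}` within each of the two columns. -/
  d1 : ∀ a b : Idx ℓ, b.1 = a.1 + 1 → (b.1 ≤ h ∨ h + 1 ≤ a.1) → ¬ succeq n (T a) (T b)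
  /-- No `a < b ≤ h` with `i_a = k`, `i_b = k̄`, `b - a = n - 1 - k`. -/
  d2 : ¬ ∃ (a b : Idx ℓ) (k : ℕ), a.1 < b.1 ∧ b.1 ≤ h ∧ T a = num k ∧ T b = bar k ∧
    (b.1 : ℤ) - a.1 = n - 1 - k
  /-- No `h + 1 ≤ a < b` with `i_a = k`, `i_b = k̄`, `b - a = n - 1 - k`. -/
  d3 : ¬ ∃ (a b : Idx ℓ) (k : ℕ), h + 1 ≤ a.1 ∧ a.1 < b.1 ∧ T a = num k ∧ T b = bar k ∧
    (b.1 : ℤ) - a.1 = n - 1 - k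
  /-- No `a ≤ h < b` with `i_a = k`, `i_b = k̄`, `b - a = n - max(r,1) - k`. -/
  d4 : ¬ ∃ (a b : Idx ℓ) (k : ℕ), a.1 ≤ h ∧ h + 1 ≤ b.1 ∧ T a = num k ∧ T b = bar k ∧
    (b.1 : ℤ) - a.1 = n - max (r : ℤ) 1 - k
  /-- If `i_{h+1} = k` with `1 ≤ k ≤ n-1` and `i_h ⪰ i_{h+1}`, then `i_h = k'` with
  `1 ≤ k' ≤ n-1`, and `(k'‾, (k'-1)‾, …, k̄) = (i_{b'}, i_{b'+1}, …, i_b)` for some `b'`, `b`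
  with `n - r - k < b - h ≤ n - k - 1`. -/
  d5 : ∀ (u v : Idx ℓ) (k : ℕ), u.1 = h → v.1 = h + 1 → 1 ≤ k → k ≤ n - 1 → T v = num k →
    succeq n (T u) (T v) →
    ∃ k' : ℕ, 1 ≤ k' ∧ k' ≤ n - 1 ∧ T u = num k' ∧
      ∃ b' b : Idx ℓ, b'.1 ≤ b.1 ∧ (b.1 : ℤ) - b'.1 = k' - k ∧
        (∀ c : Idx ℓ, b'.1 ≤ c.1 → c.1 ≤ b.1 →
          ∃ j : ℕ, T c = bar j ∧ (j : ℤ) = k' - (c.1 - b'.1)) ∧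
        (n : ℤ) - r - k < (b.1 : ℤ) - h ∧ (b.1 : ℤ) - h ≤ n - k - 1
  /-- If `i_{h+1} = k̄` with `1 ≤ k ≤ n-1` and `i_h ⪰ i_{h+1}`, then `i_h = k'‾` with
  `1 ≤ k' ≤ n-1`, and `(k', k'+1, …, k) = (i_{a'}, i_{a'+1}, …, i_a)` for some `a'`, `a`
  with `n - r - k ≤ h - a < n - k - 1`. -/
  d6 : ∀ (u v : Idx ℓ) (k : ℕ), u.1 = h → v.1 = h + 1 → 1 ≤ k → k ≤ n - 1 → T v = bar k →
    succeq n (T u) (T v) →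
    ∃ k' : ℕ, 1 ≤ k' ∧ k' ≤ n - 1 ∧ T u = bar k' ∧
      ∃ a' a : Idx ℓ, a'.1 ≤ a.1 ∧ (a.1 : ℤ) - a'.1 = k - k' ∧
        (∀ c : Idx ℓ, a'.1 ≤ c.1 → c.1 ≤ a.1 →
          ∃ j : ℕ, T c = num j ∧ (j : ℤ) = k' + (c.1 - a'.1)) ∧
        (n : ℤ) - r - k ≤ (h : ℤ) - a.1 ∧ (h : ℤ) - a.1 < n - k - 1
  /-- If `i_{h+1}` is `n` or `n̄`, then `i_h ⋡ i_{h+1}`. -/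
  d7 : ∀ u v : Idx ℓ, u.1 = h → v.1 = h + 1 → (T v = num n ∨ T v = bar n) →
    ¬ succeq n (T u) (T v)

/-- The set `D_{ℓ,h,r}`. -/
def tableauSet (n ℓ h r : ℕ) : Set (Tableau ℓ) := {T | IsD n ℓ h r T}

end TypeD

/-! ### The Cartan matrix of type D. -/

namespace TypeD

/-! An arrow labelled `i` multiplies the monomial of a box by the inverse of some `A_{i,l}`
(`box_fLetter`). Hence `mT` commutes with all `f̃_i` on every filling with letters in the alphabet
(`f_map_mT`). The theorem then rests on three facts about admissible tableaux.

Stability. Write `x` for the position of a box, increased by `r` in the second column. The partial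
sums of exponents of `Y_{i,*}` in `m_T` become signed counts of the letters `i`, `i+1` and their
bars beyond a coordinate (`entrySum`). The place where `f̃_i` acts is where this count reaches its
maximum for the first time in the order of the index `l`. Comparing the count there with its values
at suitable other coordinates shows that a change can violate a condition only if `T` already
violated one, or if the tie rule had chosen the other entry (`IsAdm.update_num`,
`IsAdm.update_bar`). The vertices `n-1` and `n` touch only letters of height `n-1`, `n`, `n+1`,
which enter none of the conditions on pairs (`IsAdm.update_spin`). For this purpose (D.5)–(D.7) are
recast as a statement about individual pairs `j`, `j̄` (`IsAdm`, `isD_iff_isAdm`).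

Inverse operators. The tie rule for `ẽ_i` selects the entry that `f̃_i` has just changed
(`IsAdm.isEPos_of_f`). Reading a tableau backwards with barred and unbarred letters exchanged turns
`ẽ_i` into `f̃_i` and `h` into `ℓ-h` (`tableauCrystal_e_eq_revT`, `IsAdm.revT`), so every statement
on `f̃_i` yields one on `ẽ_i`. On monomials, `ẽ_i` and `f̃_i` are mutually inverse because the
indices of the variables obey a parity rule (`monomialCrystal_e_iff_f`).

One source. The only admissible tableau with all `ε_i = 0` is `(1, …, ℓ)`
(`IsAdm.eq_highestTableau`). As `ẽ_i` lowers the sum of the heights of the letters, every admissible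
tableau is reached from this one by operators `f̃_i` (`IsAdm.induction`). Since `mT` commutes with
the operators, its image is the component of `M_{ℓ,h,r}`, and injectivity follows by climbing to the
source from two tableaux in parallel (`bijOn_mT`).

The arguments need `r ≠ 0` when both columns are nonempty. For `r = 0` the two columns merge into
one (`isAdm_zero_iff`), and `h` may be replaced by `0`. -/

theorem cartan_self {n : ℕ} (i : Idx n) : cartan n i i = 2 := by
  simp [cartan, CartanMatrix.D]

theorem cartan_of_ne {n : ℕ} (hn : 4 ≤ n) {i j : Idx n} (hij : j ≠ i) :
    cartan n j i =
      if (j.1 + 1 = i.1 ∧ i.1 < n) ∨ (i.1 + 1 = j.1 ∧ j.1 < n) ∨ (j.1 + 2 = n ∧ i.1 = n) ∨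
        (i.1 + 2 = n ∧ j.1 = n) then -1 else 0 := by
  have h₁ := i.2.1
  have h₂ := i.2.2
  have h₃ := j.2.1
  have h₄ := j.2.2
  have h₅ : j.1 ≠ i.1 := fun h => hij (Subtype.ext h)
  simp only [cartan, CartanMatrix.D, Matrix.of_apply, Fin.mk.injEq]
  split_ifs <;> first | rfl | (exfalso; omega)

/-! ### Partial sums of exponents, and the extrema that define φ, ε, q and p. -/

namespace Mono

variable {n : ℕ}

theorem wt_add (m m' : Mono n) : wt (m + m') = wt m + wt m' := by
  funext i
  exact Finsupp.sum_add_index' (fun a => by split_ifs <;> rfl) fun a b b' => by split_ifs <;> simp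

theorem wt_zero : wt (0 : Mono n) = 0 := by
  funext i; exact Finsupp.sum_zero_index

theorem wt_single (x : Idx n × ℤ) (v : ℤ) (i : Idx n) :
    wt (Finsupp.single x v) i = if x.1 = i then v else 0 :=
  Finsupp.sum_single_index (by split_ifs <;> rfl)

/-- `φPart` as an additive map. -/
noncomputable def φHom (i : Idx n) (L : ℤ) : Mono n →+ ℤ where
  toFun m := φPart i m L
  map_zero' := Finsupp.sum_zero_index
  map_add' m m' := Finsupp.sum_add_index' (fun a => by split_ifs <;> rfl)
    fun a b b' => by split_ifs <;> simp

theorem φHom_apply (i : Idx n) (L : ℤ) (m : Mono n) : φHom i L m = φPart i m L := rfl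

theorem φPart_add (i : Idx n) (m m' : Mono n) (L : ℤ) :
    φPart i (m + m') L = φPart i m L + φPart i m' L := (φHom i L).map_add m m'

theorem φPart_sub (i : Idx n) (m m' : Mono n) (L : ℤ) :
    φPart i (m - m') L = φPart i m L - φPart i m' L := (φHom i L).map_sub m m'

theorem φPart_single (i : Idx n) (x : Idx n × ℤ) (v L : ℤ) :
    φPart i (Finsupp.single x v) L = if x.1 = i ∧ x.2 ≤ L then v else 0 :=
  Finsupp.sum_single_index (by split_ifs <;> rfl)

theorem φPart_eq_add (i : Idx n) (m : Mono n) (L : ℤ) :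
    φPart i m L = φPart i m (L - 1) + m (i, L) := by
  induction m using Finsupp.induction_linear with
  | zero => simp [φPart]
  | add f g hf hg => rw [φPart_add, φPart_add, hf, hg, Finsupp.add_apply]; ring
  | single x v =>
    obtain ⟨j, l⟩ := x
    rw [φPart_single, φPart_single, Finsupp.single_apply]
    simp only [Prod.mk.injEq]
    split_ifs <;> first | omega | (exfalso; grind)

/-- A tail sum is the total minus a partial sum. All statements about `ε` and `p` can thus be read
off the single function `φPart`: `p - 1` is the last place where `φPart` is maximal, while `q` is
the first. -/
theorem εPart_eq (i : Idx n) (m : Mono n) (L : ℤ) :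
    εPart i m L = φPart i m (L - 1) - wt m i := by
  have key : ∀ m : Mono n, (m.sum fun x u => if x.1 = i ∧ L ≤ x.2 then u else 0) =
      wt m i - φPart i m (L - 1) := by
    intro m
    induction m using Finsupp.induction_linear with
    | zero => simp [φPart, wt]
    | add f g hf hg =>
      rw [Finsupp.sum_add_index' (fun a => by split_ifs <;> rfl)
        (fun a b b' => by split_ifs <;> simp), φPart_add, wt_add, hf, hg, Pi.add_apply]
      ring
    | single x v =>
      obtain ⟨j, l⟩ := x
      rw [φPart_single, wt_single, Finsupp.sum_single_index (by split_ifs <;> rfl)]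
      simp only
      split_ifs <;> first | omega | (exfalso; grind)
  rw [εPart, key]; ring

/-- As a function of `L`, the partial sum is a bounded step function, `0` on the far left and equal
to the weight on the far right. This makes the suprema and infima in the definitions genuine maxima
and minima. -/
theorem φPart_bounds (i : Idx n) (m : Mono n) :
    ∃ a b K : ℤ, (∀ L ≤ a, φPart i m L = 0) ∧ (∀ L, b ≤ L → φPart i m L = wt m i) ∧
      ∀ L, φPart i m L ≤ K := by
  induction m using Finsupp.induction_linear with
  | zero => exact ⟨0, 0, 0, by simp [φPart], by simp [φPart, wt], by simp [φPart]⟩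
  | add f g hf hg =>
    obtain ⟨a, b, K, h₁, h₂, h₃⟩ := hf
    obtain ⟨a', b', K', h₁', h₂', h₃'⟩ := hg
    refine ⟨min a a', max b b', K + K', fun L hL => ?_, fun L hL => ?_, fun L => ?_⟩
    · rw [φPart_add, h₁ L (by omega), h₁' L (by omega)]; rfl
    · rw [φPart_add, h₂ L (by omega), h₂' L (by omega), wt_add]; rfl
    · rw [φPart_add]; exact add_le_add (h₃ L) (h₃' L)
  | single x v =>
    refine ⟨x.2 - 1, x.2, max v 0, fun L hL => ?_, fun L hL => ?_, fun L => ?_⟩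
    · rw [φPart_single, if_neg (by omega)]
    · rw [φPart_single, wt_single]; simp [hL]
    · rw [φPart_single]; split_ifs <;> simp

theorem isGreatest_φ (i : Idx n) (m : Mono n) : IsGreatest (Set.range (φPart i m)) (φ i m) := by
  obtain ⟨a, b, K, -, -, h₃⟩ := φPart_bounds i m
  have hb : BddAbove (Set.range (φPart i m)) := ⟨K, by rintro _ ⟨L, rfl⟩; exact h₃ L⟩
  exact ⟨Int.csSup_mem (Set.range_nonempty _) hb, fun x hx => le_csSup hb hx⟩

theorem φPart_le (i : Idx n) (m : Mono n) (L : ℤ) : φPart i m L ≤ φ i m :=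
  (isGreatest_φ i m).2 ⟨L, rfl⟩

theorem φ_eq_of {i : Idx n} {m : Mono n} {v : ℤ} (L : ℤ) (hL : φPart i m L = v)
    (hv : ∀ L, φPart i m L ≤ v) : φ i m = v :=
  (isGreatest_φ i m).unique ⟨⟨L, hL⟩, by rintro _ ⟨L, rfl⟩; exact hv L⟩

theorem φ_nonneg (i : Idx n) (m : Mono n) : 0 ≤ φ i m := by
  obtain ⟨a, b, K, h₁, -, -⟩ := φPart_bounds i m
  exact (h₁ a le_rfl) ▸ φPart_le i m a

theorem wt_le_φ (i : Idx n) (m : Mono n) : wt m i ≤ φ i m := by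
  obtain ⟨a, b, K, -, h₂, -⟩ := φPart_bounds i m
  exact (h₂ b le_rfl) ▸ φPart_le i m b

theorem φ_eq_ε_add_wt (i : Idx n) (m : Mono n) : φ i m = ε i m + wt m i := by
  have hr : IsGreatest (Set.range (εPart i m)) (φ i m - wt m i) := by
    constructor
    · obtain ⟨L, hL⟩ := (isGreatest_φ i m).1
      exact ⟨L + 1, by rw [εPart_eq, add_sub_cancel_right, hL]⟩
    · rintro _ ⟨L, rfl⟩
      rw [εPart_eq]
      exact sub_le_sub_right (φPart_le i m _) _
  have : ε i m = φ i m - wt m i := hr.csSup_eq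
  omega

theorem ε_nonneg (i : Idx n) (m : Mono n) : 0 ≤ ε i m := by
  have h₁ := φ_eq_ε_add_wt i m
  have h₂ := wt_le_φ i m
  omega

/-- The assumption `φ i m ≠ 0` keeps the set of maximal points away from the far left, where `φPart`
is `0`; otherwise that set is unbounded below and `sInf` carries no information. -/
theorem q_spec {i : Idx n} {m : Mono n} (h : φ i m ≠ 0) :
    φPart i m (q i m) = φ i m ∧ ∀ L < q i m, φPart i m L < φ i m := by
  obtain ⟨a, b, K, h₁, -, -⟩ := φPart_bounds i m
  have hb : BddBelow {L | φPart i m L = φ i m} := ⟨a, fun L hL => by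
    by_contra hlt
    exact h (hL.symm.trans (h₁ L (by omega)))⟩
  refine ⟨Int.csInf_mem (isGreatest_φ i m).1 hb, fun L hL => lt_of_le_of_ne (φPart_le i m L) ?_⟩
  intro he
  exact absurd (csInf_le hb he) (not_le.2 hL)

theorem q_eq_of {i : Idx n} {m : Mono n} {L : ℤ} (h₁ : φPart i m L = φ i m)
    (h₂ : ∀ L' < L, φPart i m L' < φ i m) : q i m = L := by
  refine IsLeast.csInf_eq ⟨h₁, fun L' hL' => ?_⟩
  by_contra hlt
  exact (h₂ L' (by omega)).ne hL'

theorem mem_p_iff (i : Idx n) (m : Mono n) (L : ℤ) :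
    εPart i m L = ε i m ↔ φPart i m (L - 1) = φ i m := by
  rw [εPart_eq, φ_eq_ε_add_wt i m]; omega

theorem p_spec {i : Idx n} {m : Mono n} (h : ε i m ≠ 0) :
    φPart i m (p i m - 1) = φ i m ∧ ∀ L, p i m ≤ L → φPart i m L < φ i m := by
  obtain ⟨a, b, K, -, h₂, -⟩ := φPart_bounds i m
  have hφ := φ_eq_ε_add_wt i m
  have hb : BddAbove {L | εPart i m L = ε i m} := ⟨b + 1, fun L hL => by
    by_contra hlt
    have := h₂ (L - 1) (by omega)
    rw [(mem_p_iff i m L).1 hL] at this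
    omega⟩
  obtain ⟨L₀, hL₀⟩ := (isGreatest_φ i m).1
  have hne : {L | εPart i m L = ε i m}.Nonempty :=
    ⟨L₀ + 1, (mem_p_iff i m _).2 (by rwa [add_sub_cancel_right])⟩
  refine ⟨(mem_p_iff i m _).1 (Int.csSup_mem hne hb), fun L hL =>
    lt_of_le_of_ne (φPart_le i m L) fun he => ?_⟩
  have := le_csSup hb ((mem_p_iff i m (L + 1)).2 (by rwa [add_sub_cancel_right]))
  change L + 1 ≤ p i m at this
  omega

theorem p_eq_of {i : Idx n} {m : Mono n} {L : ℤ} (h₁ : φPart i m (L - 1) = φ i m)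
    (h₂ : ∀ L', L ≤ L' → φPart i m L' < φ i m) : p i m = L := by
  refine IsGreatest.csSup_eq ⟨(mem_p_iff i m L).2 h₁, fun L' hL' => ?_⟩
  by_contra hlt
  exact (h₂ (L' - 1) (by omega)).ne ((mem_p_iff i m L').1 hL')

theorem A_apply (i j : Idx n) (l l' : ℤ) :
    A i l (j, l') = if j = i then (if l' = l - 1 ∨ l' = l + 1 then 1 else 0)
      else if l' = l then cartan n j i else 0 := by
  have hs : (∑ k : Idx n, if k = i then (0 : Mono n)
      else Finsupp.single (k, l) (cartan n k i)) (j, l') =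
      if j = i then 0 else if l' = l then cartan n j i else 0 := by
    rw [Finsupp.finsetSum_apply, Finset.sum_eq_single j]
    · split_ifs <;> simp_all [eq_comm]
    · intro k _ hk
      split_ifs
      · rfl
      · rw [Finsupp.single_apply, if_neg]
        simp [hk]
    · simp
  rw [A, Finsupp.add_apply, Finsupp.add_apply, hs, Finsupp.single_apply, Finsupp.single_apply]
  by_cases hji : j = i
  · subst hji
    simp only [Prod.mk.injEq, true_and, if_true]
    split_ifs <;> omega
  · simp [hji, Ne.symm hji]

theorem wt_A (i : Idx n) (l : ℤ) : wt (A i l) = simpleRoot n i := by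
  have hs : ∀ j, wt (∑ k : Idx n, if k = i then (0 : Mono n)
      else Finsupp.single (k, l) (cartan n k i)) j = if j = i then 0 else cartan n j i := by
    intro j
    let W : Mono n →+ Weight n := ⟨⟨wt, wt_zero⟩, wt_add⟩
    change W _ j = _
    rw [map_sum, Finset.sum_apply, Finset.sum_eq_single j]
    · change wt _ j = _
      split_ifs
      · simp [wt_zero]
      · rw [wt_single, if_pos rfl]
    · intro k _ hk
      change wt _ j = _
      split_ifs
      · simp [wt_zero]
      · rw [wt_single, if_neg hk]
    · simp
  funext j
  rw [A, wt_add, wt_add, Pi.add_apply, Pi.add_apply, hs, wt_single, wt_single, simpleRoot]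
  by_cases h : j = i
  · subst h; simp [cartan_self]
  · simp [h, Ne.symm h]

theorem φPart_A (i : Idx n) (l L : ℤ) :
    φPart i (A i l) L = (if l - 1 ≤ L then 1 else 0) + (if l + 1 ≤ L then 1 else 0) := by
  have hs : φPart i (∑ k : Idx n, if k = i then (0 : Mono n)
      else Finsupp.single (k, l) (cartan n k i)) L = 0 := by
    rw [← φHom_apply, map_sum]
    refine Finset.sum_eq_zero fun k _ => ?_
    rw [φHom_apply]
    split_ifs with h
    · exact (φHom i L).map_zero
    · rw [φPart_single, if_neg (by simp [h])]
  rw [A, φPart_add, φPart_add, hs, φPart_single, φPart_single]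
  simp

/-- The parity of the vertex `i` in the (bipartite) Dynkin diagram is that of `depth i`. -/
def depth (i : Idx n) : ℤ := min i.1 (n - 1 : ℕ)

/-- The variables `Y_{i,l}` that occur in `m` satisfy `l ≡ c - depth i` modulo 2. -/
def HasParity (c : ℤ) (m : Mono n) : Prop :=
  ∀ (i : Idx n) (l : ℤ), m (i, l) ≠ 0 → (l + depth i - c) % 2 = 0

theorem HasParity.add {c : ℤ} {m m' : Mono n} (h : HasParity c m) (h' : HasParity c m') :
    HasParity c (m + m') := fun i l hne => by
  by_cases h0 : m (i, l) = 0
  · exact h' i l (by simpa [h0] using hne)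
  · exact h i l h0

theorem HasParity.neg {c : ℤ} {m : Mono n} (h : HasParity c m) : HasParity c (-m) :=
  fun i l hne => h i l (by simpa using hne)

theorem HasParity.sub {c : ℤ} {m m' : Mono n} (h : HasParity c m) (h' : HasParity c m') :
    HasParity c (m - m') := sub_eq_add_neg m m' ▸ h.add h'.neg

theorem hasParity_zero (c : ℤ) : HasParity c (0 : Mono n) := fun _ _ h => absurd rfl h

theorem hasParity_sum {c : ℤ} {ι : Type} (s : Finset ι) (g : ι → Mono n)
    (h : ∀ a ∈ s, HasParity c (g a)) : HasParity c (∑ a ∈ s, g a) :=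
  Finset.sum_induction g (HasParity c) (fun _ _ => HasParity.add) (hasParity_zero c) h

/-- Neighbours in the Dynkin diagram have depths of opposite parity, the vertices `n-1` and `n` both
having depth `n-1`. The variables of index `l ± 1` at `i` and of index `l` at its neighbours
therefore fall into one class. -/
theorem hasParity_A (hn : 4 ≤ n) {c : ℤ} {i : Idx n} {l : ℤ} (h : (l + 1 + depth i - c) % 2 = 0) :
    HasParity c (A i l) := by
  intro j l' hne
  rw [A_apply] at hne
  have h₁ := i.2.1
  have h₂ := i.2.2
  have h₃ := j.2.1
  have h₄ := j.2.2
  by_cases hji : j = i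
  · subst hji
    rw [if_pos rfl] at hne
    split_ifs at hne <;> omega
  · rw [if_neg hji, cartan_of_ne hn hji] at hne
    simp only [depth] at h ⊢
    split_ifs at hne <;> omega

end Mono

/-! ### The Kashiwara operators on monomials. -/

open Mono

variable {n : ℕ}

theorem apply_q_pos {i : Idx n} {m : Mono n} (h : φ i m ≠ 0) : 0 < m (i, q i m) := by
  obtain ⟨h₁, h₂⟩ := q_spec h
  have h₃ := φPart_eq_add i m (q i m)
  have h₄ := h₂ (q i m - 1) (by omega)
  omega

theorem apply_p_neg {i : Idx n} {m : Mono n} (h : ε i m ≠ 0) : m (i, p i m) < 0 := by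
  obtain ⟨h₁, h₂⟩ := p_spec h
  have h₃ := φPart_eq_add i m (p i m)
  have h₄ := h₂ (p i m) le_rfl
  omega

theorem monomialCrystal_f_eq {i : Idx n} {m m' : Mono n} :
    (monomialCrystal n).f i m = some m' ↔ φ i m ≠ 0 ∧ m' = m - A i (q i m + 1) := by
  simp only [monomialCrystal]
  split_ifs with h <;> simp [h, eq_comm]

theorem monomialCrystal_e_eq {i : Idx n} {m m' : Mono n} :
    (monomialCrystal n).e i m = some m' ↔ ε i m ≠ 0 ∧ m' = m + A i (p i m - 1) := by
  simp only [monomialCrystal]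
  split_ifs with h <;> simp [h, eq_comm]

/-- Dividing by `A_{i,q+1}` lowers the partial sums by `1` from `q` on and by a further `1` from
`q+2` on. To the left of `q` they were at most `φ - 1` already, because `q` is the first maximum. -/
theorem φ_f {i : Idx n} {m : Mono n} (h : φ i m ≠ 0) :
    φ i (m - A i (q i m + 1)) = φ i m - 1 := by
  obtain ⟨h₁, h₂⟩ := q_spec h
  refine φ_eq_of (q i m) ?_ fun L => ?_
  · rw [φPart_sub, φPart_A, h₁, if_pos (by omega), if_neg (by omega)]; ring
  · rw [φPart_sub, φPart_A]
    have h₃ := φPart_le i m L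
    have h₄ := h₂ L
    split_ifs <;> omega

theorem ε_f {i : Idx n} {m : Mono n} (h : φ i m ≠ 0) :
    ε i (m - A i (q i m + 1)) = ε i m + 1 := by
  have h₁ := φ_eq_ε_add_wt i m
  have h₂ := φ_eq_ε_add_wt i (m - A i (q i m + 1))
  have h₃ := wt_add (m - A i (q i m + 1)) (A i (q i m + 1))
  rw [sub_add_cancel, wt_A] at h₃
  have h₄ := congrFun h₃ i
  simp only [Pi.add_apply, simpleRoot, cartan_self] at h₄
  rw [φ_f h] at h₂
  omega

/-- Parity enters here: `Y_{i,q+1}` cannot occur, so the partial sum at `q+1` equals that at `q` and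
the lowered maximum is still attained at `q+1`. From `q+2` on it is no longer attained. -/
theorem p_f {c : ℤ} {i : Idx n} {m : Mono n} (hm : HasParity c m) (h : φ i m ≠ 0) :
    p i (m - A i (q i m + 1)) = q i m + 2 := by
  obtain ⟨h₁, h₂⟩ := q_spec h
  have hq := hm i _ (apply_q_pos h).ne'
  have h₃ := φPart_eq_add i m (q i m + 1)
  have h₀ : m (i, q i m + 1) = 0 := by
    by_contra hne
    have := hm i _ hne
    omega
  rw [h₀, add_sub_cancel_right, h₁] at h₃
  refine p_eq_of ?_ fun L hL => ?_
  · rw [φ_f h, φPart_sub, φPart_A, show q i m + 2 - 1 = q i m + 1 by ring, h₃, if_pos (by omega),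
      if_neg (by omega)]
    ring
  · rw [φ_f h, φPart_sub, φPart_A, if_pos (by omega), if_pos (by omega)]
    have := φPart_le i m L
    omega

/-- The mirror image of `p_f`: by parity the last maximum `p-1` is shared by `p-2`, and multiplying
by `A_{i,p-1}` makes `p-2` the first point of the new, larger maximum. -/
theorem φ_e_q_e {c : ℤ} {i : Idx n} {m : Mono n} (hm : HasParity c m) (h : ε i m ≠ 0) :
    φ i (m + A i (p i m - 1)) = φ i m + 1 ∧ q i (m + A i (p i m - 1)) = p i m - 2 := by
  obtain ⟨h₁, h₂⟩ := p_spec h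
  have hp := hm i _ (apply_p_neg h).ne
  have h₃ := φPart_eq_add i m (p i m - 1)
  have h₀ : m (i, p i m - 1) = 0 := by
    by_contra hne
    have := hm i _ hne
    omega
  rw [h₀, h₁, show p i m - 1 - 1 = p i m - 2 by ring] at h₃
  have h₄ : φPart i (m + A i (p i m - 1)) (p i m - 2) = φ i m + 1 := by
    rw [φPart_add, φPart_A, if_pos (by omega), if_neg (by omega)]
    omega
  have h₅ : φ i (m + A i (p i m - 1)) = φ i m + 1 := by
    refine φ_eq_of _ h₄ fun L => ?_
    rw [φPart_add, φPart_A]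
    have h₅ := φPart_le i m L
    have h₆ := h₂ L
    split_ifs <;> omega
  refine ⟨h₅, q_eq_of (h₄.trans h₅.symm) fun L hL => ?_⟩
  rw [h₅, φPart_add, φPart_A, if_neg (by omega), if_neg (by omega)]
  have := φPart_le i m L
  omega

theorem monomialCrystal_e_iff_f {c : ℤ} {i : Idx n} {m m' : Mono n} (hm : HasParity c m)
    (hm' : HasParity c m') :
    (monomialCrystal n).e i m = some m' ↔ (monomialCrystal n).f i m' = some m := by
  rw [monomialCrystal_e_eq, monomialCrystal_f_eq]
  constructor
  · rintro ⟨h, rfl⟩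
    obtain ⟨h₁, h₂⟩ := φ_e_q_e hm h
    have := φ_nonneg i m
    refine ⟨by omega, ?_⟩
    rw [h₂, show p i m - 2 + 1 = p i m - 1 by ring, add_sub_cancel_right]
  · rintro ⟨h, rfl⟩
    have h₁ := ε_f h
    have := ε_nonneg i m'
    refine ⟨by omega, ?_⟩
    rw [p_f hm' h, show q i m' + 2 - 1 = q i m' + 1 by ring, sub_add_cancel]

theorem HasParity.f {c : ℤ} (hn : 4 ≤ n) {i : Idx n} {m m' : Mono n} (hm : HasParity c m)
    (h : (monomialCrystal n).f i m = some m') : HasParity c m' := by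
  obtain ⟨h₀, rfl⟩ := monomialCrystal_f_eq.1 h
  have := hm i _ (apply_q_pos h₀).ne'
  exact hm.sub (hasParity_A hn (by omega))

theorem HasParity.e {c : ℤ} (hn : 4 ≤ n) {i : Idx n} {m m' : Mono n} (hm : HasParity c m)
    (h : (monomialCrystal n).e i m = some m') : HasParity c m' := by
  obtain ⟨h₀, rfl⟩ := monomialCrystal_e_eq.1 h
  have := hm i _ (apply_p_neg h₀).ne
  exact hm.add (hasParity_A hn (by omega))

/-- The axioms for `ẽ_i` at `b` are those for `f̃_i` at the image, read backwards through the
inverse relation. -/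
theorem CrystalData.IsCrystalOn.of_f {B : Type} {X : CrystalData n B} {S : Set B}
    (e_mem : ∀ i, ∀ b ∈ S, ∀ b', X.e i b = some b' → b' ∈ S)
    (f_mem : ∀ i, ∀ b ∈ S, ∀ b', X.f i b = some b' → b' ∈ S)
    (φ_eq : ∀ i, ∀ b ∈ S, X.φ i b = X.ε i b + X.wt b i)
    (wt_f : ∀ i, ∀ b ∈ S, ∀ b', X.f i b = some b' → X.wt b' = X.wt b - simpleRoot n i)
    (ε_f : ∀ i, ∀ b ∈ S, ∀ b', X.f i b = some b' → X.ε i b' = X.ε i b + 1)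
    (φ_f : ∀ i, ∀ b ∈ S, ∀ b', X.f i b = some b' → X.φ i b' = X.φ i b - 1)
    (e_iff_f : ∀ i, ∀ b ∈ S, ∀ b' ∈ S, X.e i b = some b' ↔ X.f i b' = some b) :
    X.IsCrystalOn S where
  e_mem := e_mem
  f_mem := f_mem
  φ_eq := φ_eq
  wt_e i b hb b' h := by
    have hb' := e_mem i b hb b' h
    rw [wt_f i b' hb' b ((e_iff_f i b hb b' hb').1 h), sub_add_cancel]
  ε_e i b hb b' h := by
    have hb' := e_mem i b hb b' h
    rw [ε_f i b' hb' b ((e_iff_f i b hb b' hb').1 h), add_sub_cancel_right]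
  φ_e i b hb b' h := by
    have hb' := e_mem i b hb b' h
    rw [φ_f i b' hb' b ((e_iff_f i b hb b' hb').1 h), sub_add_cancel]
  wt_f := wt_f
  ε_f := ε_f
  φ_f := φ_f
  e_iff_f := e_iff_f

theorem isCrystalOn_monomialComponent (hn : 4 ≤ n) {c : ℤ} {M : Mono n} (hM : HasParity c M) :
    (monomialCrystal n).IsCrystalOn (monomialComponent n M) := by
  have hP : ∀ m ∈ monomialComponent n M, HasParity c m := by
    intro m hm
    induction hm with
    | base => exact hM
    | e_step i _ h ih => exact HasParity.e hn ih h
    | f_step i _ h ih => exact HasParity.f hn ih h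
  refine CrystalData.IsCrystalOn.of_f (fun i b hb b' h => .e_step i hb h)
    (fun i b hb b' h => .f_step i hb h) (fun i b _ => φ_eq_ε_add_wt i b) ?_ ?_ ?_
    fun i b hb b' hb' => monomialCrystal_e_iff_f (hP b hb) (hP b' hb')
  all_goals
    intro i b hb b' h
    obtain ⟨h₀, rfl⟩ := monomialCrystal_f_eq.1 h
  · have h₃ := wt_add (b - A i (q i b + 1)) (A i (q i b + 1))
    rw [sub_add_cancel, wt_A] at h₃
    exact eq_sub_of_add_eq h₃.symm
  · exact TypeD.ε_f h₀
  · exact TypeD.φ_f h₀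

end TypeD

/-! ### Boxes, and the effect of an arrow on a box. -/

namespace TypeD

open Mono Letter

variable {n : ℕ}

noncomputable instance : DecidableEq Letter := Classical.decEq _

namespace Mono

theorem Y_apply (j : ℕ) (l : ℤ) (i : Idx n) (l' : ℤ) :
    Y n j l (i, l') = if j = i.1 ∧ l = l' then 1 else 0 := by
  have hi := i.2
  unfold Y
  split_ifs with h₁ h₂ h₂
  · obtain ⟨rfl, rfl⟩ := h₂
    exact Finsupp.single_eq_same
  · rw [Finsupp.single_apply, if_neg]
    rintro h
    rw [Prod.mk.injEq, Subtype.ext_iff] at h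
    exact h₂ h
  · exact absurd (h₂.1 ▸ hi) h₁
  · rfl

theorem φPart_Y (i : Idx n) (j : ℕ) (l L : ℤ) :
    φPart i (Y n j l) L = if j = i.1 ∧ l ≤ L then 1 else 0 := by
  have hi := i.2
  unfold Y
  split_ifs with h₁ h₂ h₂
  · obtain ⟨rfl, h₂⟩ := h₂
    rw [φPart_single, if_pos ⟨rfl, h₂⟩]
  · rw [φPart_single, if_neg]
    rintro ⟨rfl, h₃⟩
    exact h₂ ⟨rfl, h₃⟩
  · exact absurd (h₂.1 ▸ hi) h₁
  · exact (φHom i L).map_zero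

/-- This lemma and the next two give the three shapes of `A_{i,l}`: on the tail, at the branching
vertex and at the two ends of the fork. `Y n 0` is `0` in additive notation, so the vertex `1` needs
no separate treatment. -/
theorem A_eq_of_lt (hn : 4 ≤ n) {i : Idx n} (hi : i.1 + 3 ≤ n) (l : ℤ) :
    A i l = Y n i (l - 1) + Y n i (l + 1) - Y n (i.1 - 1) l - Y n (i.1 + 1) l := by
  have h₁ := i.2.1
  ext ⟨j, l'⟩
  have h₃ := j.2.1
  have h₄ := j.2.2
  simp only [Finsupp.sub_apply, Finsupp.add_apply, Y_apply, A_apply]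
  by_cases hji : j = i
  · subst hji
    simp only [if_true, true_and]
    split_ifs <;> omega
  · rw [if_neg hji, cartan_of_ne hn hji]
    have : i.1 ≠ j.1 := fun h => hji (Subtype.ext h.symm)
    split_ifs <;> omega

theorem A_eq_branch (hn : 4 ≤ n) {i : Idx n} (hi : i.1 + 2 = n) (l : ℤ) :
    A i l = Y n (n - 2) (l - 1) + Y n (n - 2) (l + 1) - Y n (n - 3) l - Y n (n - 1) l
      - Y n n l := by
  have h₁ := i.2.1
  ext ⟨j, l'⟩
  have h₃ := j.2.1
  have h₄ := j.2.2
  simp only [Finsupp.sub_apply, Finsupp.add_apply, Y_apply, A_apply]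
  by_cases hji : j = i
  · subst hji
    simp only [if_true]
    split_ifs <;> omega
  · rw [if_neg hji, cartan_of_ne hn hji]
    have : i.1 ≠ j.1 := fun h => hji (Subtype.ext h.symm)
    split_ifs <;> omega

theorem A_eq_of_ge (hn : 4 ≤ n) {i : Idx n} (hi : n ≤ i.1 + 1) (l : ℤ) :
    A i l = Y n i (l - 1) + Y n i (l + 1) - Y n (n - 2) l := by
  have h₁ := i.2.1
  have h₂ := i.2.2
  ext ⟨j, l'⟩
  have h₃ := j.2.1
  have h₄ := j.2.2
  simp only [Finsupp.sub_apply, Finsupp.add_apply, Y_apply, A_apply]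
  by_cases hji : j = i
  · subst hji
    simp only [if_true, true_and]
    split_ifs <;> omega
  · rw [if_neg hji, cartan_of_ne hn hji]
    have : i.1 ≠ j.1 := fun h => hji (Subtype.ext h.symm)
    split_ifs <;> omega

end Mono

theorem num_mem_alphabet {k : ℕ} : num k ∈ alphabet n ↔ 1 ≤ k ∧ k ≤ n := by
  constructor
  · rintro ⟨k', h₁, h₂, h | h⟩ <;> cases h
    exact ⟨h₁, h₂⟩
  · exact fun h => ⟨k, h.1, h.2, Or.inl rfl⟩

theorem bar_mem_alphabet {k : ℕ} : bar k ∈ alphabet n ↔ 1 ≤ k ∧ k ≤ n := by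
  constructor
  · rintro ⟨k', h₁, h₂, h | h⟩ <;> cases h
    exact ⟨h₁, h₂⟩
  · exact fun h => ⟨k, h.1, h.2, Or.inr rfl⟩

/-- Only four letters involve `Y_{i,*}`. The formula is uniform in `i < n`, including `i = n-1`,
where the letters are `n-1`, `n` and their bars; only the vertex `n` needs another formula. -/
theorem φPart_box_of_lt (hn : 4 ≤ n) {x : Letter} (hx : x ∈ alphabet n) {i : Idx n} (hi : i.1 < n)
    (s L : ℤ) :
    φPart i (box n x s) L =
      (if x = num i ∧ s + i - 1 ≤ L then 1 else 0) -
        (if x = num (i + 1) ∧ s + i + 1 ≤ L then 1 else 0) +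
      (if x = bar (i + 1) ∧ s + 2 * n - 3 - i ≤ L then 1 else 0) -
        (if x = bar i ∧ s + 2 * n - 1 - i ≤ L then 1 else 0) := by
  have h₁ := i.2.1
  obtain ⟨k, hk₁, hk₂, rfl | rfl⟩ := hx <;> unfold box <;>
    simp only [num.injEq, bar.injEq, reduceCtorEq, false_and, if_false]
  all_goals
    by_cases hk : k + 2 ≤ n
    · rw [if_pos hk]
      simp only [φPart_sub, φPart_Y]
      split_ifs <;> omega
    · rw [if_neg hk]
      by_cases hk' : k + 1 = n
      · rw [if_pos hk']
        simp only [φPart_sub, φPart_add, φPart_Y]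
        split_ifs <;> omega
      · rw [if_neg hk']
        simp only [φPart_sub, φPart_Y]
        split_ifs <;> omega

theorem φPart_box_last (hn : 4 ≤ n) {x : Letter} (hx : x ∈ alphabet n) {i : Idx n} (hi : i.1 = n)
    (s L : ℤ) :
    φPart i (box n x s) L =
      (if (x = num (n - 1) ∨ x = num n) ∧ s + n - 2 ≤ L then 1 else 0) -
        (if (x = bar n ∨ x = bar (n - 1)) ∧ s + n ≤ L then 1 else 0) := by
  obtain ⟨k, hk₁, hk₂, rfl | rfl⟩ := hx <;> unfold box <;>
    simp only [num.injEq, bar.injEq, reduceCtorEq, false_and, or_self, if_false]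
  all_goals
    by_cases hk : k + 2 ≤ n
    · rw [if_pos hk]
      simp only [φPart_sub, φPart_Y]
      split_ifs <;> omega
    · rw [if_neg hk]
      by_cases hk' : k + 1 = n
      · rw [if_pos hk']
        simp only [φPart_sub, φPart_add, φPart_Y]
        split_ifs <;> omega
      · rw [if_neg hk']
        simp only [φPart_sub, φPart_Y]
        split_ifs <;> omega

theorem box_apply_of_lt (hn : 4 ≤ n) {x : Letter} (hx : x ∈ alphabet n) {i : Idx n} (hi : i.1 < n)
    (s l : ℤ) :
    box n x s (i, l) =
      (if x = num i ∧ l = s + i - 1 then 1 else 0) -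
        (if x = num (i + 1) ∧ l = s + i + 1 then 1 else 0) +
      (if x = bar (i + 1) ∧ l = s + 2 * n - 3 - i then 1 else 0) -
        (if x = bar i ∧ l = s + 2 * n - 1 - i then 1 else 0) := by
  -- An exponent is the jump of the partial sum at its index, so the formula for the partial sums
  -- gives the exponents.
  have h₁ := φPart_eq_add i (box n x s) l
  rw [φPart_box_of_lt hn hx hi, φPart_box_of_lt hn hx hi] at h₁
  obtain ⟨k, hk₁, hk₂, rfl | rfl⟩ := hx <;>
    simp only [num.injEq, bar.injEq, reduceCtorEq, false_and, if_false] at h₁ ⊢ <;>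
    split_ifs at h₁ ⊢ <;> omega

theorem box_apply_last (hn : 4 ≤ n) {x : Letter} (hx : x ∈ alphabet n) {i : Idx n} (hi : i.1 = n)
    (s l : ℤ) :
    box n x s (i, l) =
      (if (x = num (n - 1) ∨ x = num n) ∧ l = s + n - 2 then 1 else 0) -
        (if (x = bar n ∨ x = bar (n - 1)) ∧ l = s + n then 1 else 0) := by
  have h₁ := φPart_eq_add i (box n x s) l
  rw [φPart_box_last hn hx hi, φPart_box_last hn hx hi] at h₁
  obtain ⟨k, hk₁, hk₂, rfl | rfl⟩ := hx <;>
    simp only [num.injEq, bar.injEq, reduceCtorEq, false_and, or_self, if_false] at h₁ ⊢ <;>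
    split_ifs at h₁ ⊢ <;> omega

theorem box_eq_one_of_lt (hn : 4 ≤ n) {x : Letter} (hx : x ∈ alphabet n) {i : Idx n}
    (hi : i.1 < n) {s l : ℤ} :
    box n x s (i, l) = 1 ↔
      x = num i ∧ l = s + i - 1 ∨ x = bar (i + 1) ∧ l = s + 2 * n - 3 - i := by
  rw [box_apply_of_lt hn hx hi]
  obtain ⟨k, hk₁, hk₂, rfl | rfl⟩ := hx <;>
    simp only [num.injEq, bar.injEq, reduceCtorEq, false_and, or_false, false_or, if_false] <;>
    split_ifs <;> constructor <;> intro h <;> omega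

theorem box_eq_neg_one_of_lt (hn : 4 ≤ n) {x : Letter} (hx : x ∈ alphabet n) {i : Idx n}
    (hi : i.1 < n) {s l : ℤ} :
    box n x s (i, l) = -1 ↔
      x = num (i + 1) ∧ l = s + i + 1 ∨ x = bar i ∧ l = s + 2 * n - 1 - i := by
  rw [box_apply_of_lt hn hx hi]
  obtain ⟨k, hk₁, hk₂, rfl | rfl⟩ := hx <;>
    simp only [num.injEq, bar.injEq, reduceCtorEq, false_and, or_false, false_or, if_false] <;>
    split_ifs <;> constructor <;> intro h <;> omega

theorem box_eq_one_last (hn : 4 ≤ n) {x : Letter} (hx : x ∈ alphabet n) {i : Idx n}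
    (hi : i.1 = n) {s l : ℤ} :
    box n x s (i, l) = 1 ↔ (x = num (n - 1) ∨ x = num n) ∧ l = s + n - 2 := by
  rw [box_apply_last hn hx hi]
  obtain ⟨k, hk₁, hk₂, rfl | rfl⟩ := hx <;>
    simp only [num.injEq, bar.injEq, reduceCtorEq, false_and, or_self, if_false] <;>
    split_ifs <;> constructor <;> intro h <;> first | assumption | contradiction | omega

theorem box_eq_neg_one_last (hn : 4 ≤ n) {x : Letter} (hx : x ∈ alphabet n) {i : Idx n}
    (hi : i.1 = n) {s l : ℤ} :
    box n x s (i, l) = -1 ↔ (x = bar n ∨ x = bar (n - 1)) ∧ l = s + n := by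
  rw [box_apply_last hn hx hi]
  obtain ⟨k, hk₁, hk₂, rfl | rfl⟩ := hx <;>
    simp only [num.injEq, bar.injEq, reduceCtorEq, false_and, or_self, if_false] <;>
    split_ifs <;> constructor <;> intro h <;> first | assumption | contradiction | omega

theorem box_le_one (hn : 4 ≤ n) {x : Letter} (hx : x ∈ alphabet n) (i : Idx n) (s l : ℤ) :
    box n x s (i, l) ≤ 1 := by
  rcases i.2.2.lt_or_eq with hi | hi
  · rw [box_apply_of_lt hn hx hi]
    obtain ⟨k, hk₁, hk₂, rfl | rfl⟩ := hx <;>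
      simp only [num.injEq, bar.injEq, reduceCtorEq, false_and, if_false] <;>
      split_ifs <;> omega
  · rw [box_apply_last hn hx hi]
    split_ifs <;> omega

theorem hasParity_box (hn : 4 ≤ n) {x : Letter} (hx : x ∈ alphabet n) (s : ℤ) :
    HasParity (s + 1) (box n x s) := by
  intro i l hne
  have h₁ := i.2.1
  have h₂ := i.2.2
  unfold depth
  rcases i.2.2.lt_or_eq with hi | hi
  · rw [box_apply_of_lt hn hx hi] at hne
    split_ifs at hne <;> omega
  · rw [box_apply_last hn hx hi] at hne
    split_ifs at hne <;> omega

/-- The bridge between the two crystals: following the arrow at a box that contains `Y_{i,q}`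
divides its monomial by `A_{i,q+1}`, exactly the change that `f̃_i` makes to a monomial. -/
theorem box_fLetter (hn : 4 ≤ n) {x : Letter} (hx : x ∈ alphabet n) {i : Idx n} {s q : ℤ}
    (h : box n x s (i, q) = 1) :
    fLetter n i x ∈ alphabet n ∧ eLetter n i (fLetter n i x) = x ∧
      box n (fLetter n i x) s = box n x s - A i (q + 1) := by
  have h₁ := i.2.1
  rcases i.2.2.lt_or_eq with hi | hi
  · rw [box_eq_one_of_lt hn hx hi] at h
    rcases h with ⟨rfl, rfl⟩ | ⟨rfl, rfl⟩
    · refine ⟨?_, ?_, ?_⟩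
      · simp only [fLetter, if_pos hi, if_true]
        exact num_mem_alphabet.2 (by omega)
      · simp [fLetter, eLetter, hi]
      simp only [fLetter, if_pos hi, if_true, box]
      rcases (by omega : i.1 + 3 ≤ n ∨ i.1 + 2 = n ∨ i.1 + 1 = n) with h | h | h
      · rw [if_pos (by omega), if_pos (by omega), A_eq_of_lt hn h]
        push_cast
        rw [show s + (i.1 + 1 : ℤ) - 1 = s + i by ring, show s + (i.1 + 1 : ℤ) = s + i + 1 by ring,
          show s + (i.1 : ℤ) - 1 + 1 = s + i by ring]
        abel
      · rw [if_neg (by omega), if_pos (by omega), if_pos (by omega), A_eq_branch hn h]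
        rw [show (n : ℤ) = i.1 + 2 by omega, show i.1 = n - 2 by omega,
          show n - 2 - 1 = n - 3 by omega]
        rw [show s + ((n - 2 : ℕ) : ℤ) - 1 + 1 = s + ((n - 2 : ℕ) : ℤ) by ring,
          show s + (((n - 2 : ℕ) : ℤ) + 2) - 2 = s + ((n - 2 : ℕ) : ℤ) by ring,
          show s + (((n - 2 : ℕ) : ℤ) + 2) - 1 = s + ((n - 2 : ℕ) : ℤ) + 1 by ring]
        abel
      · rw [if_neg (by omega), if_neg (by omega), if_neg (by omega), if_pos (by omega),
          A_eq_of_ge hn (by omega)]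
        rw [show (n : ℤ) = i.1 + 1 by omega, show i.1 = n - 1 by omega]
        rw [show s + ((n - 1 : ℕ) : ℤ) - 1 + 1 = s + ((n - 1 : ℕ) : ℤ) by ring,
          show s + (((n - 1 : ℕ) : ℤ) + 1) - 2 = s + ((n - 1 : ℕ) : ℤ) - 1 by ring,
          show s + (((n - 1 : ℕ) : ℤ) + 1) - 1 = s + ((n - 1 : ℕ) : ℤ) by ring,
          show s + (((n - 1 : ℕ) : ℤ) + 1) = s + ((n - 1 : ℕ) : ℤ) + 1 by ring]
        abel
    · refine ⟨?_, ?_, ?_⟩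
      · simp only [fLetter, hi, true_and, if_true]
        exact bar_mem_alphabet.2 (by omega)
      · simp [fLetter, eLetter, hi]
      simp only [fLetter, hi, true_and, if_true, box]
      rcases (by omega : i.1 + 3 ≤ n ∨ i.1 + 2 = n ∨ i.1 + 1 = n) with h | h | h
      · rw [if_pos (by omega), if_pos (by omega), A_eq_of_lt hn h]
        push_cast
        rw [show s + 2 * (n : ℤ) - 3 - i.1 + 1 - 1 = s + 2 * n - 2 - (i.1 + 1) by ring,
          show s + 2 * (n : ℤ) - 3 - i.1 + 1 = s + 2 * n - 2 - i.1 by ring,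
          show s + 2 * (n : ℤ) - 1 - (i.1 + 1) = s + 2 * n - 2 - i.1 by ring,
          show s + 2 * (n : ℤ) - 2 - i.1 + 1 = s + 2 * n - 1 - i.1 by ring]
        abel
      · rw [if_pos (by omega), if_neg (by omega), if_pos (by omega), A_eq_branch hn h]
        rw [show i.1 - 1 = n - 3 by omega, show i.1 = n - 2 by omega,
          show ((n - 2 : ℕ) : ℤ) = n - 2 by omega]
        generalize (n : ℤ) = k
        rw [show s + 2 * k - 3 - (k - 2) + 1 - 1 = s + k - 1 by ring,
          show s + 2 * k - 3 - (k - 2) + 1 + 1 = s + k + 1 by ring,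
          show s + 2 * k - 3 - (k - 2) + 1 = s + k by ring,
          show s + 2 * k - 2 - (k - 2) = s + k by ring,
          show s + 2 * k - 1 - (k - 2) = s + k + 1 by ring]
        abel
      · rw [if_neg (by omega), if_pos (by omega), if_neg (by omega), if_neg (by omega),
          A_eq_of_ge hn (by omega)]
        rw [show i.1 = n - 1 by omega, show ((n - 1 : ℕ) : ℤ) = n - 1 by omega]
        generalize (n : ℤ) = k
        rw [show s + 2 * k - 3 - (k - 1) + 1 - 1 = s + k - 2 by ring,
          show s + 2 * k - 3 - (k - 1) + 1 + 1 = s + k by ring,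
          show s + 2 * k - 3 - (k - 1) + 1 = s + k - 1 by ring]
        abel
  · rw [box_eq_one_last hn hx hi] at h
    have e₁ : s + (n : ℤ) - 2 + 1 = s + n - 1 := by ring
    have e₂ : s + (n : ℤ) - 1 - 1 = s + n - 2 := by ring
    have e₃ : s + (n : ℤ) - 1 + 1 = s + n := by ring
    obtain ⟨rfl | rfl, rfl⟩ := h
    · have hf : fLetter n i (num (n - 1)) = bar n := by simp [fLetter, hi]
      rw [hf]
      refine ⟨bar_mem_alphabet.2 (by omega), by simp [eLetter, hi], ?_⟩
      rw [A_eq_of_ge hn (by omega), hi, e₁, e₂, e₃]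
      simp only [box]
      rw [if_neg (by omega), if_neg (by omega), if_neg (by omega), if_pos (by omega)]
      abel
    · have hf : fLetter n i (num n) = bar (n - 1) := by
        simp only [fLetter, hi, lt_irrefl, if_false, if_true]
        rw [if_neg (by omega)]
      rw [hf]
      refine ⟨bar_mem_alphabet.2 (by omega), ?_, ?_⟩
      · simp only [eLetter, hi, lt_irrefl, if_false, if_true]
        rw [if_neg (by omega)]
      rw [A_eq_of_ge hn (by omega), hi, e₁, e₂, e₃]
      simp only [box]
      rw [if_neg (by omega), if_pos (by omega), if_neg (by omega), if_neg (by omega)]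
      abel

end TypeD

/-! ### Fillings, their monomials and the position where an operator acts. -/

namespace TypeD

open Mono Letter

variable {n ℓ h r : ℕ}

/-- The position of a box, where the second column is shifted by `r`. -/
def xcoord (h r : ℕ) (a : Idx ℓ) : ℤ := if a.1 ≤ h then a.1 else a.1 + r

theorem xcoord_of_le {a : Idx ℓ} (ha : a.1 ≤ h) : xcoord h r a = a.1 := if_pos ha

theorem xcoord_of_lt {a : Idx ℓ} (ha : h < a.1) : xcoord h r a = a.1 + r := if_neg (by omega)

theorem suffix_eq (a : Idx ℓ) : suffix ℓ h r a = ℓ + 1 - 2 * xcoord h r a := by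
  unfold suffix xcoord
  split_ifs <;> ring

theorem xcoord_lt {a b : Idx ℓ} (hab : a.1 < b.1) : xcoord h r a < xcoord h r b := by
  unfold xcoord
  split_ifs <;> omega

theorem xcoord_injective {a b : Idx ℓ} (hab : xcoord h r a = xcoord h r b) : a = b := by
  refine Subtype.ext ?_
  unfold xcoord at hab
  split_ifs at hab <;> omega

theorem mT_update (T : Tableau ℓ) (a : Idx ℓ) (y : Letter) :
    mT n ℓ h r (Function.update T a y) =
      mT n ℓ h r T - box n (T a) (suffix ℓ h r a) + box n y (suffix ℓ h r a) := by
  unfold mT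
  rw [← Finset.add_sum_erase _ _ (Finset.mem_univ a), ← Finset.add_sum_erase _ _ (Finset.mem_univ a),
    Function.update_self,
    Finset.sum_congr rfl fun b hb => by rw [Function.update_of_ne (Finset.ne_of_mem_erase hb)]]
  abel

theorem mT_apply (T : Tableau ℓ) (x : Idx n × ℤ) :
    mT n ℓ h r T x = ∑ a : Idx ℓ, box n (T a) (suffix ℓ h r a) x := by
  rw [mT, Finsupp.finsetSum_apply]

theorem φPart_mT (T : Tableau ℓ) (i : Idx n) (L : ℤ) :
    φPart i (mT n ℓ h r T) L = ∑ a : Idx ℓ, φPart i (box n (T a) (suffix ℓ h r a)) L :=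
  map_sum (φHom i L) _ _

/-- All suffixes are congruent to `ℓ + 1` modulo 2, as the shift of the second column is the even
number `2r`. -/
theorem hasParity_mT (hn : 4 ≤ n) {T : Tableau ℓ} (hT : ∀ a, T a ∈ alphabet n) :
    HasParity ℓ (mT n ℓ h r T) := by
  refine hasParity_sum _ _ fun a _ i l hne => ?_
  have h₁ := hasParity_box hn (hT a) _ i l hne
  rw [suffix_eq] at h₁
  omega

/-- The position `a` is the one at which `f̃_i` changes `T`. -/
structure IsFPos (n ℓ h r : ℕ) (i : Idx n) (T : Tableau ℓ) (a : Idx ℓ) : Prop where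
  mem : a ∈ fPositions n ℓ h r i T
  le : ∀ b ∈ fPositions n ℓ h r i T, Crossing h r (fPositions n ℓ h r i T) → b ≤ a
  ge : ∀ b ∈ fPositions n ℓ h r i T, ¬ Crossing h r (fPositions n ℓ h r i T) → a ≤ b

/-- The position `a` is the one at which `ẽ_i` changes `T`. -/
structure IsEPos (n ℓ h r : ℕ) (i : Idx n) (T : Tableau ℓ) (a : Idx ℓ) : Prop where
  mem : a ∈ ePositions n ℓ h r i T
  ge : ∀ b ∈ ePositions n ℓ h r i T, Crossing h r (ePositions n ℓ h r i T) → a ≤ b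
  le : ∀ b ∈ ePositions n ℓ h r i T, ¬ Crossing h r (ePositions n ℓ h r i T) → b ≤ a

theorem mem_fPositions {i : Idx n} {T : Tableau ℓ} {a : Idx ℓ} :
    a ∈ fPositions n ℓ h r i T ↔
      box n (T a) (suffix ℓ h r a) (i, q i (mT n ℓ h r T)) = 1 := by
  simp [fPositions]

theorem mem_ePositions {i : Idx n} {T : Tableau ℓ} {a : Idx ℓ} :
    a ∈ ePositions n ℓ h r i T ↔
      box n (T a) (suffix ℓ h r a) (i, p i (mT n ℓ h r T)) = -1 := by
  simp [ePositions]

theorem tableauCrystal_f_eq {i : Idx n} {T T' : Tableau ℓ} :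
    (tableauCrystal n ℓ h r).f i T = some T' ↔ φ i (mT n ℓ h r T) ≠ 0 ∧
      ∃ a, IsFPos n ℓ h r i T a ∧ T' = Function.update T a (fLetter n i (T a)) := by
  simp only [tableauCrystal]
  split_ifs with hs hc
  · rw [Option.some.injEq]
    constructor
    · rintro rfl
      exact ⟨hs.1, _, ⟨Finset.max'_mem _ _, fun b hb _ => Finset.le_max' _ b hb,
        fun b _ hn => absurd hc hn⟩, rfl⟩
    · rintro ⟨-, a, ha, rfl⟩
      rw [le_antisymm (Finset.le_max' _ a ha.mem) (ha.le _ (Finset.max'_mem _ _) hc)]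
  · rw [Option.some.injEq]
    constructor
    · rintro rfl
      exact ⟨hs.1, _, ⟨Finset.min'_mem _ _, fun b _ hn => absurd hn hc,
        fun b hb _ => Finset.min'_le _ b hb⟩, rfl⟩
    · rintro ⟨-, a, ha, rfl⟩
      rw [le_antisymm (ha.ge _ (Finset.min'_mem _ _) hc) (Finset.min'_le _ a ha.mem)]
  · simp only [false_iff]
    rintro ⟨h₁, a, ha, -⟩
    exact hs ⟨h₁, a, ha.mem⟩

theorem tableauCrystal_e_eq {i : Idx n} {T T' : Tableau ℓ} :
    (tableauCrystal n ℓ h r).e i T = some T' ↔ ε i (mT n ℓ h r T) ≠ 0 ∧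
      ∃ a, IsEPos n ℓ h r i T a ∧ T' = Function.update T a (eLetter n i (T a)) := by
  simp only [tableauCrystal]
  split_ifs with hs hc
  · rw [Option.some.injEq]
    constructor
    · rintro rfl
      exact ⟨hs.1, _, ⟨Finset.min'_mem _ _, fun b hb _ => Finset.min'_le _ b hb,
        fun b _ hn => absurd hc hn⟩, rfl⟩
    · rintro ⟨-, a, ha, rfl⟩
      rw [le_antisymm (ha.ge _ (Finset.min'_mem _ _) hc) (Finset.min'_le _ a ha.mem)]
  · rw [Option.some.injEq]
    constructor
    · rintro rfl
      exact ⟨hs.1, _, ⟨Finset.max'_mem _ _, fun b _ hn => absurd hn hc,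
        fun b hb _ => Finset.le_max' _ b hb⟩, rfl⟩
    · rintro ⟨-, a, ha, rfl⟩
      rw [le_antisymm (Finset.le_max' _ a ha.mem) (ha.le _ (Finset.max'_mem _ _) hc)]
  · simp only [false_iff]
    rintro ⟨h₁, a, ha, -⟩
    exact hs ⟨h₁, a, ha.mem⟩

/-- The exponent of `Y_{i,q}` in `m_T` is positive and no box contributes more than `1`, so some box
contributes exactly `1`. -/
theorem exists_isFPos (hn : 4 ≤ n) {i : Idx n} {T : Tableau ℓ} (hT : ∀ a, T a ∈ alphabet n)
    (h₀ : φ i (mT n ℓ h r T) ≠ 0) : ∃ a, IsFPos n ℓ h r i T a := by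
  have h₁ := apply_q_pos h₀
  have hne : (fPositions n ℓ h r i T).Nonempty := by
    rw [mT_apply] at h₁
    obtain ⟨a, -, ha⟩ := Finset.exists_lt_of_sum_lt (s := Finset.univ) (f := fun _ : Idx ℓ => (0 : ℤ))
      (by simpa using h₁)
    refine ⟨a, mem_fPositions.2 ?_⟩
    have := box_le_one hn (hT a) i (suffix ℓ h r a) (q i (mT n ℓ h r T))
    omega
  by_cases hc : Crossing h r (fPositions n ℓ h r i T)
  · exact ⟨_, Finset.max'_mem _ hne, fun b hb _ => Finset.le_max' _ b hb,
      fun b _ hn => absurd hc hn⟩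
  · exact ⟨_, Finset.min'_mem _ hne, fun b _ hn => absurd hn hc,
      fun b hb _ => Finset.min'_le _ b hb⟩

theorem mT_f (hn : 4 ≤ n) {i : Idx n} {T T' : Tableau ℓ} (hT : ∀ a, T a ∈ alphabet n)
    (hf : (tableauCrystal n ℓ h r).f i T = some T') :
    (∀ a, T' a ∈ alphabet n) ∧ (monomialCrystal n).f i (mT n ℓ h r T) = some (mT n ℓ h r T') := by
  obtain ⟨h₀, a, ha, rfl⟩ := tableauCrystal_f_eq.1 hf
  obtain ⟨h₁, -, h₂⟩ := box_fLetter hn (hT a) (mem_fPositions.1 ha.mem)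
  refine ⟨fun b => ?_, monomialCrystal_f_eq.2 ⟨h₀, ?_⟩⟩
  · by_cases hb : b = a
    · subst hb; rwa [Function.update_self]
    · rw [Function.update_of_ne hb]; exact hT b
  · rw [mT_update, h₂]; abel

theorem f_map_mT (hn : 4 ≤ n) (i : Idx n) {T : Tableau ℓ} (hT : ∀ a, T a ∈ alphabet n) :
    (monomialCrystal n).f i (mT n ℓ h r T) =
      ((tableauCrystal n ℓ h r).f i T).map (mT n ℓ h r) := by
  by_cases h₀ : φ i (mT n ℓ h r T) = 0
  · rw [Option.map_eq_none_iff.2]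
    · simp [monomialCrystal, h₀]
    · rw [Option.eq_none_iff_forall_ne_some]
      intro T' hT'
      exact (tableauCrystal_f_eq.1 hT').1 h₀
  · obtain ⟨a, ha⟩ := exists_isFPos hn hT h₀
    have h₁ := tableauCrystal_f_eq.2 ⟨h₀, a, ha, rfl⟩
    rw [h₁, (mT_f hn hT h₁).2, Option.map_some]

/-! ### Reversal -/

namespace Letter

def dual : Letter → Letter
  | num k => bar k
  | bar k => num k

theorem dual_dual (x : Letter) : x.dual.dual = x := by cases x <;> rfl

theorem dual_num (k : ℕ) : (num k).dual = bar k := rfl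

theorem dual_bar (k : ℕ) : (bar k).dual = num k := rfl

theorem dual_mem {x : Letter} (hx : x ∈ alphabet n) : x.dual ∈ alphabet n := by
  obtain ⟨k, h₁, h₂, rfl | rfl⟩ := hx
  · exact ⟨k, h₁, h₂, Or.inr rfl⟩
  · exact ⟨k, h₁, h₂, Or.inl rfl⟩

end Letter

theorem eLetter_dual (i : ℕ) (x : Letter) : eLetter n i x = (fLetter n i x.dual).dual := by
  cases x with
  | num k =>
    simp only [eLetter, fLetter, dual_num]
    split_ifs <;> rfl
  | bar k =>
    simp only [eLetter, fLetter, dual_bar]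
    split_ifs <;> first | rfl | (simp only [dual_bar, num.injEq]; omega)

/-- Exchanging a letter with its bar inverts the variables and reflects their indices. The centre
`t` is free because a shift of the suffix shifts all indices. -/
theorem box_dual (hn : 4 ≤ n) {x : Letter} (hx : x ∈ alphabet n) (i : Idx n) (s t l : ℤ) :
    box n x.dual s (i, l) = - box n x (2 - 2 * n - s + t) (i, t - l) := by
  have hx' := dual_mem hx
  rcases i.2.2.lt_or_eq with hi | hi
  · rw [box_apply_of_lt hn hx' hi, box_apply_of_lt hn hx hi]
    obtain ⟨k, hk₁, hk₂, rfl | rfl⟩ := hx <;>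
      simp only [num.injEq, bar.injEq, reduceCtorEq, false_and, if_false, dual_num, dual_bar] <;>
      split_ifs <;> omega
  · rw [box_apply_last hn hx' hi, box_apply_last hn hx hi]
    obtain ⟨k, hk₁, hk₂, rfl | rfl⟩ := hx <;>
      simp only [num.injEq, bar.injEq, reduceCtorEq, false_and, if_false, dual_num, dual_bar,
        or_self] <;>
      split_ifs <;> omega

/-- The position `ℓ + 1 - a`. -/
def revIdx (a : Idx ℓ) : Idx ℓ :=
  ⟨ℓ + 1 - a.1, by have h₁ := a.2.1; have h₂ := a.2.2; constructor <;> omega⟩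

theorem revIdx_val (a : Idx ℓ) : (revIdx a).1 + a.1 = ℓ + 1 := by
  have h₁ := a.2.1
  have h₂ := a.2.2
  change ℓ + 1 - a.1 + a.1 = ℓ + 1
  omega

theorem revIdx_revIdx (a : Idx ℓ) : revIdx (revIdx a) = a := by
  refine Subtype.ext ?_
  have h₁ := revIdx_val a
  have h₂ := revIdx_val (revIdx a)
  omega

theorem revIdx_le {a b : Idx ℓ} : revIdx a ≤ revIdx b ↔ b ≤ a := by
  have h₁ := revIdx_val a
  have h₂ := revIdx_val b
  rw [← Subtype.coe_le_coe, ← Subtype.coe_le_coe]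
  omega

/-- The tableau in reverse order, with `k` and `k̄` exchanged. -/
def revT (T : Tableau ℓ) : Tableau ℓ := fun a => (T (revIdx a)).dual

theorem revT_revT (T : Tableau ℓ) : revT (revT T) = T := by
  funext a
  simp [revT, revIdx_revIdx, dual_dual]

theorem revT_update (T : Tableau ℓ) (a : Idx ℓ) (y : Letter) :
    revT (Function.update T a y) = Function.update (revT T) (revIdx a) y.dual := by
  funext b
  by_cases hb : b = revIdx a
  · subst hb
    simp [revT, revIdx_revIdx]
  · rw [Function.update_of_ne hb]
    have : revIdx b ≠ a := fun h => hb (by rw [← h, revIdx_revIdx])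
    simp [revT, Function.update_of_ne this]

theorem revT_mem {T : Tableau ℓ} (hT : ∀ a, T a ∈ alphabet n) (a : Idx ℓ) :
    revT T a ∈ alphabet n := dual_mem (hT _)

theorem suffix_revIdx (hh : h ≤ ℓ) (a : Idx ℓ) :
    suffix ℓ (ℓ - h) r a = - suffix ℓ h r (revIdx a) - 2 * r := by
  have h₁ := revIdx_val a
  unfold suffix
  split_ifs <;> omega

theorem box_revT (hn : 4 ≤ n) (hh : h ≤ ℓ) {T : Tableau ℓ} (hT : ∀ a, T a ∈ alphabet n)
    (i : Idx n) (a : Idx ℓ) (l : ℤ) :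
    box n (revT T a) (suffix ℓ (ℓ - h) r a) (i, l) =
      - box n (T (revIdx a)) (suffix ℓ h r (revIdx a)) (i, 2 * n - 2 - 2 * r - l) := by
  rw [revT, box_dual hn (hT _) i _ (2 * n - 2 - 2 * r), suffix_revIdx hh]
  congr 3
  ring

theorem mT_revT (hn : 4 ≤ n) (hh : h ≤ ℓ) {T : Tableau ℓ} (hT : ∀ a, T a ∈ alphabet n)
    (i : Idx n) (l : ℤ) :
    mT n ℓ (ℓ - h) r (revT T) (i, l) = - mT n ℓ h r T (i, 2 * n - 2 - 2 * r - l) := by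
  rw [mT_apply, mT_apply, ← Finset.sum_neg_distrib]
  refine Finset.sum_equiv ⟨revIdx, revIdx, revIdx_revIdx, revIdx_revIdx⟩ (by simp) fun a _ => ?_
  exact box_revT hn hh hT i a l

/-- As functions of `L`, both sides have the same jumps and vanish on the far left. -/
theorem φPart_eq_εPart {m m' : Mono n} {i : Idx n} {c : ℤ}
    (hm : ∀ l, m' (i, l) = - m (i, c - l)) (L : ℤ) : φPart i m' L = εPart i m (c - L) := by
  have step : ∀ L, φPart i m' L - εPart i m (c - L) =
      φPart i m' (L - 1) - εPart i m (c - (L - 1)) := by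
    intro L
    have h₁ := φPart_eq_add i m' L
    have h₂ := φPart_eq_add i m (c - L)
    have h₃ := hm L
    rw [εPart_eq, εPart_eq, show c - (L - 1) - 1 = c - L by ring]
    omega
  obtain ⟨a, -, -, h₁, -, -⟩ := φPart_bounds i m'
  obtain ⟨-, b, -, -, h₂, -⟩ := φPart_bounds i m
  have base : ∀ L, L ≤ a → L ≤ c - b - 1 → φPart i m' L - εPart i m (c - L) = 0 := by
    intro L hL hL'
    rw [h₁ L hL, εPart_eq, h₂ _ (by omega)]
    ring
  have down : ∀ k : ℕ, φPart i m' L - εPart i m (c - L) =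
      φPart i m' (L - k) - εPart i m (c - (L - k)) := by
    intro k
    induction k with
    | zero => simp
    | succ k ih =>
      rw [ih, step (L - k)]
      push_cast
      rw [sub_sub]
  have h₃ := down (max (L - a) (L - (c - b - 1))).toNat
  have h₄ := base (L - (max (L - a) (L - (c - b - 1))).toNat) (by omega) (by omega)
  omega

theorem φ_eq_ε {m m' : Mono n} {i : Idx n} {c : ℤ} (hm : ∀ l, m' (i, l) = - m (i, c - l)) :
    φ i m' = ε i m := by
  unfold φ ε
  congr 1
  ext v
  constructor
  · rintro ⟨L, rfl⟩
    exact ⟨c - L, (φPart_eq_εPart hm L).symm⟩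
  · rintro ⟨L, rfl⟩
    exact ⟨c - L, by rw [φPart_eq_εPart hm, sub_sub_cancel]⟩

theorem q_eq_p {m m' : Mono n} {i : Idx n} {c : ℤ} (hm : ∀ l, m' (i, l) = - m (i, c - l))
    (h₀ : ε i m ≠ 0) : q i m' = c - p i m := by
  obtain ⟨h₁, h₂⟩ := p_spec h₀
  have h₃ := φ_eq_ε_add_wt i m
  refine q_eq_of ?_ fun L hL => ?_
  · rw [φPart_eq_εPart hm, φ_eq_ε hm, sub_sub_cancel]
    exact (mem_p_iff i m _).2 h₁
  · rw [φPart_eq_εPart hm, φ_eq_ε hm, εPart_eq]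
    have := h₂ (c - L - 1) (by omega)
    omega

/-- Reversal exchanges first and last position, the two columns, and positive and negative
exponents. The opposite tie rules of `ẽ_i` and `f̃_i` are therefore carried into each other, so that
results about `f̃_i` transfer to `ẽ_i`. -/
theorem tableauCrystal_e_eq_revT (hn : 4 ≤ n) (hh : h ≤ ℓ) (i : Idx n) {T T' : Tableau ℓ}
    (hT : ∀ a, T a ∈ alphabet n) :
    (tableauCrystal n ℓ h r).e i T = some T' ↔
      (tableauCrystal n ℓ (ℓ - h) r).f i (revT T) = some (revT T') := by
  rw [tableauCrystal_e_eq, tableauCrystal_f_eq]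
  have hm := mT_revT (r := r) hn hh hT i
  rw [φ_eq_ε hm]
  refine and_congr_right fun h₀ => ?_
  have hq := q_eq_p hm h₀
  have hmem : ∀ a, revIdx a ∈ fPositions n ℓ (ℓ - h) r i (revT T) ↔
      a ∈ ePositions n ℓ h r i T := by
    intro a
    rw [mem_fPositions, mem_ePositions, hq, box_revT hn hh hT, sub_sub_cancel, revIdx_revIdx,
      neg_eq_iff_eq_neg]
  have hmem' : ∀ a, a ∈ fPositions n ℓ (ℓ - h) r i (revT T) ↔
      revIdx a ∈ ePositions n ℓ h r i T := by
    intro a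
    rw [← hmem, revIdx_revIdx]
  have hC : Crossing (ℓ - h) r (fPositions n ℓ (ℓ - h) r i (revT T)) ↔
      Crossing h r (ePositions n ℓ h r i T) := by
    refine and_congr_right fun _ => ?_
    constructor
    · rintro ⟨a, ha, b, hb, h₁, h₂⟩
      have e₁ := revIdx_val a
      have e₂ := revIdx_val b
      exact ⟨revIdx b, (hmem' b).1 hb, revIdx a, (hmem' a).1 ha, by omega, by omega⟩
    · rintro ⟨a, ha, b, hb, h₁, h₂⟩
      have e₁ := revIdx_val a
      have e₂ := revIdx_val b
      exact ⟨revIdx b, (hmem b).2 hb, revIdx a, (hmem a).2 ha, by omega, by omega⟩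
  have hpos : ∀ a, IsEPos n ℓ h r i T a ↔ IsFPos n ℓ (ℓ - h) r i (revT T) (revIdx a) := by
    intro a
    constructor
    · rintro ⟨h₁, h₂, h₃⟩
      refine ⟨(hmem a).2 h₁, fun b hb hc => ?_, fun b hb hc => ?_⟩
      · have := h₂ _ ((hmem' b).1 hb) (hC.1 hc)
        rwa [← revIdx_le, revIdx_revIdx] at this
      · have := h₃ _ ((hmem' b).1 hb) (hC.not.1 hc)
        rwa [← revIdx_le, revIdx_revIdx] at this
    · rintro ⟨h₁, h₂, h₃⟩
      refine ⟨(hmem a).1 h₁, fun b hb hc => ?_, fun b hb hc => ?_⟩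
      · exact revIdx_le.1 (h₂ _ ((hmem b).2 hb) (hC.2 hc))
      · exact revIdx_le.1 (h₃ _ ((hmem b).2 hb) (hC.not.2 hc))
  constructor
  · rintro ⟨a, ha, rfl⟩
    refine ⟨revIdx a, (hpos a).1 ha, ?_⟩
    rw [revT_update, eLetter_dual, dual_dual]
    simp [revT, revIdx_revIdx]
  · rintro ⟨a, ha, h₁⟩
    refine ⟨revIdx a, (hpos _).2 (by rwa [revIdx_revIdx]), ?_⟩
    rw [← revT_revT T', h₁, revT_update, eLetter_dual, revT_revT]
    simp [revT]

/-! ### Local form of the conditions on tableaux. -/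

/-- `Lt n x y` is `x ⋡ y` for letters `x`, `y` of the alphabet. -/
def Lt (n : ℕ) (x y : Letter) : Prop :=
  height n x < height n y ∨ x ≠ y ∧ height n x = n ∧ height n y = n

theorem not_succeq_iff {x y : Letter} (hx : x ∈ alphabet n) (hy : y ∈ alphabet n) :
    ¬ succeq n x y ↔ Lt n x y := by
  obtain ⟨k, h₁, h₂, rfl | rfl⟩ := hx <;> obtain ⟨k', h₃, h₄, rfl | rfl⟩ := hy <;>
    simp only [succeq, prec, Lt, height, num.injEq, bar.injEq, reduceCtorEq, ne_eq, false_or,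
      not_false_eq_true, true_and] <;> omega

theorem height_dual (x : Letter) : height n x.dual = 2 * n - height n x := by
  cases x
  · rfl
  · simp [dual, height]

theorem dual_injective {x y : Letter} (hxy : x.dual = y.dual) : x = y := by
  rw [← dual_dual x, hxy, dual_dual]

theorem Lt.dual {x y : Letter} (hxy : Lt n x y) : Lt n y.dual x.dual := by
  unfold Lt at *
  rw [height_dual, height_dual]
  rcases hxy with h₁ | ⟨h₁, h₂, h₃⟩
  · left; omega
  · exact Or.inr ⟨fun h => h₁ (dual_injective h.symm), by omega, by omega⟩

/-- The two positions lie in the same column. -/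
def SameCol (h : ℕ) (a b : Idx ℓ) : Prop := b.1 ≤ h ∨ h + 1 ≤ a.1

/-- A form of `IsD` in which the last three conditions are local: they only mention pairs of
entries `j` and `j̄`. -/
structure IsAdm (n ℓ h r : ℕ) (T : Tableau ℓ) : Prop where
  mem : ∀ a, T a ∈ alphabet n
  col : ∀ a b : Idx ℓ, b.1 = a.1 + 1 → SameCol h a b → Lt n (T a) (T b)
  same : ∀ (a b : Idx ℓ) (k : ℕ), a.1 < b.1 → SameCol h a b → T a = num k → T b = bar k →
    b.1 + 1 + k ≠ a.1 + n
  cross : ∀ (a b : Idx ℓ) (k : ℕ), a.1 ≤ h → h + 1 ≤ b.1 → T a = num k → T b = bar k →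
    b.1 + max r 1 + k ≠ a.1 + n
  gap : ∀ u v : Idx ℓ, u.1 = h → v.1 = h + 1 → Lt n (T u) (T v) ∨
    (∃ k' k, T u = num k' ∧ T v = num k ∧ k ≤ k' ∧ ∀ j, k ≤ j → j ≤ k' →
      ∃ b : Idx ℓ, h < b.1 ∧ T b = bar j ∧ n + h < b.1 + r + j ∧ b.1 + j + 1 ≤ n + h) ∨
    (∃ k' k, T u = bar k' ∧ T v = bar k ∧ k' ≤ k ∧ ∀ j, k' ≤ j → j ≤ k →
      ∃ a : Idx ℓ, a.1 ≤ h ∧ T a = num j ∧ n + a.1 ≤ h + r + j ∧ h + j + 1 < n + a.1)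

/-- The relation `⋡` is not transitive, since `n` and `n̄` may alternate in a column. Heights
nevertheless increase strictly along a column except within such an alternating stretch. -/
theorem height_lt_of_col {T : Tableau ℓ}
    (hcol : ∀ a b : Idx ℓ, b.1 = a.1 + 1 → SameCol h a b → Lt n (T a) (T b)) {a b : Idx ℓ}
    (hab : a.1 < b.1) (hs : SameCol h a b) :
    height n (T a) < height n (T b) ∨ height n (T a) = n ∧ height n (T b) = n := by
  have key : ∀ d : ℕ, ∀ b : Idx ℓ, b.1 = a.1 + 1 + d → SameCol h a b →
      height n (T a) < height n (T b) ∨ height n (T a) = n ∧ height n (T b) = n := by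
    intro d
    induction d with
    | zero =>
      intro b hb hs
      rcases hcol a b hb hs with h₁ | h₁
      · exact Or.inl h₁
      · exact Or.inr h₁.2
    | succ d ih =>
      intro b hb hs
      have h₁ := a.2.1
      have h₂ := b.2.2
      let c : Idx ℓ := ⟨a.1 + 1 + d, by constructor <;> omega⟩
      have hc : c.1 = a.1 + 1 + d := rfl
      unfold SameCol at hs
      have h₃ := ih c rfl (by unfold SameCol; omega)
      have h₄ := hcol c b (by omega) (by unfold SameCol; omega)
      rcases h₄ with h₄ | ⟨-, h₄⟩ <;> omega
  exact key (b.1 - a.1 - 1) b (by omega) hs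

namespace IsAdm

variable {T : Tableau ℓ}

theorem height_lt (hT : IsAdm n ℓ h r T) {a b : Idx ℓ} (hab : a.1 < b.1) (hs : SameCol h a b) :
    height n (T a) < height n (T b) ∨ height n (T a) = n ∧ height n (T b) = n :=
  height_lt_of_col hT.col hab hs

/-- Heights increase along a column, so no entry fits between two consecutive heights once the
height `n`, which may be repeated, is excluded. -/
theorem adjacent (hT : IsAdm n ℓ h r T) {a b : Idx ℓ} (hs : a.1 ≤ h ↔ b.1 ≤ h)
    (hab : height n (T b) = height n (T a) + 1) (ha : height n (T a) ≠ n)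
    (hb : height n (T b) ≠ n) : b.1 = a.1 + 1 := by
  have h₁ := a.2.1
  have h₂ := b.2.2
  rcases lt_trichotomy a.1 b.1 with h₃ | h₃ | h₃
  · by_contra hne
    let c : Idx ℓ := ⟨a.1 + 1, by constructor <;> omega⟩
    have hc : c.1 = a.1 + 1 := rfl
    have h₄ := hT.height_lt (a := a) (b := c) (by omega) (by unfold SameCol; omega)
    have h₅ := hT.height_lt (a := c) (b := b) (by omega) (by unfold SameCol; omega)
    omega
  · rw [Subtype.ext h₃] at hab
    omega
  · have h₄ := hT.height_lt (a := b) (b := a) h₃ (by unfold SameCol; omega)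
    omega

theorem unique (hT : IsAdm n ℓ h r T) {a b : Idx ℓ} (hs : a.1 ≤ h ↔ b.1 ≤ h)
    (hab : height n (T a) = height n (T b)) (ha : height n (T a) ≠ n) : a = b := by
  rcases lt_trichotomy a.1 b.1 with h₃ | h₃ | h₃
  · have h₄ := hT.height_lt (a := a) (b := b) h₃ (by unfold SameCol; omega)
    omega
  · exact Subtype.ext h₃
  · have h₄ := hT.height_lt (a := b) (b := a) h₃ (by unfold SameCol; omega)
    omega

/-- Along a run of consecutive letters the sum (for unbarred letters, the difference) of position
and letter is constant. The bound at the end of the run in (D.5) or (D.6) is thus the same bound for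
each of its letters, and monotonicity of heights decides the column containing the run. -/
theorem of_isD (hT : IsD n ℓ h r T) : IsAdm n ℓ h r T := by
  have hcol : ∀ a b : Idx ℓ, b.1 = a.1 + 1 → SameCol h a b → Lt n (T a) (T b) :=
    fun a b hab hs => (not_succeq_iff (hT.mem a) (hT.mem b)).1 (hT.d1 a b hab hs)
  refine ⟨hT.mem, hcol, ?_, ?_, ?_⟩
  · intro a b k hab hs ha hb he
    rcases hs with hs | hs
    · exact hT.d2 ⟨a, b, k, hab, hs, ha, hb, by omega⟩
    · exact hT.d3 ⟨a, b, k, hs, hab, ha, hb, by omega⟩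
  · intro a b k ha' hb' ha hb he
    exact hT.d4 ⟨a, b, k, ha', hb', ha, hb, by omega⟩
  · intro u v hu hv
    by_cases hs : succeq n (T u) (T v)
    swap
    · exact Or.inl ((not_succeq_iff (hT.mem u) (hT.mem v)).1 hs)
    right
    obtain ⟨k, hk₁, hk₂, hk | hk⟩ := hT.mem v
    · left
      rcases hk₂.lt_or_eq with hk₂ | rfl
      swap
      · exact absurd hs (hT.d7 u v hu hv (Or.inl hk))
      obtain ⟨k', hk'₁, hk'₂, hu', b', b, h₁, h₂, h₃, h₄, h₅⟩ :=
        hT.d5 u v k hu hv hk₁ (by omega) hk hs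
      refine ⟨k', k, hu', hk, by omega, fun j hj₁ hj₂ => ?_⟩
      have e₁ := b'.2.1
      have e₂ := b.2.2
      let c : Idx ℓ := ⟨b'.1 + (k' - j), by constructor <;> omega⟩
      have hc : c.1 = b'.1 + (k' - j) := rfl
      obtain ⟨j', hj', hj''⟩ := h₃ c (by omega) (by omega)
      obtain rfl : j' = j := by omega
      refine ⟨c, ?_, hj', by omega, by omega⟩
      by_contra hlt
      rcases (by omega : c.1 = u.1 ∨ c.1 < u.1) with h₆ | h₆
      · rw [Subtype.ext h₆, hu'] at hj'
        cases hj'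
      · have h₇ := height_lt_of_col hcol h₆ (Or.inl (by omega))
        rw [hj', hu'] at h₇
        simp only [height] at h₇
        omega
    · right
      rcases hk₂.lt_or_eq with hk₂ | rfl
      swap
      · exact absurd hs (hT.d7 u v hu hv (Or.inr hk))
      obtain ⟨k', hk'₁, hk'₂, hu', b', b, h₁, h₂, h₃, h₄, h₅⟩ :=
        hT.d6 u v k hu hv hk₁ (by omega) hk hs
      refine ⟨k', k, hu', hk, by omega, fun j hj₁ hj₂ => ?_⟩
      have e₁ := b'.2.1
      have e₂ := b.2.2
      let c : Idx ℓ := ⟨b'.1 + (j - k'), by constructor <;> omega⟩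
      have hc : c.1 = b'.1 + (j - k') := rfl
      obtain ⟨j', hj', hj''⟩ := h₃ c (by omega) (by omega)
      obtain rfl : j' = j := by omega
      refine ⟨c, ?_, hj', by omega, by omega⟩
      by_contra hlt
      rcases (by omega : c.1 = v.1 ∨ v.1 < c.1) with h₆ | h₆
      · rw [Subtype.ext h₆, hk] at hj'
        cases hj'
      · have h₇ := height_lt_of_col hcol h₆ (Or.inr (by omega))
        rw [hj', hk] at h₇
        simp only [height] at h₇
        omega

/-- Conversely, letters of consecutive heights in one column occupy consecutive positions by
`adjacent`, so the separately given letters form a run. The bounds force all letters involved to be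
at most `n-2`, which excludes `n` and `n̄` as in (D.7). -/
theorem isD (hT : IsAdm n ℓ h r T) : IsD n ℓ h r T := by
  have hns : ∀ {a b}, succeq n (T a) (T b) → ¬ Lt n (T a) (T b) := fun hs hlt =>
    (not_succeq_iff (hT.mem _) (hT.mem _)).2 hlt hs
  refine ⟨hT.mem, fun a b hab hs => (not_succeq_iff (hT.mem a) (hT.mem b)).2 (hT.col a b hab hs),
    ?_, ?_, ?_, ?_, ?_, ?_⟩
  · rintro ⟨a, b, k, hab, hb', ha, hb, he⟩
    exact hT.same a b k hab (Or.inl hb') ha hb (by omega)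
  · rintro ⟨a, b, k, ha', hab, ha, hb, he⟩
    exact hT.same a b k hab (Or.inr ha') ha hb (by omega)
  · rintro ⟨a, b, k, ha', hb', ha, hb, he⟩
    exact hT.cross a b k ha' hb' ha hb (by omega)
  · intro u v k hu hv hk₁ hk₂ hk hs
    rcases hT.gap u v hu hv with h₁ | ⟨k', k₀, h₁, h₂, h₃, h₄⟩ | ⟨k', k₀, h₁, h₂, h₃, h₄⟩
    · exact absurd h₁ (hns hs)
    · obtain rfl : k₀ = k := by rw [hk] at h₂; cases h₂; rfl
      obtain ⟨b', e₁, e₂, e₃, e₄⟩ := h₄ k' h₃ le_rfl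
      have key : ∀ d, d ≤ k' - k₀ → ∀ c : Idx ℓ, h < c.1 → T c = bar (k' - d) →
          c.1 = b'.1 + d := by
        intro d
        induction d with
        | zero =>
          intro _ c hc hc'
          rw [hT.unique (a := c) (b := b') (by omega) (by rw [hc', e₂]; rfl)
            (by rw [hc']; simp only [height]; omega)]
          rfl
        | succ d ih =>
          intro hd c hc hc'
          obtain ⟨c₁, g₁, g₂, -, -⟩ := h₄ (k' - d) (by omega) (by omega)
          have := hT.adjacent (a := c₁) (b := c) (by omega)
            (by rw [hc', g₂]; simp only [height]; omega)
            (by rw [g₂]; simp only [height]; omega) (by rw [hc']; simp only [height]; omega)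
          have := ih (by omega) c₁ g₁ g₂
          omega
      obtain ⟨b, g₁, g₂, g₃, g₄⟩ := h₄ k₀ le_rfl h₃
      have hb := key (k' - k₀) le_rfl b g₁ (by rw [g₂]; congr 1; omega)
      refine ⟨k', by omega, by omega, h₁, b', b, by omega, by omega, ?_, by omega, by omega⟩
      intro c hc₁ hc₂
      refine ⟨k' - (c.1 - b'.1), ?_, by omega⟩
      obtain ⟨c', f₁, f₂, -, -⟩ := h₄ (k' - (c.1 - b'.1)) (by omega) (by omega)
      have := key (c.1 - b'.1) (by omega) c' f₁ f₂
      rwa [Subtype.ext (show c'.1 = c.1 by omega)] at f₂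
    · rw [hk] at h₂; cases h₂
  · intro u v k hu hv hk₁ hk₂ hk hs
    rcases hT.gap u v hu hv with h₁ | ⟨k', k₀, h₁, h₂, h₃, h₄⟩ | ⟨k', k₀, h₁, h₂, h₃, h₄⟩
    · exact absurd h₁ (hns hs)
    · rw [hk] at h₂; cases h₂
    · obtain rfl : k₀ = k := by rw [hk] at h₂; cases h₂; rfl
      have hk' : 1 ≤ k' ∧ k' ≤ n := bar_mem_alphabet.1 (h₁ ▸ hT.mem u)
      obtain ⟨b', e₁, e₂, e₃, e₄⟩ := h₄ k' le_rfl h₃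
      have key : ∀ d, d ≤ k₀ - k' → ∀ c : Idx ℓ, c.1 ≤ h → T c = num (k' + d) →
          c.1 = b'.1 + d := by
        intro d
        induction d with
        | zero =>
          intro _ c hc hc'
          rw [hT.unique (a := c) (b := b') (by omega) (by rw [hc', e₂]; rfl)
            (by rw [hc']; simp only [height]; omega)]
          rfl
        | succ d ih =>
          intro hd c hc hc'
          obtain ⟨c₁, g₁, g₂, -, -⟩ := h₄ (k' + d) (by omega) (by omega)
          have := hT.adjacent (a := c₁) (b := c) (by omega)
            (by rw [hc', g₂]; simp only [height]; push_cast; omega)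
            (by rw [g₂]; simp only [height]; omega) (by rw [hc']; simp only [height]; omega)
          have := ih (by omega) c₁ g₁ g₂
          omega
      obtain ⟨b, g₁, g₂, g₃, g₄⟩ := h₄ k₀ h₃ le_rfl
      have hb := key (k₀ - k') le_rfl b g₁ (by rw [g₂]; congr 1; omega)
      refine ⟨k', by omega, by omega, h₁, b', b, by omega, by omega, ?_, by omega, by omega⟩
      intro c hc₁ hc₂
      refine ⟨k' + (c.1 - b'.1), ?_, by omega⟩
      obtain ⟨c', f₁, f₂, -, -⟩ := h₄ (k' + (c.1 - b'.1)) (by omega) (by omega)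
      have := key (c.1 - b'.1) (by omega) c' f₁ f₂
      rwa [Subtype.ext (show c'.1 = c.1 by omega)] at f₂
  · intro u v hu hv hk hs
    rcases hT.gap u v hu hv with h₁ | ⟨k', k₀, h₁, h₂, h₃, h₄⟩ | ⟨k', k₀, h₁, h₂, h₃, h₄⟩
    · exact absurd h₁ (hns hs)
    · obtain ⟨b, e₁, -, -, e₄⟩ := h₄ k' h₃ le_rfl
      rcases hk with hk | hk <;> rw [hk] at h₂ <;> cases h₂
      omega
    · obtain ⟨b, e₁, -, -, e₄⟩ := h₄ k₀ h₃ le_rfl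
      rcases hk with hk | hk <;> rw [hk] at h₂ <;> cases h₂
      omega

/-- The two alternatives in `gap` are exchanged. Their strict and weak inequalities are interchanged
because the position `a` becomes `ℓ + 1 - a` while `h` becomes `ℓ - h`. -/
theorem revT (hT : IsAdm n ℓ h r T) (hh : h ≤ ℓ) : IsAdm n ℓ (ℓ - h) r (TypeD.revT T) := by
  refine ⟨revT_mem hT.mem, ?_, ?_, ?_, ?_⟩
  · intro a b hab hs
    have h₁ := revIdx_val a
    have h₂ := revIdx_val b
    unfold SameCol at hs
    exact (hT.col (revIdx b) (revIdx a) (by omega) (by unfold SameCol; omega)).dual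
  · intro a b k hab hs ha hb
    have h₁ := revIdx_val a
    have h₂ := revIdx_val b
    unfold SameCol at hs
    have := hT.same (revIdx b) (revIdx a) k (by omega) (by unfold SameCol; omega)
      (dual_injective hb) (dual_injective ha)
    omega
  · intro a b k ha' hb' ha hb
    have h₁ := revIdx_val a
    have h₂ := revIdx_val b
    have := hT.cross (revIdx b) (revIdx a) k (by omega) (by omega)
      (dual_injective hb) (dual_injective ha)
    omega
  · intro u v hu hv
    have h₁ := revIdx_val u
    have h₂ := revIdx_val v
    rcases hT.gap (revIdx v) (revIdx u) (by omega) (by omega) with h₃ | ⟨k', k, h₃, h₄, h₅, h₆⟩ |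
      ⟨k', k, h₃, h₄, h₅, h₆⟩
    · exact Or.inl h₃.dual
    · refine Or.inr (Or.inr ⟨k, k', congrArg Letter.dual h₄, congrArg Letter.dual h₃, h₅,
        fun j hj₁ hj₂ => ?_⟩)
      obtain ⟨b, e₁, e₂, e₃, e₄⟩ := h₆ j hj₁ hj₂
      have h₇ := revIdx_val b
      refine ⟨revIdx b, by omega, ?_, by omega, by omega⟩
      change (T (revIdx (revIdx b))).dual = _
      rw [revIdx_revIdx, e₂]; rfl
    · refine Or.inr (Or.inl ⟨k, k', congrArg Letter.dual h₄, congrArg Letter.dual h₃, h₅,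
        fun j hj₁ hj₂ => ?_⟩)
      obtain ⟨b, e₁, e₂, e₃, e₄⟩ := h₆ j hj₁ hj₂
      have h₇ := revIdx_val b
      refine ⟨revIdx b, by omega, ?_, by omega, by omega⟩
      change (T (revIdx (revIdx b))).dual = _
      rw [revIdx_revIdx, e₂]; rfl

end IsAdm

theorem isD_iff_isAdm {T : Tableau ℓ} : IsD n ℓ h r T ↔ IsAdm n ℓ h r T :=
  ⟨IsAdm.of_isD, IsAdm.isD⟩

/-- For `r = 0` the windows in `gap` are empty, so the column condition also holds between the last
entry of the first column and the first entry of the second. As `max r 1 = 1`, the condition `cross`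
is then `same` for pairs in different columns: what remains is a single column. -/
theorem isAdm_zero_iff {T : Tableau ℓ} : IsAdm n ℓ h 0 T ↔ IsAdm n ℓ 0 0 T := by
  constructor
  · intro hT
    refine ⟨hT.mem, ?_, ?_, ?_, ?_⟩
    · intro a b hab _
      by_cases hs : SameCol h a b
      · exact hT.col a b hab hs
      · unfold SameCol at hs
        rcases hT.gap a b (by omega) (by omega) with h₁ | ⟨k', k, -, -, h₁, h₂⟩ |
          ⟨k', k, -, -, h₁, h₂⟩
        · exact h₁
        · obtain ⟨b, -, -, h₃, h₄⟩ := h₂ k le_rfl h₁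
          omega
        · obtain ⟨b, -, -, h₃, h₄⟩ := h₂ k h₁ le_rfl
          omega
    · intro a b k hab _ ha hb
      by_cases hs : SameCol h a b
      · exact hT.same a b k hab hs ha hb
      · unfold SameCol at hs
        exact hT.cross a b k (by omega) (by omega) ha hb
    · intro a b k ha'
      have := a.2.1
      omega
    · intro u v hu
      have := u.2.1
      omega
  · intro hT
    have hs : ∀ a b : Idx ℓ, SameCol 0 a b := fun a b => Or.inr (by have := a.2.1; omega)
    exact ⟨hT.mem, fun a b hab _ => hT.col a b hab (hs a b),
      fun a b k hab _ => hT.same a b k hab (hs a b),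
      fun a b k ha' hb' => hT.same a b k (by omega) (hs a b),
      fun u v hu hv => Or.inl (hT.col u v (by omega) (hs u v))⟩

/-! ### Partial sums as counts of entries. -/

theorem height_num (k : ℕ) : height n (num k) = k := rfl

theorem height_bar (k : ℕ) : height n (bar k) = 2 * n - k := rfl

theorem eq_num_of_height {x : Letter} (hx : x ∈ alphabet n) {k : ℕ} (hk : k < n)
    (hxk : height n x = k) : x = num k := by
  obtain ⟨k', h₁, h₂, rfl | rfl⟩ := hx <;> simp only [height] at hxk
  · congr 1; omega
  · omega

theorem eq_bar_of_height {x : Letter} (hx : x ∈ alphabet n) {k : ℕ} (hk : k < n)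
    (hxk : height n x = 2 * n - k) : x = bar k := by
  obtain ⟨k', h₁, h₂, rfl | rfl⟩ := hx <;> simp only [height] at hxk
  · omega
  · congr 1; omega

/-- The number of entries `y` with coordinate at least `X` in the first (`c = true`) or second
(`c = false`) column. -/
noncomputable def colCount (h r : ℕ) (T : Tableau ℓ) (c : Bool) (y : Letter) (X : ℤ) : ℤ :=
  ∑ a : Idx ℓ, if T a = y ∧ decide (a.1 ≤ h) = c ∧ X ≤ xcoord h r a then 1 else 0

theorem colCount_eq_zero {T : Tableau ℓ} {c : Bool} {y : Letter}
    (hy : ∀ a : Idx ℓ, decide (a.1 ≤ h) = c → T a ≠ y) (X : ℤ) : colCount h r T c y X = 0 :=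
  Finset.sum_eq_zero fun a _ => if_neg fun ha => hy a ha.2.1 ha.1

/-- Apart from `n` and `n̄`, a letter occurs at most once in a column, so its count is the indicator
function of a half-line. -/
theorem IsAdm.colCount_eq {T : Tableau ℓ} (hT : IsAdm n ℓ h r T) (p : Idx ℓ) {c : Bool}
    {y : Letter} (hc : decide (p.1 ≤ h) = c) (hy : T p = y) (hn : height n y ≠ n) (X : ℤ) :
    colCount h r T c y X = if X ≤ xcoord h r p then 1 else 0 := by
  subst hc hy
  unfold colCount
  rw [Finset.sum_eq_single p]
  · simp
  · intro b _ hb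
    rw [if_neg]
    rintro ⟨h₁, h₂, -⟩
    exact hb (hT.unique (by simpa using h₂) (congrArg _ h₁) (by rwa [h₁]))
  · simp

theorem exists_or_colCount (h r : ℕ) (T : Tableau ℓ) (c : Bool) (y : Letter) :
    (∃ p : Idx ℓ, decide (p.1 ≤ h) = c ∧ T p = y) ∨ ∀ X, colCount h r T c y X = 0 := by
  by_cases hp : ∃ p : Idx ℓ, decide (p.1 ≤ h) = c ∧ T p = y
  · exact Or.inl hp
  · exact Or.inr (colCount_eq_zero fun a ha hy => hp ⟨a, ha, hy⟩)

/-- The partial sums `φ_{i,L}` (`L = ℓ + i - 2 * M`) in terms of the entries. -/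
noncomputable def entrySum (n h r i : ℕ) (T : Tableau ℓ) (M : ℤ) : ℤ :=
  colCount h r T true (num i) M + colCount h r T false (num i) M
    - colCount h r T true (num (i + 1)) (M + 1) - colCount h r T false (num (i + 1)) (M + 1)
    + colCount h r T true (bar (i + 1)) (M + n - 1 - i)
    + colCount h r T false (bar (i + 1)) (M + n - 1 - i)
    - colCount h r T true (bar i) (M + n - i) - colCount h r T false (bar i) (M + n - i)

/-- In terms of `M` all four letters are compared with integral coordinates. Larger `M` means
smaller `L`, so the first maximum in `L` is the last one in `M`. -/
theorem φPart_mT_eq (hn : 4 ≤ n) {T : Tableau ℓ} (hT : ∀ a, T a ∈ alphabet n) {i : Idx n}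
    (hi : i.1 < n) (M : ℤ) :
    φPart i (mT n ℓ h r T) (ℓ + i - 2 * M) = entrySum n h r i T M := by
  rw [φPart_mT]
  unfold entrySum colCount
  simp only [← Finset.sum_add_distrib, ← Finset.sum_sub_distrib]
  refine Finset.sum_congr rfl fun a _ => ?_
  rw [φPart_box_of_lt hn (hT a) hi, suffix_eq]
  have e₁ : (ℓ : ℤ) + 1 - 2 * xcoord h r a + i - 1 ≤ ℓ + i - 2 * M ↔ M ≤ xcoord h r a := by omega
  have e₂ : (ℓ : ℤ) + 1 - 2 * xcoord h r a + i + 1 ≤ ℓ + i - 2 * M ↔ M + 1 ≤ xcoord h r a := by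
    omega
  have e₃ : (ℓ : ℤ) + 1 - 2 * xcoord h r a + 2 * n - 3 - i ≤ ℓ + i - 2 * M ↔
    M + n - 1 - i ≤ xcoord h r a := by omega
  have e₄ : (ℓ : ℤ) + 1 - 2 * xcoord h r a + 2 * n - 1 - i ≤ ℓ + i - 2 * M ↔
    M + n - i ≤ xcoord h r a := by omega
  simp only [e₁, e₂, e₃, e₄]
  by_cases ha : a.1 ≤ h <;> simp [ha]

/-- Coordinates are distinct across both columns, so lowering the threshold by one picks up at most
one new entry. -/
theorem colCount_step (h r : ℕ) (T : Tableau ℓ) (y : Letter) (X : ℤ) :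
    (∃ a, T a = y ∧ xcoord h r a = X ∧
      colCount h r T true y X + colCount h r T false y X =
        colCount h r T true y (X + 1) + colCount h r T false y (X + 1) + 1) ∨
    (∀ a, T a = y → xcoord h r a ≠ X) ∧
      colCount h r T true y X + colCount h r T false y X =
        colCount h r T true y (X + 1) + colCount h r T false y (X + 1) := by
  have key : colCount h r T true y X + colCount h r T false y X =
      colCount h r T true y (X + 1) + colCount h r T false y (X + 1) +
        ∑ a : Idx ℓ, if T a = y ∧ xcoord h r a = X then 1 else 0 := by
    unfold colCount
    simp only [← Finset.sum_add_distrib]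
    refine Finset.sum_congr rfl fun a _ => ?_
    by_cases hy : T a = y
    · by_cases ha : a.1 ≤ h <;> simp only [hy, ha, decide_true, decide_false, true_and,
        reduceCtorEq, false_and, if_false] <;> split_ifs <;> omega
    · simp [hy]
  by_cases hex : ∃ a, T a = y ∧ xcoord h r a = X
  · left
    obtain ⟨a, ha, hx⟩ := hex
    refine ⟨a, ha, hx, ?_⟩
    rw [key, Finset.sum_eq_single a, if_pos ⟨ha, hx⟩]
    · intro b _ hb
      exact if_neg fun hb' => hb (xcoord_injective (hb'.2.trans hx.symm))
    · simp
  · right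
    refine ⟨fun a ha hx => hex ⟨a, ha, hx⟩, ?_⟩
    rw [key, Finset.sum_eq_zero, add_zero]
    exact fun a _ => if_neg fun ha => hex ⟨a, ha⟩

/-- The properties of the position `a` at which `f̃_i` acts (`i ≤ n - 2`), in terms of the
entries. -/
structure IsFStep (n h r i : ℕ) (T : Tableau ℓ) (a : Idx ℓ) (M : ℤ) : Prop where
  lt : ∀ M', M < M' → entrySum n h r i T M' < entrySum n h r i T M
  le : entrySum n h r i T (M - 1) ≤ entrySum n h r i T M
  pos : (T a = num i ∧ xcoord h r a = M ∧ ∀ b : Idx ℓ, T b = bar (i + 1) →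
      xcoord h r b = M + n - 1 - i → a.1 ≤ h → h < b.1 → r = 0) ∨
    (T a = bar (i + 1) ∧ xcoord h r a = M + n - 1 - i ∧ ∀ b : Idx ℓ, T b = num i →
      xcoord h r b = M → b.1 ≤ h ∧ h < a.1)

/-! ### The column and pair conditions after applying `f̃_i` with `i ≤ n - 2`. -/

namespace IsAdm

variable {T : Tableau ℓ} {i : ℕ} {a : Idx ℓ} {M : ℤ}

theorem height_le_last (hT : IsAdm n ℓ h r T) {u p : Idx ℓ} (hu : u.1 = h) (hp : p.1 ≤ h) :
    height n (T p) ≤ height n (T u) := by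
  rcases (by omega : p.1 = u.1 ∨ p.1 < u.1) with h₁ | h₁
  · rw [Subtype.ext h₁]
  · have := hT.height_lt h₁ (Or.inl (by omega))
    omega

theorem height_first_le (hT : IsAdm n ℓ h r T) {v p : Idx ℓ} (hv : v.1 = h + 1) (hp : h < p.1) :
    height n (T v) ≤ height n (T p) := by
  rcases (by omega : p.1 = v.1 ∨ v.1 < p.1) with h₁ | h₁
  · rw [Subtype.ext h₁]
  · have := hT.height_lt h₁ (Or.inr (by omega))
    omega

/-- An `i+1` right after the `i` at `a` would cancel it when passing from `M+1` to `M`. The strict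
increase then needs a barred `i+1` at coordinate `M+n-1-i`. In the column of `a` it violates `same`
together with the `i+1`; in the other column the tie rule would not have selected `a`. -/
theorem num_succ_not_adjacent (hr : r ≠ 0 ∨ h = 0 ∨ h = ℓ) (hi : i + 2 ≤ n)
    (hT : IsAdm n ℓ h r T) (hf : IsFStep n h r i T a M) (ha : T a = num i) {b : Idx ℓ}
    (hab : b.1 = a.1 + 1) (hs : SameCol h a b) : T b ≠ num (i + 1) := by
  intro hb
  obtain ⟨-, hx, hrule⟩ | ⟨ha', -⟩ := hf.pos
  swap
  · rw [ha] at ha'; cases ha'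
  have h₀ := hf.lt (M + 1) (by omega)
  have hxb : xcoord h r b = M + 1 := by
    unfold SameCol at hs
    unfold xcoord at hx ⊢
    split_ifs at hx ⊢ <;> omega
  unfold entrySum at h₀
  rw [show M + 1 + n - 1 - i = M + n - 1 - i + 1 by ring,
    show M + 1 + n - i = M + n - i + 1 by ring] at h₀
  have s₁ := colCount_step h r T (num i) M
  have s₂ := colCount_step h r T (num (i + 1)) (M + 1)
  have s₃ := colCount_step h r T (bar (i + 1)) (M + n - 1 - i)
  have s₄ := colCount_step h r T (bar i) (M + n - i)
  rcases s₂ with ⟨_, -, -, s₂⟩ | ⟨s₂, -⟩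
  swap
  · exact s₂ b hb hxb
  rcases s₃ with ⟨c, hc, hxc, s₃⟩ | ⟨-, s₃⟩
  swap
  · rcases s₁ with ⟨_, -, -, s₁⟩ | ⟨-, s₁⟩ <;> rcases s₄ with ⟨_, -, -, s₄⟩ | ⟨-, s₄⟩ <;> omega
  have hbc : b.1 < c.1 := by
    rcases lt_trichotomy b.1 c.1 with g | g | g
    · exact g
    · rw [Subtype.ext g, hc] at hb; cases hb
    · have := xcoord_lt (h := h) (r := r) g; omega
  by_cases hcol : SameCol h b c
  · have := hT.same b c (i + 1) hbc hcol hb hc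
    unfold SameCol at hcol
    unfold xcoord at hxb hxc
    split_ifs at hxb hxc <;> omega
  · unfold SameCol at hcol hs
    have := hrule c hc hxc (by omega) (by omega)
    clear s₁ s₄
    have := b.2.1
    have := c.2.2
    omega

/-- A barred `i` right after `a` cancels the barred `i+1`, so strictness needs an `i` at coordinate
`M`. By the tie rule it lies in the first column and `a` in the second, and with the barred `i` it
violates `cross`. -/
theorem bar_not_adjacent (hT : IsAdm n ℓ h r T) (hf : IsFStep n h r i T a M)
    (ha : T a = bar (i + 1)) {b : Idx ℓ} (hr : r ≠ 0 ∨ h = 0 ∨ h = ℓ)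
    (hab : b.1 = a.1 + 1) (hs : SameCol h a b) : T b ≠ bar i := by
  intro hb
  obtain ⟨ha', -⟩ | ⟨-, hx, hrule⟩ := hf.pos
  · rw [ha] at ha'; cases ha'
  have h₀ := hf.lt (M + 1) (by omega)
  have hxb : xcoord h r b = M + n - i := by
    unfold SameCol at hs
    unfold xcoord at hx ⊢
    split_ifs at hx ⊢ <;> omega
  unfold entrySum at h₀
  rw [show M + 1 + n - 1 - i = M + n - 1 - i + 1 by ring,
    show M + 1 + n - i = M + n - i + 1 by ring] at h₀
  have s₁ := colCount_step h r T (num i) M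
  have s₂ := colCount_step h r T (num (i + 1)) (M + 1)
  have s₃ := colCount_step h r T (bar (i + 1)) (M + n - 1 - i)
  have s₄ := colCount_step h r T (bar i) (M + n - i)
  rcases s₄ with ⟨_, -, -, s₄⟩ | ⟨s₄, -⟩
  swap
  · exact s₄ b hb hxb
  rcases s₁ with ⟨c, hc, hxc, s₁⟩ | ⟨-, s₁⟩
  swap
  · rcases s₂ with ⟨_, -, -, s₂⟩ | ⟨-, s₂⟩ <;> rcases s₃ with ⟨_, -, -, s₃⟩ | ⟨-, s₃⟩ <;> omega
  clear s₂ s₃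
  obtain ⟨g₁, g₂⟩ := hrule c hc hxc
  have := hT.cross c b i g₁ (by omega) hc hb
  rw [xcoord_of_le g₁] at hxc
  rw [xcoord_of_lt (by omega)] at hxb
  have := c.2.1
  have := b.2.2
  omega

/-- All conditions except `gap`, which is left as a hypothesis. A new forbidden pair consists of the
new `i+1` and a barred `i+1`. Within a column this is excluded by comparing the counts at `M-1` and
`M`, across the columns by the tie rule. -/
theorem f_num (hr : r ≠ 0 ∨ h = 0 ∨ h = ℓ) (hi : i + 2 ≤ n)
    (hT : IsAdm n ℓ h r T) (hf : IsFStep n h r i T a M) (ha : T a = num i)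
    (hgap : ∀ u v : Idx ℓ, u.1 = h → v.1 = h + 1 →
      Lt n (Function.update T a (num (i + 1)) u) (Function.update T a (num (i + 1)) v) ∨
    (∃ k' k, Function.update T a (num (i + 1)) u = num k' ∧
      Function.update T a (num (i + 1)) v = num k ∧ k ≤ k' ∧ ∀ j, k ≤ j → j ≤ k' →
      ∃ b : Idx ℓ, h < b.1 ∧ Function.update T a (num (i + 1)) b = bar j ∧
        n + h < b.1 + r + j ∧ b.1 + j + 1 ≤ n + h) ∨
    (∃ k' k, Function.update T a (num (i + 1)) u = bar k' ∧
      Function.update T a (num (i + 1)) v = bar k ∧ k' ≤ k ∧ ∀ j, k' ≤ j → j ≤ k →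
      ∃ b : Idx ℓ, b.1 ≤ h ∧ Function.update T a (num (i + 1)) b = num j ∧
        n + b.1 ≤ h + r + j ∧ h + j + 1 < n + b.1)) :
    IsAdm n ℓ h r (Function.update T a (num (i + 1))) := by
  obtain ⟨-, hx, hrule⟩ | ⟨ha', -⟩ := hf.pos
  swap
  · rw [ha] at ha'; cases ha'
  have hia : 1 ≤ i ∧ i ≤ n := num_mem_alphabet.1 (ha ▸ hT.mem a)
  refine ⟨fun b => ?_, fun u v huv hs => ?_, fun u v k huv hs hu hv he => ?_,
    fun u v k hu' hv' hu hv he => ?_, hgap⟩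
  · by_cases hb : b = a
    · subst hb
      rw [Function.update_self]
      exact num_mem_alphabet.2 (by omega)
    · rw [Function.update_of_ne hb]; exact hT.mem b
  · have hlt := hT.col u v huv hs
    by_cases hu : u = a
    · subst hu
      have hv : v ≠ u := fun h => by rw [h] at huv; omega
      rw [Function.update_self, Function.update_of_ne hv]
      have hne := hT.num_succ_not_adjacent hr hi hf ha huv hs
      have : height n (T v) ≠ (i + 1 : ℕ) := fun h => hne (eq_num_of_height (hT.mem v) (by omega) h)
      rw [ha] at hlt
      unfold Lt at *
      simp only [height_num] at hlt ⊢
      omega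
    · rw [Function.update_of_ne hu]
      by_cases hv : v = a
      · subst hv
        rw [Function.update_self]
        rw [ha] at hlt
        unfold Lt at *
        simp only [height_num] at hlt ⊢
        omega
      · rwa [Function.update_of_ne hv]
  · have hva : v ≠ a := by rintro rfl; rw [Function.update_self] at hv; cases hv
    rw [Function.update_of_ne hva] at hv
    by_cases hua : u = a
    swap
    · rw [Function.update_of_ne hua] at hu
      exact hT.same u v k huv hs hu hv he
    subst hua
    rw [Function.update_self, num.injEq] at hu
    subst hu
    have hxv : xcoord h r v = M - 1 + n - 1 - i := by
      unfold SameCol at hs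
      unfold xcoord at hx ⊢
      split_ifs at hx ⊢ <;> omega
    -- The forbidden barred `i+1` is counted at `M-1` but not at `M`. Since the count does not
    -- exceed its value at `M`, a barred `i` must follow one step later, and it forms a forbidden
    -- pair with the old `i` at `a`.
    have h₀ := hf.le
    unfold entrySum at h₀
    rw [show M + n - 1 - i = M - 1 + n - 1 - i + 1 by ring,
      show M + n - i = M - 1 + n - i + 1 by ring] at h₀
    have s₁ := colCount_step h r T (num i) (M - 1)
    have s₂ := colCount_step h r T (num (i + 1)) (M - 1 + 1)
    have s₃ := colCount_step h r T (bar (i + 1)) (M - 1 + n - 1 - i)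
    have s₄ := colCount_step h r T (bar i) (M - 1 + n - i)
    rw [sub_add_cancel] at s₁ s₂ h₀
    rcases s₂ with ⟨c, hc, hxc, -⟩ | ⟨-, s₂⟩
    · rw [xcoord_injective (hxc.trans hx.symm), ha, num.injEq] at hc
      omega
    rcases s₃ with ⟨_, -, -, s₃⟩ | ⟨s₃, -⟩
    swap
    · exact s₃ v hv hxv
    rcases s₄ with ⟨c, hc, hxc, s₄⟩ | ⟨-, s₄⟩
    swap
    · rcases s₁ with ⟨_, -, -, s₁⟩ | ⟨-, s₁⟩ <;> omega
    have hvc : v.1 < c.1 := by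
      rcases lt_trichotomy v.1 c.1 with g | g | g
      · exact g
      · rw [Subtype.ext g, hc, bar.injEq] at hv; omega
      · have := xcoord_lt (h := h) (r := r) g; omega
    by_cases hcol : SameCol h u c
    · have := hT.same u c i (by omega) hcol ha hc
      unfold SameCol at hcol
      unfold xcoord at hx hxc
      split_ifs at hx hxc <;> omega
    · unfold SameCol at hcol hs
      have := u.2.1
      have := c.2.2
      unfold xcoord at hxv hxc
      split_ifs at hxv hxc <;> omega
  · have hva : v ≠ a := by rintro rfl; rw [Function.update_self] at hv; cases hv
    rw [Function.update_of_ne hva] at hv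
    by_cases hua : u = a
    swap
    · rw [Function.update_of_ne hua] at hu
      exact hT.cross u v k hu' hv' hu hv he
    subst hua
    rw [Function.update_self, num.injEq] at hu
    subst hu
    have hu₀ := u.2.1
    have hv₀ := v.2.2
    have hr' : r ≠ 0 := by omega
    -- The forbidden distance across the columns is exactly the distance of the two candidates in a
    -- tie, where the second one is changed.
    refine hr' (hrule v hv ?_ hu' hv')
    rw [xcoord_of_le hu'] at hx
    rw [xcoord_of_lt hv']
    omega

/-- The roles are reversed compared with `f_num`: the tie rule excludes a new forbidden pair within
a column, and the comparison of `M-1` with `M` excludes one across the columns. -/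
theorem f_bar (hr : r ≠ 0 ∨ h = 0 ∨ h = ℓ) (hi₁ : 1 ≤ i) (hi : i + 2 ≤ n)
    (hT : IsAdm n ℓ h r T) (hf : IsFStep n h r i T a M) (ha : T a = bar (i + 1))
    (hgap : ∀ u v : Idx ℓ, u.1 = h → v.1 = h + 1 →
      Lt n (Function.update T a (bar i) u) (Function.update T a (bar i) v) ∨
    (∃ k' k, Function.update T a (bar i) u = num k' ∧
      Function.update T a (bar i) v = num k ∧ k ≤ k' ∧ ∀ j, k ≤ j → j ≤ k' →
      ∃ b : Idx ℓ, h < b.1 ∧ Function.update T a (bar i) b = bar j ∧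
        n + h < b.1 + r + j ∧ b.1 + j + 1 ≤ n + h) ∨
    (∃ k' k, Function.update T a (bar i) u = bar k' ∧
      Function.update T a (bar i) v = bar k ∧ k' ≤ k ∧ ∀ j, k' ≤ j → j ≤ k →
      ∃ b : Idx ℓ, b.1 ≤ h ∧ Function.update T a (bar i) b = num j ∧
        n + b.1 ≤ h + r + j ∧ h + j + 1 < n + b.1)) :
    IsAdm n ℓ h r (Function.update T a (bar i)) := by
  obtain ⟨ha', -⟩ | ⟨-, hx, hrule⟩ := hf.pos
  · rw [ha] at ha'; cases ha'
  refine ⟨fun b => ?_, fun u v huv hs => ?_, fun u v k huv hs hu hv he => ?_,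
    fun u v k hu' hv' hu hv he => ?_, hgap⟩
  · by_cases hb : b = a
    · subst hb
      rw [Function.update_self]
      exact bar_mem_alphabet.2 (by omega)
    · rw [Function.update_of_ne hb]; exact hT.mem b
  · have hlt := hT.col u v huv hs
    by_cases hu : u = a
    · subst hu
      have hv : v ≠ u := fun h => by rw [h] at huv; omega
      rw [Function.update_self, Function.update_of_ne hv]
      have hne := hT.bar_not_adjacent hf ha hr huv hs
      have : height n (T v) ≠ 2 * n - i := fun h => hne (eq_bar_of_height (hT.mem v) (by omega) h)
      rw [ha] at hlt
      unfold Lt at *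
      simp only [height_bar] at hlt ⊢
      omega
    · rw [Function.update_of_ne hu]
      by_cases hv : v = a
      · subst hv
        rw [Function.update_self]
        rw [ha] at hlt
        unfold Lt at *
        simp only [height_bar] at hlt ⊢
        omega
      · rwa [Function.update_of_ne hv]
  · have hua : u ≠ a := by rintro rfl; rw [Function.update_self] at hu; cases hu
    rw [Function.update_of_ne hua] at hu
    by_cases hva : v = a
    swap
    · rw [Function.update_of_ne hva] at hv
      exact hT.same u v k huv hs hu hv he
    subst hva
    rw [Function.update_self, bar.injEq] at hv
    subst hv
    have := hrule u hu (by
      unfold SameCol at hs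
      unfold xcoord at hx ⊢
      split_ifs at hx ⊢ <;> omega)
    unfold SameCol at hs
    omega
  · have hua : u ≠ a := by rintro rfl; rw [Function.update_self] at hu; cases hu
    rw [Function.update_of_ne hua] at hu
    by_cases hva : v = a
    swap
    · rw [Function.update_of_ne hva] at hv
      exact hT.cross u v k hu' hv' hu hv he
    subst hva
    rw [Function.update_self, bar.injEq] at hv
    subst hv
    have hu₀ := u.2.1
    have hv₀ := v.2.2
    have hxu : xcoord h r u = M - 1 := by
      rw [xcoord_of_lt hv'] at hx
      rw [xcoord_of_le hu']
      omega
    have h₀ := hf.le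
    unfold entrySum at h₀
    rw [show M + n - 1 - i = M - 1 + n - 1 - i + 1 by ring,
      show M + n - i = M - 1 + n - i + 1 by ring] at h₀
    have s₁ := colCount_step h r T (num i) (M - 1)
    have s₂ := colCount_step h r T (num (i + 1)) (M - 1 + 1)
    have s₃ := colCount_step h r T (bar (i + 1)) (M - 1 + n - 1 - i)
    have s₄ := colCount_step h r T (bar i) (M - 1 + n - i)
    rw [sub_add_cancel] at s₁ s₂ h₀
    rcases s₄ with ⟨c, hc, hxc, -⟩ | ⟨-, s₄⟩
    · rw [xcoord_injective (a := c) (b := v) (h := h) (r := r) (by omega), ha, bar.injEq] at hc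
      omega
    rcases s₁ with ⟨_, -, -, s₁⟩ | ⟨s₁, -⟩
    swap
    · exact s₁ u hu hxu
    -- The `i` at coordinate `M-1` must be compensated by an `i+1` at `M`. In the first column the
    -- latter forms a forbidden pair with the old barred `i+1`; in the second it would leave no room
    -- for the shift `r`.
    rcases s₂ with ⟨c, hc, hxc, s₂⟩ | ⟨-, s₂⟩
    swap
    · rcases s₃ with ⟨_, -, -, s₃⟩ | ⟨-, s₃⟩ <;> omega
    rw [xcoord_of_lt hv'] at hx
    rw [xcoord_of_le hu'] at hxu
    by_cases hch : c.1 ≤ h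
    · have := hT.cross c v (i + 1) hch hv' hc ha
      rw [xcoord_of_le hch] at hxc
      omega
    · rw [xcoord_of_lt (by omega)] at hxc
      omega

end IsAdm

/-! ### The condition at the junction of the two columns. -/

theorem colCount_nonneg (h r : ℕ) (T : Tableau ℓ) (c : Bool) (y : Letter) (X : ℤ) :
    0 ≤ colCount h r T c y X :=
  Finset.sum_nonneg fun a _ => by split_ifs <;> simp

theorem colCount_large (h r : ℕ) (T : Tableau ℓ) (c : Bool) (y : Letter) {X : ℤ}
    (hX : (ℓ : ℤ) + r < X) : colCount h r T c y X = 0 := by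
  refine Finset.sum_eq_zero fun a _ => if_neg fun ha => ?_
  have h₁ := a.2.2
  have h₂ := ha.2.2
  unfold xcoord at h₂
  split_ifs at h₂ <;> omega

theorem entrySum_large {i : ℕ} (hi : i < n) (T : Tableau ℓ) {M : ℤ} (hM : (ℓ : ℤ) + r < M) :
    entrySum n h r i T M = 0 := by
  unfold entrySum
  rw [colCount_large, colCount_large, colCount_large, colCount_large, colCount_large,
    colCount_large, colCount_large, colCount_large] <;> omega

/-- The count vanishes for large arguments and is strictly smaller there than at `M`. This replaces
the hypothesis `φ_i > 0`. -/
theorem IsFStep.entrySum_pos {i : ℕ} {T : Tableau ℓ} {a : Idx ℓ} {M : ℤ} (hi : i < n)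
    (hf : IsFStep n h r i T a M) : 0 < entrySum n h r i T M := by
  have h₁ := entrySum_large (h := h) (r := r) hi T (M := max (M + 1) (ℓ + r + 1)) (by omega)
  have h₂ := hf.lt (max (M + 1) (ℓ + r + 1)) (by omega)
  omega

namespace IsAdm

variable {T : Tableau ℓ} {i : ℕ} {a : Idx ℓ} {M : ℤ}

theorem colCount_first_eq_zero (hT : IsAdm n ℓ h r T) {u : Idx ℓ} (hu : u.1 = h) {y : Letter}
    (hy : height n (T u) < height n y) (X : ℤ) : colCount h r T true y X = 0 := by
  refine colCount_eq_zero (fun p hp hpy => ?_) X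
  have := hT.height_le_last hu (of_decide_eq_true hp)
  rw [hpy] at this
  omega

theorem colCount_second_eq_zero (hT : IsAdm n ℓ h r T) {v : Idx ℓ} (hv : v.1 = h + 1) {y : Letter}
    (hy : height n y < height n (T v)) (X : ℤ) : colCount h r T false y X = 0 := by
  refine colCount_eq_zero (fun p hp hpy => ?_) X
  have := hT.height_first_le hv (not_le.1 (of_decide_eq_false hp))
  rw [hpy] at this
  omega

theorem colCount_first (hT : IsAdm n ℓ h r T) {p : Idx ℓ} {y : Letter} (hp : p.1 ≤ h)
    (hy : T p = y) (hn : height n y ≠ n) (X : ℤ) :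
    colCount h r T true y X = if X ≤ p.1 then 1 else 0 := by
  rw [hT.colCount_eq p (decide_eq_true hp) hy hn, xcoord_of_le hp]

theorem colCount_second (hT : IsAdm n ℓ h r T) {p : Idx ℓ} {y : Letter} (hp : h < p.1)
    (hy : T p = y) (hn : height n y ≠ n) (X : ℤ) :
    colCount h r T false y X = if X ≤ p.1 + r then 1 else 0 := by
  rw [hT.colCount_eq p (decide_eq_false (not_le.2 hp)) hy hn, xcoord_of_lt hp]

theorem first_cases (hT : IsAdm n ℓ h r T) (y : Letter) (hn : height n y ≠ n) :
    (∃ p : Idx ℓ, p.1 ≤ h ∧ T p = y ∧ ∀ X : ℤ, colCount h r T true y X = if X ≤ p.1 then 1 else 0) ∨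
      ∀ X, colCount h r T true y X = 0 := by
  rcases exists_or_colCount h r T true y with ⟨p, hp, hpy⟩ | e
  · exact Or.inl ⟨p, of_decide_eq_true hp, hpy, hT.colCount_first (of_decide_eq_true hp) hpy hn⟩
  · exact Or.inr e

theorem second_cases (hT : IsAdm n ℓ h r T) (y : Letter) (hn : height n y ≠ n) :
    (∃ p : Idx ℓ, h < p.1 ∧ T p = y ∧
      ∀ X : ℤ, colCount h r T false y X = if X ≤ p.1 + r then 1 else 0) ∨
      ∀ X, colCount h r T false y X = 0 := by
  rcases exists_or_colCount h r T false y with ⟨p, hp, hpy⟩ | e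
  · have hp := not_le.1 (of_decide_eq_false hp)
    exact Or.inl ⟨p, hp, hpy, hT.colCount_second hp hpy hn⟩
  · exact Or.inr e

/-- When `i` and `i+1` meet at the junction, they cancel in the count at `M = h`. Positivity
requires a barred `i+1` in the second column that no barred `i` cancels. Its lower bound comes from
positivity, with equality excluded by the tie rule; its upper bound comes from strictness, with
equality excluded by `same`. -/
theorem gap_num_new (hr : 1 ≤ r) (hi : i + 2 ≤ n) (hT : IsAdm n ℓ h r T)
    (hf : IsFStep n h r i T a M) (ha : T a = num i) (ha' : a.1 = h) {v : Idx ℓ}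
    (hv' : v.1 = h + 1) (hv : T v = num (i + 1)) :
    ∃ b : Idx ℓ, h < b.1 ∧ T b = bar (i + 1) ∧ n + h < b.1 + r + (i + 1) ∧
      b.1 + (i + 1) + 1 ≤ n + h := by
  obtain ⟨-, hx, hrule⟩ | ⟨ha'', -⟩ := hf.pos
  swap
  · rw [ha] at ha''; cases ha''
  rw [xcoord_of_le ha'.le] at hx
  subst hx
  have e₁ := hT.colCount_first ha'.le ha (by rw [height_num]; omega)
  have e₂ := hT.colCount_second_eq_zero hv' (y := num i)
    (by rw [hv, height_num, height_num]; omega)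
  have e₃ := hT.colCount_first_eq_zero ha' (y := num (i + 1))
    (by rw [ha, height_num, height_num]; omega)
  have e₄ := hT.colCount_second (by omega) hv (by rw [height_num]; omega)
  have e₅ := hT.colCount_first_eq_zero ha' (y := bar (i + 1))
    (by rw [ha, height_num, height_bar]; omega)
  have e₆ := hT.colCount_first_eq_zero ha' (y := bar i)
    (by rw [ha, height_num, height_bar]; omega)
  have h₀ := hf.entrySum_pos (by omega)
  rcases hT.second_cases (bar (i + 1)) (by rw [height_bar]; omega) with ⟨p, hp, hpy, e₇⟩ | e₇
  swap
  · rcases hT.second_cases (bar i) (by rw [height_bar]; omega) with ⟨p', hp', hpy', e₈⟩ | e₈ <;>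
      simp only [entrySum, e₁, e₂, e₃, e₄, e₅, e₆, e₇, e₈] at h₀ <;> split_ifs at h₀ <;> omega
  refine ⟨p, hp, hpy, ?_⟩
  have g₁ := hT.same v p (i + 1)
    (by
      have : p ≠ v := by rintro rfl; rw [hv] at hpy; cases hpy
      have : p.1 ≠ v.1 := fun h => this (Subtype.ext h)
      omega) (Or.inr (by omega)) hv hpy
  have g₂ : (p.1 : ℤ) + r ≠ a.1 + n - 1 - i := fun hxp => by
    have := hrule p hpy (by rwa [xcoord_of_lt hp]) ha'.le hp
    omega
  -- This is the largest argument at which the barred `i+1` at `p` is still counted.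
  have h₂ := hf.lt (p.1 + r - (n - 1 - i))
  rcases hT.second_cases (bar i) (by rw [height_bar]; omega) with ⟨p', hp', hpy', e₈⟩ | e₈
  · have := hT.adjacent (a := p) (b := p') (by omega)
      (by rw [hpy, hpy', height_bar, height_bar]; push_cast; omega)
      (by rw [hpy, height_bar]; omega) (by rw [hpy', height_bar]; omega)
    simp only [entrySum, e₁, e₂, e₃, e₄, e₅, e₆, e₇, e₈] at h₀ h₂
    split_ifs at h₀ <;> omega
  · simp only [entrySum, e₁, e₂, e₃, e₄, e₅, e₆, e₇, e₈] at h₀ h₂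
    split_ifs at h₀ h₂ <;> omega

/-- The barred `i` in the window cancels the `i` at `a`. If a barred `i+1` were missing, positivity
would need an `i` in the second column, and the count at its coordinate would equal the count at
`M`. If it is present, it stands just before the barred `i`, with the same sum of position and
letter. -/
theorem gap_num_extend (hi : i + 2 ≤ n) (hT : IsAdm n ℓ h r T)
    (hf : IsFStep n h r i T a M) (ha : T a = num i) (ha' : a.1 = h) {v b : Idx ℓ}
    (hv' : v.1 = h + 1) (hb' : h < b.1) (hb : T b = bar i)
    (hb₁ : n + h < b.1 + r + i) (hb₂ : b.1 + i + 1 ≤ n + h) :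
    ∃ b : Idx ℓ, h < b.1 ∧ T b = bar (i + 1) ∧ n + h < b.1 + r + (i + 1) ∧
      b.1 + (i + 1) + 1 ≤ n + h := by
  obtain ⟨-, hx, -⟩ | ⟨ha'', -⟩ := hf.pos
  swap
  · rw [ha] at ha''; cases ha''
  rw [xcoord_of_le ha'.le] at hx
  subst hx
  have e₁ := hT.colCount_first ha'.le ha (by rw [height_num]; omega)
  have e₃ := hT.colCount_first_eq_zero ha' (y := num (i + 1))
    (by rw [ha, height_num, height_num]; omega)
  have e₅ := hT.colCount_first_eq_zero ha' (y := bar (i + 1))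
    (by rw [ha, height_num, height_bar]; omega)
  have e₆ := hT.colCount_first_eq_zero ha' (y := bar i)
    (by rw [ha, height_num, height_bar]; omega)
  have e₈ := hT.colCount_second hb' hb (by rw [height_bar]; omega)
  rcases hT.second_cases (bar (i + 1)) (by rw [height_bar]; omega) with ⟨p, hp, hpy, e₇⟩ | e₇
  · have := hT.adjacent (a := p) (b := b) (by omega)
      (by rw [hpy, hb, height_bar, height_bar]; push_cast; omega)
      (by rw [hpy, height_bar]; omega) (by rw [hb, height_bar]; omega)
    exact ⟨p, hp, hpy, by omega, by omega⟩
  exfalso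
  have h₀ := hf.entrySum_pos (by omega)
  rcases hT.second_cases (num i) (by rw [height_num]; omega) with ⟨c, hc, hcy, e₂⟩ | e₂
  · have h₂ := hf.lt (c.1 + r) (by omega)
    rcases hT.second_cases (num (i + 1)) (by rw [height_num]; omega) with ⟨c', hc', hcy', e₄⟩ | e₄
    all_goals
      simp only [entrySum, e₁, e₂, e₃, e₄, e₅, e₆, e₇, e₈] at h₀ h₂
      split_ifs at h₀ h₂ <;> omega
  · have h₃ := colCount_nonneg h r T false (num (i + 1)) (a.1 + 1)
    simp only [entrySum, e₁, e₂, e₃, e₅, e₆, e₇, e₈] at h₀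
    split_ifs at h₀ <;> omega

/-- By the lower bound the barred `i` at the junction cancels the `i` at `a`. By the upper bound no
barred `i+1` of the first column is far enough to be counted, so the count at `M` is not positive.
-/
theorem gap_num_last (hi : i + 2 ≤ n) (hT : IsAdm n ℓ h r T)
    (hf : IsFStep n h r i T a M) (ha : T a = num i) (ha' : a.1 ≤ h) {v : Idx ℓ}
    (hv' : v.1 = h + 1) (hv : T v = bar i) (ha₁ : n + a.1 ≤ h + r + i)
    (ha₂ : h + i + 1 < n + a.1) : False := by
  obtain ⟨-, hx, -⟩ | ⟨ha'', -⟩ := hf.pos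
  swap
  · rw [ha] at ha''; cases ha''
  rw [xcoord_of_le ha'] at hx
  subst hx
  have e₁ := hT.colCount_first ha' ha (by rw [height_num]; omega)
  have e₂ := hT.colCount_second_eq_zero hv' (y := num i)
    (by rw [hv, height_num, height_bar]; omega)
  have e₇ := hT.colCount_second_eq_zero hv' (y := bar (i + 1))
    (by rw [hv, height_bar, height_bar]; push_cast; omega)
  have e₈ := hT.colCount_second (by omega) hv (by rw [height_bar]; omega)
  have h₀ := hf.entrySum_pos (by omega)
  have h₃ := colCount_nonneg h r T true (num (i + 1)) (a.1 + 1)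
  have h₄ := colCount_nonneg h r T false (num (i + 1)) (a.1 + 1)
  have h₅ := colCount_nonneg h r T true (bar i) (a.1 + n - i)
  rcases hT.first_cases (bar (i + 1)) (by rw [height_bar]; omega) with ⟨c, hc, hcy, e₅⟩ | e₅
  all_goals
    simp only [entrySum, e₁, e₂, e₅, e₇, e₈] at h₀
    split_ifs at h₀ <;> omega

/-- The `i+1` at the junction cancels the barred `i+1` at `a`, and the window places `M` beyond the
first column, so that no `i` contributes. Again the count is not positive. -/
theorem gap_bar_first (hi : i + 2 ≤ n) (hT : IsAdm n ℓ h r T)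
    (hf : IsFStep n h r i T a M) (ha : T a = bar (i + 1)) (ha' : h < a.1) {u v : Idx ℓ}
    (hu' : u.1 = h) {k : ℕ} (hu : T u = num k)
    (hv' : v.1 = h + 1) (hv : T v = num (i + 1)) (ha₁ : n + h < a.1 + r + (i + 1))
    (ha₂ : a.1 + (i + 1) + 1 ≤ n + h) : False := by
  obtain ⟨ha'', -⟩ | ⟨-, hx, -⟩ := hf.pos
  · rw [ha] at ha''; cases ha''
  rw [xcoord_of_lt ha'] at hx
  have hk : 1 ≤ k ∧ k ≤ n := num_mem_alphabet.1 (hu ▸ hT.mem u)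
  have e₂ := hT.colCount_second_eq_zero hv' (y := num i)
    (by rw [hv, height_num, height_num]; omega)
  have e₄ := hT.colCount_second (by omega) hv (by rw [height_num]; omega)
  have e₅ := hT.colCount_first_eq_zero hu' (y := bar (i + 1))
    (by rw [hu, height_num, height_bar]; omega)
  have e₇ := hT.colCount_second ha' ha (by rw [height_bar]; omega)
  have h₀ := hf.entrySum_pos (by omega)
  have h₃ := colCount_nonneg h r T true (num (i + 1)) (M + 1)
  have h₄ := colCount_nonneg h r T false (bar i) (M + n - i)
  have h₅ := colCount_nonneg h r T true (bar i) (M + n - i)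
  rcases hT.first_cases (num i) (by rw [height_num]; omega) with ⟨c, hc, hcy, e₁⟩ | e₁
  all_goals
    simp only [entrySum, e₁, e₂, e₄, e₅, e₇] at h₀
    split_ifs at h₀ <;> omega

/-- The counterpart of `gap_num_extend`: without an `i` before the `i+1` at `b`, positivity needs a
barred `i+1` in the second column, where the count takes the same value as at `M`. -/
theorem gap_bar_extend (hi : i + 2 ≤ n) (hT : IsAdm n ℓ h r T)
    (hf : IsFStep n h r i T a M) (ha : T a = bar (i + 1)) (ha' : a.1 = h) {v b : Idx ℓ}
    (hv' : v.1 = h + 1) {k : ℕ} (hv : T v = bar k) (hb' : b.1 ≤ h) (hb : T b = num (i + 1))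
    (hb₁ : n + b.1 ≤ h + r + (i + 1)) (hb₂ : h + (i + 1) + 1 < n + b.1) :
    ∃ b : Idx ℓ, b.1 ≤ h ∧ T b = num i ∧ n + b.1 ≤ h + r + i ∧ h + i + 1 < n + b.1 := by
  obtain ⟨ha'', -⟩ | ⟨-, hx, -⟩ := hf.pos
  · rw [ha] at ha''; cases ha''
  rw [xcoord_of_le ha'.le] at hx
  have hk : 1 ≤ k ∧ k ≤ n := bar_mem_alphabet.1 (hv ▸ hT.mem v)
  rcases hT.first_cases (num i) (by rw [height_num]; omega) with ⟨p, hp, hpy, e₁⟩ | e₁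
  · have := hT.adjacent (a := p) (b := b) (by omega)
      (by rw [hpy, hb, height_num, height_num]; push_cast; omega)
      (by rw [hpy, height_num]; omega) (by rw [hb, height_num]; omega)
    exact ⟨p, hp, hpy, by omega, by omega⟩
  exfalso
  have e₂ := hT.colCount_second_eq_zero hv' (y := num i)
    (by rw [hv, height_num, height_bar]; omega)
  have e₃ := hT.colCount_first hb' hb (by rw [height_num]; omega)
  have e₄ := hT.colCount_second_eq_zero hv' (y := num (i + 1))
    (by rw [hv, height_num, height_bar]; omega)
  have e₅ := hT.colCount_first ha'.le ha (by rw [height_bar]; omega)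
  have e₆ := hT.colCount_first_eq_zero ha' (y := bar i)
    (by rw [ha, height_bar, height_bar]; push_cast; omega)
  have h₀ := hf.entrySum_pos (by omega)
  rcases hT.second_cases (bar (i + 1)) (by rw [height_bar]; omega) with ⟨c, hc, hcy, e₇⟩ | e₇
  · have h₂ := hf.lt (c.1 + r - (n - 1 - i)) (by omega)
    rcases hT.second_cases (bar i) (by rw [height_bar]; omega) with ⟨c', hc', hcy', e₈⟩ | e₈
    all_goals
      simp only [entrySum, e₁, e₂, e₃, e₄, e₅, e₆, e₇, e₈] at h₀ h₂
      split_ifs at h₀ h₂ <;> omega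
  · have h₃ := colCount_nonneg h r T false (bar i) (M + n - i)
    simp only [entrySum, e₁, e₂, e₃, e₄, e₅, e₆, e₇] at h₀
    split_ifs at h₀ <;> omega

/-- The counterpart of `gap_num_new`, with an `i` in the first column as the compensating entry.
Here the tie rule and `cross` exclude the two cases of equality. -/
theorem gap_bar_new (hr : 1 ≤ r) (hi : i + 2 ≤ n) (hT : IsAdm n ℓ h r T)
    (hf : IsFStep n h r i T a M) (ha : T a = bar (i + 1)) (ha' : a.1 = h) {v : Idx ℓ}
    (hv' : v.1 = h + 1) (hv : T v = bar i) :
    ∃ b : Idx ℓ, b.1 ≤ h ∧ T b = num i ∧ n + b.1 ≤ h + r + i ∧ h + i + 1 < n + b.1 := by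
  obtain ⟨ha'', -⟩ | ⟨-, hx, hrule⟩ := hf.pos
  · rw [ha] at ha''; cases ha''
  rw [xcoord_of_le ha'.le] at hx
  have e₂ := hT.colCount_second_eq_zero hv' (y := num i)
    (by rw [hv, height_num, height_bar]; omega)
  have e₄ := hT.colCount_second_eq_zero hv' (y := num (i + 1))
    (by rw [hv, height_num, height_bar]; omega)
  have e₅ := hT.colCount_first ha'.le ha (by rw [height_bar]; omega)
  have e₆ := hT.colCount_first_eq_zero ha' (y := bar i)
    (by rw [ha, height_bar, height_bar]; push_cast; omega)
  have e₇ := hT.colCount_second_eq_zero hv' (y := bar (i + 1))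
    (by rw [hv, height_bar, height_bar]; push_cast; omega)
  have e₈ := hT.colCount_second (by omega) hv (by rw [height_bar]; omega)
  have h₀ := hf.entrySum_pos (by omega)
  rcases hT.first_cases (num i) (by rw [height_num]; omega) with ⟨p, hp, hpy, e₁⟩ | e₁
  swap
  · have h₃ := colCount_nonneg h r T true (num (i + 1)) (M + 1)
    simp only [entrySum, e₁, e₂, e₄, e₅, e₆, e₇, e₈] at h₀
    split_ifs at h₀ <;> omega
  refine ⟨p, hp, hpy, ?_⟩
  have g₁ := hT.cross p v i hp (by omega) hpy hv
  have g₂ : (p.1 : ℤ) ≠ M := fun hxp => by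
    have := hrule p hpy (by rwa [xcoord_of_le hp])
    omega
  have h₂ := hf.lt p.1
  rcases hT.first_cases (num (i + 1)) (by rw [height_num]; omega) with ⟨p', hp', hpy', e₃⟩ | e₃
  · have := hT.adjacent (a := p) (b := p') (by omega)
      (by rw [hpy, hpy', height_num, height_num]; push_cast; omega)
      (by rw [hpy, height_num]; omega) (by rw [hpy', height_num]; omega)
    simp only [entrySum, e₁, e₂, e₃, e₄, e₅, e₆, e₇, e₈] at h₀ h₂
    split_ifs at h₀ <;> omega
  · simp only [entrySum, e₁, e₂, e₃, e₄, e₅, e₆, e₇, e₈] at h₀ h₂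
    split_ifs at h₀ h₂ <;> omega

end IsAdm

/-! ### Stability under `f̃_i` for `i ≤ n - 2`. -/

namespace IsAdm

variable {T : Tableau ℓ} {i : ℕ} {a : Idx ℓ} {M : ℤ}

/-- What remains is `gap`. Depending on where `a` lies, the required set of pairs is created,
extended or shortened by one letter. The entry `a` cannot itself be a required unbarred letter: if
it is the last of its run, `gap_num_last` applies; otherwise `i+1` stands right after it. -/
theorem update_num (hr : r ≠ 0 ∨ h = 0 ∨ h = ℓ) (hi : i + 2 ≤ n) (hT : IsAdm n ℓ h r T)
    (hf : IsFStep n h r i T a M) (ha : T a = num i) :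
    IsAdm n ℓ h r (Function.update T a (num (i + 1))) := by
  refine hT.f_num hr hi hf ha fun u v hu' hv' => ?_
  have hr₁ : 1 ≤ r := by
    have := u.2.1
    have := v.2.2
    omega
  have hvu : v ≠ u := fun h => by rw [h] at hv'; omega
  have hbar : ∀ {b : Idx ℓ} {j : ℕ}, T b = bar j →
      Function.update T a (num (i + 1)) b = bar j := by
    intro b j hb
    rw [Function.update_of_ne, hb]
    rintro rfl
    rw [ha] at hb; cases hb
  rcases hT.gap u v hu' hv' with hlt | ⟨k', k, hu, hv, hk, H⟩ | ⟨k', k, hu, hv, hk, H⟩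
  · by_cases hua : u = a
    · subst hua
      rw [Function.update_self, Function.update_of_ne hvu]
      by_cases hvn : T v = num (i + 1)
      · obtain ⟨b, hb, hb', hb₁, hb₂⟩ := hT.gap_num_new hr₁ hi hf ha hu' hv' hvn
        refine Or.inr (Or.inl ⟨i + 1, i + 1, rfl, hvn, le_rfl, fun j hj₁ hj₂ => ?_⟩)
        obtain rfl : j = i + 1 := by omega
        exact ⟨b, hb, hbar hb', hb₁, hb₂⟩
      · left
        have : height n (T v) ≠ (i + 1 : ℕ) :=
          fun h => hvn (eq_num_of_height (hT.mem v) (by omega) h)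
        rw [ha] at hlt
        unfold Lt at *
        simp only [height_num] at hlt ⊢
        omega
    · rw [Function.update_of_ne hua]
      by_cases hva : v = a
      · subst hva
        rw [Function.update_self]
        left
        rw [ha] at hlt
        unfold Lt at *
        simp only [height_num] at hlt ⊢
        omega
      · rw [Function.update_of_ne hva]
        exact Or.inl hlt
  · by_cases hua : u = a
    · subst hua
      rw [Function.update_self, Function.update_of_ne hvu]
      obtain rfl : i = k' := by rw [ha] at hu; cases hu; rfl
      obtain ⟨b, hb, hb', hb₁, hb₂⟩ := H i hk le_rfl
      obtain ⟨c, hc, hc', hc₁, hc₂⟩ := hT.gap_num_extend hi hf ha hu' hv' hb hb' hb₁ hb₂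
      refine Or.inr (Or.inl ⟨i + 1, k, rfl, hv, by omega, fun j hj₁ hj₂ => ?_⟩)
      rcases (by omega : j = i + 1 ∨ j ≤ i) with rfl | hj
      · exact ⟨c, hc, hbar hc', hc₁, hc₂⟩
      · obtain ⟨b, hb, hb', hb₁, hb₂⟩ := H j hj₁ hj
        exact ⟨b, hb, hbar hb', hb₁, hb₂⟩
    · rw [Function.update_of_ne hua]
      by_cases hva : v = a
      · subst hva
        rw [Function.update_self]
        obtain rfl : i = k := by rw [ha] at hv; cases hv; rfl
        rcases hk.eq_or_lt with rfl | hk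
        · left; left
          rw [hu, height_num, height_num]
          push_cast
          omega
        · refine Or.inr (Or.inl ⟨k', i + 1, hu, rfl, by omega, fun j hj₁ hj₂ => ?_⟩)
          obtain ⟨b, hb, hb', hb₁, hb₂⟩ := H j (by omega) hj₂
          exact ⟨b, hb, hbar hb', hb₁, hb₂⟩
      · rw [Function.update_of_ne hva]
        refine Or.inr (Or.inl ⟨k', k, hu, hv, hk, fun j hj₁ hj₂ => ?_⟩)
        obtain ⟨b, hb, hb', hb₁, hb₂⟩ := H j hj₁ hj₂
        exact ⟨b, hb, hbar hb', hb₁, hb₂⟩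
  · refine Or.inr (Or.inr ⟨k', k, hbar hu, hbar hv, hk, fun j hj₁ hj₂ => ?_⟩)
    obtain ⟨b, hb, hb', hb₁, hb₂⟩ := H j hj₁ hj₂
    by_cases hba : b = a
    · exfalso
      subst hba
      obtain rfl : i = j := by rw [ha] at hb'; cases hb'; rfl
      rcases hj₂.eq_or_lt with rfl | hj₂
      · exact hT.gap_num_last hi hf ha hb hv' hv hb₁ hb₂
      · obtain ⟨c, hc, hc', -, -⟩ := H (i + 1) (by omega) hj₂
        have := hT.adjacent (a := b) (b := c) (by omega)
          (by rw [hb', hc', height_num, height_num]; push_cast; omega)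
          (by rw [hb', height_num]; omega) (by rw [hc', height_num]; omega)
        exact hT.num_succ_not_adjacent hr hi hf ha this (Or.inl hc) hc'
    · exact ⟨b, hb, by rw [Function.update_of_ne hba, hb'], hb₁, hb₂⟩

theorem update_bar (hr : r ≠ 0 ∨ h = 0 ∨ h = ℓ) (hi₁ : 1 ≤ i) (hi : i + 2 ≤ n)
    (hT : IsAdm n ℓ h r T) (hf : IsFStep n h r i T a M) (ha : T a = bar (i + 1)) :
    IsAdm n ℓ h r (Function.update T a (bar i)) := by
  refine hT.f_bar hr hi₁ hi hf ha fun u v hu' hv' => ?_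
  have hr₁ : 1 ≤ r := by
    have := u.2.1
    have := v.2.2
    omega
  have hvu : v ≠ u := fun h => by rw [h] at hv'; omega
  have hnum : ∀ {b : Idx ℓ} {j : ℕ}, T b = num j →
      Function.update T a (bar i) b = num j := by
    intro b j hb
    rw [Function.update_of_ne, hb]
    rintro rfl
    rw [ha] at hb; cases hb
  rcases hT.gap u v hu' hv' with hlt | ⟨k', k, hu, hv, hk, H⟩ | ⟨k', k, hu, hv, hk, H⟩
  · by_cases hua : u = a
    · subst hua
      rw [Function.update_self, Function.update_of_ne hvu]
      by_cases hvn : T v = bar i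
      · obtain ⟨b, hb, hb', hb₁, hb₂⟩ := hT.gap_bar_new hr₁ hi hf ha hu' hv' hvn
        refine Or.inr (Or.inr ⟨i, i, rfl, hvn, le_rfl, fun j hj₁ hj₂ => ?_⟩)
        obtain rfl : j = i := by omega
        exact ⟨b, hb, hnum hb', hb₁, hb₂⟩
      · left
        have : height n (T v) ≠ 2 * n - i :=
          fun h => hvn (eq_bar_of_height (hT.mem v) (by omega) h)
        rw [ha] at hlt
        unfold Lt at *
        simp only [height_bar] at hlt ⊢
        omega
    · rw [Function.update_of_ne hua]
      by_cases hva : v = a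
      · subst hva
        rw [Function.update_self]
        left
        rw [ha] at hlt
        unfold Lt at *
        simp only [height_bar] at hlt ⊢
        omega
      · rw [Function.update_of_ne hva]
        exact Or.inl hlt
  · refine Or.inr (Or.inl ⟨k', k, hnum hu, hnum hv, hk, fun j hj₁ hj₂ => ?_⟩)
    obtain ⟨b, hb, hb', hb₁, hb₂⟩ := H j hj₁ hj₂
    by_cases hba : b = a
    · exfalso
      subst hba
      obtain rfl : i + 1 = j := by rw [ha] at hb'; cases hb'; rfl
      rcases hj₁.eq_or_lt with rfl | hj₁
      · exact hT.gap_bar_first hi hf ha hb hu' hu hv' hv hb₁ hb₂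
      · obtain ⟨c, hc, hc', -, -⟩ := H i (by omega) (by omega)
        have := hT.adjacent (a := b) (b := c) (by omega)
          (by rw [hb', hc', height_bar, height_bar]; push_cast; omega)
          (by rw [hb', height_bar]; omega) (by rw [hc', height_bar]; omega)
        exact hT.bar_not_adjacent hf ha hr this (Or.inr hb) hc'
    · exact ⟨b, hb, by rw [Function.update_of_ne hba, hb'], hb₁, hb₂⟩
  · by_cases hua : u = a
    · subst hua
      rw [Function.update_self, Function.update_of_ne hvu]
      obtain rfl : i + 1 = k' := by rw [ha] at hu; cases hu; rfl
      obtain ⟨b, hb, hb', hb₁, hb₂⟩ := H (i + 1) le_rfl hk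
      obtain ⟨c, hc, hc', hc₁, hc₂⟩ := hT.gap_bar_extend hi hf ha hu' hv' hv hb hb' hb₁ hb₂
      refine Or.inr (Or.inr ⟨i, k, rfl, hv, by omega, fun j hj₁ hj₂ => ?_⟩)
      rcases (by omega : j = i ∨ i + 1 ≤ j) with rfl | hj
      · exact ⟨c, hc, hnum hc', hc₁, hc₂⟩
      · obtain ⟨b, hb, hb', hb₁, hb₂⟩ := H j hj hj₂
        exact ⟨b, hb, hnum hb', hb₁, hb₂⟩
    · rw [Function.update_of_ne hua]
      by_cases hva : v = a
      · subst hva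
        rw [Function.update_self]
        obtain rfl : i + 1 = k := by rw [ha] at hv; cases hv; rfl
        rcases hk.eq_or_lt with rfl | hk
        · left; left
          rw [hu, height_bar, height_bar]
          push_cast
          omega
        · refine Or.inr (Or.inr ⟨k', i, hu, rfl, by omega, fun j hj₁ hj₂ => ?_⟩)
          obtain ⟨b, hb, hb', hb₁, hb₂⟩ := H j hj₁ (by omega)
          exact ⟨b, hb, hnum hb', hb₁, hb₂⟩
      · rw [Function.update_of_ne hva]
        refine Or.inr (Or.inr ⟨k', k, hu, hv, hk, fun j hj₁ hj₂ => ?_⟩)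
        obtain ⟨b, hb, hb', hb₁, hb₂⟩ := H j hj₁ hj₂
        exact ⟨b, hb, hnum hb', hb₁, hb₂⟩

end IsAdm

/-! ### The vertices `n - 1` and `n` -/

/-- The analogue of `entrySum` for the vertices `n - 1` (`y = n`, `y' = n̄`) and `n`
(`y = n̄`, `y' = n`). -/
noncomputable def spinSum (n h r : ℕ) (y y' : Letter) (T : Tableau ℓ) (M : ℤ) : ℤ :=
  ∑ a : Idx ℓ, ((if (T a = num (n - 1) ∨ T a = y') ∧ M ≤ xcoord h r a then 1 else 0) -
    (if (T a = y ∨ T a = bar (n - 1)) ∧ M + 1 ≤ xcoord h r a then 1 else 0))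

/-- A positive letter at `a` and a negative letter at `b` cancel when no other entry lies between
the two thresholds. -/
theorem spinSum_sub {y y' : Letter} {T : Tableau ℓ} {M M' : ℤ} {a b : Idx ℓ}
    (hab : xcoord h r b < M' + 1) (ha₀ : xcoord h r a < M') (hba : xcoord h r a < xcoord h r b)
    (ha : (T a = num (n - 1) ∨ T a = y') ∧ M ≤ xcoord h r a)
    (hb : (T b = y ∨ T b = bar (n - 1)) ∧ M + 1 ≤ xcoord h r b)
    (hother : ∀ c, M ≤ xcoord h r c → xcoord h r c < M' + 1 → c = a ∨ c = b)
    (hdisj : ∀ c, ¬ ((T c = num (n - 1) ∨ T c = y') ∧ (T c = y ∨ T c = bar (n - 1)))) :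
    spinSum n h r y y' T M = spinSum n h r y y' T M' := by
  have hne : a ≠ b := by rintro rfl; omega
  have key : ∀ c : Idx ℓ,
      ((if (T c = num (n - 1) ∨ T c = y') ∧ M ≤ xcoord h r c then (1 : ℤ) else 0) -
        (if (T c = y ∨ T c = bar (n - 1)) ∧ M + 1 ≤ xcoord h r c then 1 else 0)) =
      ((if (T c = num (n - 1) ∨ T c = y') ∧ M' ≤ xcoord h r c then 1 else 0) -
        (if (T c = y ∨ T c = bar (n - 1)) ∧ M' + 1 ≤ xcoord h r c then 1 else 0)) +
      ((if c = a then 1 else 0) - (if c = b then 1 else 0)) := by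
    intro c
    by_cases hca : c = a
    · subst hca
      have h₁ : ¬ (T c = y ∨ T c = bar (n - 1)) := fun h => hdisj c ⟨ha.1, h⟩
      simp only [ha.1, ha.2, h₁, hne, true_and, false_and, if_true, if_false]
      rw [if_neg (by omega)]
      ring
    · by_cases hcb : c = b
      · subst hcb
        have h₁ : ¬ (T c = num (n - 1) ∨ T c = y') := fun h => hdisj c ⟨h, hb.1⟩
        simp only [hb.1, hb.2, h₁, hca, true_and, false_and, if_true, if_false]
        rw [if_neg (by omega)]
        ring
      · have h₁ : M ≤ xcoord h r c ↔ M' ≤ xcoord h r c := by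
          constructor
          · intro g
            by_contra g'
            rcases hother c g (by omega) with h | h
            · exact hca h
            · exact hcb h
          · omega
        have h₂ : M + 1 ≤ xcoord h r c ↔ M' + 1 ≤ xcoord h r c := by
          constructor
          · intro g
            by_contra g'
            rcases hother c (by omega) (by omega) with h | h
            · exact hca h
            · exact hcb h
          · omega
        simp only [hca, hcb, h₁, h₂, if_false]
        ring
  unfold spinSum
  rw [Finset.sum_congr rfl fun c _ => key c, Finset.sum_add_distrib, Finset.sum_sub_distrib,
    Finset.sum_sub_distrib, Finset.sum_ite_eq', Finset.sum_ite_eq']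
  simp

/-- The hypothesis on the letters `y`, `y'` in `spinSum`. -/
structure IsSpinPair (n : ℕ) (y y' : Letter) : Prop where
  pair : y = num n ∧ y' = bar n ∨ y = bar n ∧ y' = num n

namespace IsAdm

variable {T : Tableau ℓ} {a : Idx ℓ} {y y' z : Letter}

/-- A negative letter right after `a` would make the sum at its coordinate equal to the sum at `a`,
which is strictly larger than all later ones. Neither the column nor the shift matters, since no
entry lies between the two. -/
theorem spin_next (hn : 4 ≤ n) (hy : IsSpinPair n y y')
    (hlt : ∀ M', xcoord h r a < M' →
      spinSum n h r y y' T M' < spinSum n h r y y' T (xcoord h r a))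
    (ha : T a = num (n - 1) ∨ T a = y') {b : Idx ℓ} (hab : b.1 = a.1 + 1) :
    ¬ (T b = y ∨ T b = bar (n - 1)) := by
  intro hb
  have hx := xcoord_lt (h := h) (r := r) (show a.1 < b.1 by omega)
  refine (hlt (xcoord h r b) hx).ne (spinSum_sub (by omega) hx hx ⟨ha, le_rfl⟩
    ⟨hb, by omega⟩ ?_ ?_).symm
  · intro c hc hc'
    rcases lt_trichotomy c.1 a.1 with g | g | g
    · have := xcoord_lt (h := h) (r := r) g; omega
    · exact Or.inl (Subtype.ext g)
    · rcases (by omega : c.1 = b.1 ∨ b.1 < c.1) with g | g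
      · exact Or.inr (Subtype.ext g)
      · have := xcoord_lt (h := h) (r := r) g; omega
  · intro c
    rcases hy.pair with ⟨rfl, rfl⟩ | ⟨rfl, rfl⟩ <;> rintro ⟨h₁ | h₁, h₂ | h₂⟩ <;> rw [h₁] at h₂ <;>
      simp only [num.injEq, bar.injEq, reduceCtorEq] at h₂ <;> omega

/-- All pairs `k`, `k̄` that occur in `same`, `cross` and `gap` have `k ≤ n-2`, because the
positions involved force this; the letters changed here do not meet them. Only the order of
neighbouring letters has to be checked, also at the junction. -/
theorem update_spin (hn : 4 ≤ n) (hT : IsAdm n ℓ h r T)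
    (hy : IsSpinPair n y y')
    (hlt : ∀ M', xcoord h r a < M' →
      spinSum n h r y y' T M' < spinSum n h r y y' T (xcoord h r a))
    (ha : T a = num (n - 1) ∧ z = y ∨ T a = y' ∧ z = bar (n - 1)) :
    IsAdm n ℓ h r (Function.update T a z) := by
  have hT₁ : height n (T a) = n - 1 ∧ height n z = n ∨
      height n (T a) = n ∧ height n z = n + 1 := by
    rcases ha with ⟨h₁, rfl⟩ | ⟨h₁, rfl⟩ <;> rcases hy.pair with ⟨rfl, rfl⟩ | ⟨rfl, rfl⟩ <;>
      rw [h₁] <;> simp only [height, and_true, true_and] <;> omega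
  have hz : z ∈ alphabet n ∧ (∀ k, z = num k → k = n) ∧ (∀ k, z = bar k → n - 1 ≤ k) := by
    rcases ha with ⟨-, rfl⟩ | ⟨-, rfl⟩ <;> rcases hy.pair with ⟨rfl, rfl⟩ | ⟨rfl, rfl⟩ <;>
      refine ⟨?_, fun k hk => ?_, fun k hk => ?_⟩ <;>
      first | (cases hk <;> omega) | (rw [num_mem_alphabet]; omega) | (rw [bar_mem_alphabet]; omega)
  have hTa : (∀ k, T a = num k → n - 1 ≤ k) ∧ (∀ k, T a = bar k → k = n) := by
    rcases ha with ⟨h₁, -⟩ | ⟨h₁, -⟩ <;> rw [h₁] <;>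
      rcases hy.pair with ⟨rfl, rfl⟩ | ⟨rfl, rfl⟩ <;>
      refine ⟨fun k hk => ?_, fun k hk => ?_⟩ <;> cases hk <;> omega
  have hstep : ∀ u v : Idx ℓ, v.1 = u.1 + 1 → Lt n (T u) (T v) →
      Lt n (Function.update T a z u) (Function.update T a z v) := by
    intro u v huv hlt'
    by_cases hu : u = a
    · subst hu
      have hv : v ≠ u := fun h => by rw [h] at huv; omega
      rw [Function.update_self, Function.update_of_ne hv]
      have hne := spin_next hn hy hlt (ha.imp And.left And.left) huv
      obtain ⟨k, hk₁, hk₂, hk⟩ := hT.mem v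
      rcases ha with ⟨h₁, rfl⟩ | ⟨h₁, rfl⟩ <;> rcases hy.pair with ⟨rfl, rfl⟩ | ⟨rfl, rfl⟩ <;>
        rcases hk with hk | hk <;> rw [hk] at hne hlt' ⊢ <;> rw [h₁] at hlt' <;>
        simp only [Lt, height, num.injEq, bar.injEq, reduceCtorEq, ne_eq, not_false_eq_true,
          true_and, or_false, false_or] at hne hlt' ⊢ <;> omega
    · rw [Function.update_of_ne hu]
      by_cases hv : v = a
      · subst hv
        rw [Function.update_self]
        left
        unfold Lt at hlt'
        omega
      · rwa [Function.update_of_ne hv]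
  have hnum : ∀ {b : Idx ℓ} {k : ℕ}, Function.update T a z b = num k → k ≤ n - 1 → T b = num k := by
    intro b k hb hk
    by_cases hba : b = a
    · subst hba
      rw [Function.update_self] at hb
      have := hz.2.1 k hb
      omega
    · rwa [Function.update_of_ne hba] at hb
  have hbar : ∀ {b : Idx ℓ} {k : ℕ}, Function.update T a z b = bar k → k + 2 ≤ n → T b = bar k := by
    intro b k hb hk
    by_cases hba : b = a
    · subst hba
      rw [Function.update_self] at hb
      have := hz.2.2 k hb
      omega
    · rwa [Function.update_of_ne hba] at hb
  have hnum' : ∀ {b : Idx ℓ} {k : ℕ}, T b = num k → k + 2 ≤ n →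
      Function.update T a z b = num k := by
    intro b k hb hk
    rw [Function.update_of_ne, hb]
    rintro rfl
    have := hTa.1 k hb
    omega
  have hbar' : ∀ {b : Idx ℓ} {k : ℕ}, T b = bar k → k + 2 ≤ n →
      Function.update T a z b = bar k := by
    intro b k hb hk
    rw [Function.update_of_ne, hb]
    rintro rfl
    have := hTa.2 k hb
    omega
  refine ⟨fun b => ?_, fun u v huv hs => hstep u v huv (hT.col u v huv hs),
    fun u v k huv hs hu hv he => ?_, fun u v k hu' hv' hu hv he => ?_, fun u v hu' hv' => ?_⟩
  · by_cases hb : b = a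
    · subst hb
      rw [Function.update_self]
      exact hz.1
    · rw [Function.update_of_ne hb]; exact hT.mem b
  · exact hT.same u v k huv hs (hnum hu (by omega)) (hbar hv (by omega)) he
  · have hu₀ := u.2.1
    have hv₀ := v.2.2
    exact hT.cross u v k hu' hv' (hnum hu (by omega)) (hbar hv (by omega)) he
  · have hu₀ := u.2.1
    have hv₀ := v.2.2
    rcases hT.gap u v hu' hv' with hlt' | ⟨k', k, hu, hv, hk, H⟩ | ⟨k', k, hu, hv, hk, H⟩
    · exact Or.inl (hstep u v (by omega) hlt')
    · obtain ⟨b, hb, -, -, hb₂⟩ := H k' hk le_rfl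
      refine Or.inr (Or.inl ⟨k', k, hnum' hu (by omega), hnum' hv (by omega), hk,
        fun j hj₁ hj₂ => ?_⟩)
      obtain ⟨b, hb, hb', hb₁, hb₂⟩ := H j hj₁ hj₂
      exact ⟨b, hb, hbar' hb' (by omega), hb₁, hb₂⟩
    · obtain ⟨b, hb, -, -, hb₂⟩ := H k hk le_rfl
      refine Or.inr (Or.inr ⟨k', k, hbar' hu (by omega), hbar' hv (by omega), hk,
        fun j hj₁ hj₂ => ?_⟩)
      obtain ⟨b, hb, hb', hb₁, hb₂⟩ := H j hj₁ hj₂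
      exact ⟨b, hb, hnum' hb' (by omega), hb₁, hb₂⟩

end IsAdm

/-! ### The set of tableaux is a crystal -/

theorem φPart_mT_eq_spinSum_pred (hn : 4 ≤ n) {T : Tableau ℓ} (hT : ∀ a, T a ∈ alphabet n)
    {i : Idx n} (hi : i.1 + 1 = n) (M : ℤ) :
    φPart i (mT n ℓ h r T) (ℓ + n - 1 - 2 * M) = spinSum n h r (num n) (bar n) T M := by
  rw [φPart_mT]
  unfold spinSum
  refine Finset.sum_congr rfl fun a _ => ?_
  rw [φPart_box_of_lt hn (hT a) (by omega), suffix_eq]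
  have hi' : i.1 = n - 1 := by omega
  obtain ⟨k, hk₁, hk₂, hk | hk⟩ := hT a <;> rw [hk] <;>
    simp only [num.injEq, bar.injEq, reduceCtorEq, false_and, or_false, false_or, if_false] <;>
    split_ifs <;> omega

theorem φPart_mT_eq_spinSum_last (hn : 4 ≤ n) {T : Tableau ℓ} (hT : ∀ a, T a ∈ alphabet n)
    {i : Idx n} (hi : i.1 = n) (M : ℤ) :
    φPart i (mT n ℓ h r T) (ℓ + n - 1 - 2 * M) = spinSum n h r (bar n) (num n) T M := by
  rw [φPart_mT]
  unfold spinSum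
  refine Finset.sum_congr rfl fun a _ => ?_
  rw [φPart_box_last hn (hT a) hi, suffix_eq]
  obtain ⟨k, hk₁, hk₂, hk | hk⟩ := hT a <;> rw [hk] <;>
    simp only [num.injEq, bar.injEq, reduceCtorEq, false_and, or_self, if_false] <;>
    split_ifs <;> omega

/-- There are at most two candidates: an `i` at coordinate `M` and a barred `i+1` at `M+n-1-i`. The
tie rule translates into the last clauses of `pos`. -/
theorem IsFPos.isFStep (hn : 4 ≤ n) {i : Idx n} (hi : i.1 + 2 ≤ n) {T : Tableau ℓ} {a : Idx ℓ}
    (hT : ∀ a, T a ∈ alphabet n) (h₀ : φ i (mT n ℓ h r T) ≠ 0) (ha : IsFPos n ℓ h r i T a) :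
    ∃ M, IsFStep n h r i T a M := by
  obtain ⟨hq₁, hq₂⟩ := q_spec h₀
  have hmem : ∀ b, b ∈ fPositions n ℓ h r i T ↔ _ := fun b => by
    rw [mem_fPositions, box_eq_one_of_lt hn (hT b) (by omega), suffix_eq]
  generalize q i (mT n ℓ h r T) = Q at hq₁ hq₂ hmem
  have ha₁ := (hmem a).1 ha.mem
  obtain ⟨M, rfl⟩ : ∃ M : ℤ, Q = ℓ + i - 2 * M := by
    rcases ha₁ with ⟨-, h₁⟩ | ⟨-, h₁⟩
    · exact ⟨xcoord h r a, by omega⟩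
    · exact ⟨xcoord h r a - (n - 1 - i), by omega⟩
  have hφ := φPart_mT_eq (h := h) (r := r) hn hT (i := i) (by omega)
  refine ⟨M, fun M' hM' => ?_, ?_, ?_⟩
  · rw [← hφ, ← hφ, hq₁]
    exact hq₂ _ (by omega)
  · rw [← hφ, ← hφ, hq₁]
    exact φPart_le _ _ _
  rcases ha₁ with ⟨hTa, h₁⟩ | ⟨hTa, h₁⟩
  · refine Or.inl ⟨hTa, by omega, fun b hb hxb hah hbh => ?_⟩
    by_contra hr
    have hb' : b ∈ fPositions n ℓ h r i T := (hmem b).2 (Or.inr ⟨hb, by omega⟩)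
    have hle := ha.le b hb' ⟨hr, a, ha.mem, b, hb', hah, hbh⟩
    rw [← Subtype.coe_le_coe] at hle
    omega
  · refine Or.inr ⟨hTa, by omega, fun b hb hxb => ?_⟩
    have hb' : b ∈ fPositions n ℓ h r i T := (hmem b).2 (Or.inl ⟨hb, by omega⟩)
    have hba : b.1 < a.1 := by
      rcases lt_trichotomy a.1 b.1 with g | g | g
      · have := xcoord_lt (h := h) (r := r) g; omega
      · rw [Subtype.ext g, hb] at hTa; cases hTa
      · exact g
    by_cases hC : Crossing h r (fPositions n ℓ h r i T)
    · obtain ⟨-, c, hc, d, hd, hch, hdh⟩ := hC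
      have key : ∀ c ∈ fPositions n ℓ h r i T, c = a ∨ c = b := by
        intro c hc
        rcases (hmem c).1 hc with ⟨-, h₂⟩ | ⟨-, h₂⟩
        · exact Or.inr (xcoord_injective (h := h) (r := r) (by omega))
        · exact Or.inl (xcoord_injective (h := h) (r := r) (by omega))
      rcases key c hc with rfl | rfl <;> rcases key d hd with rfl | rfl <;> omega
    · have hle := ha.ge b hb' hC
      rw [← Subtype.coe_le_coe] at hle
      omega

theorem fLetter_num {i k : ℕ} (hi : i < n) (hk : k = i) : fLetter n i (num k) = num (i + 1) := by
  simp [fLetter, hi, hk]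

theorem fLetter_bar {i k : ℕ} (hi : i < n) (hk : k = i + 1) : fLetter n i (bar k) = bar i := by
  simp [fLetter, hi, hk]

theorem fLetter_last_pred : fLetter n n (num (n - 1)) = bar n := by
  simp [fLetter]

theorem fLetter_last (hn : 4 ≤ n) : fLetter n n (num n) = bar (n - 1) := by
  simp only [fLetter, lt_irrefl, if_false, if_true]
  rw [if_neg (by omega)]

theorem IsAdm.f_mem (hn : 4 ≤ n) (hr : r ≠ 0 ∨ h = 0 ∨ h = ℓ) {i : Idx n} {T T' : Tableau ℓ}
    (hT : IsAdm n ℓ h r T) (hf : (tableauCrystal n ℓ h r).f i T = some T') :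
    IsAdm n ℓ h r T' := by
  obtain ⟨h₀, a, ha, rfl⟩ := tableauCrystal_f_eq.1 hf
  have hi₁ := i.2.1
  have hi₂ := i.2.2
  obtain ⟨hq₁, hq₂⟩ := q_spec h₀
  rcases (by omega : i.1 + 2 ≤ n ∨ i.1 + 1 = n ∨ i.1 = n) with hi | hi | hi
  · obtain ⟨M, hM⟩ := ha.isFStep hn hi hT.mem h₀
    rcases hM.pos with ⟨hTa, -⟩ | ⟨hTa, -⟩
    · rw [hTa, fLetter_num (by omega) rfl]
      exact hT.update_num hr hi hM hTa
    · rw [hTa, fLetter_bar (by omega) rfl]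
      exact hT.update_bar hr hi₁ hi hM hTa
  · have hmem := mem_fPositions.1 ha.mem
    rw [box_eq_one_of_lt hn (hT.mem a) (by omega), suffix_eq] at hmem
    have hq : q i (mT n ℓ h r T) = ℓ + n - 1 - 2 * xcoord h r a := by omega
    have hφ := φPart_mT_eq_spinSum_pred (h := h) (r := r) hn hT.mem hi
    refine hT.update_spin hn (y := num n) (y' := bar n) ⟨Or.inl ⟨rfl, rfl⟩⟩
      (fun M' hM' => ?_) ?_
    · rw [← hφ, ← hφ, ← hq, hq₁]
      exact hq₂ _ (by omega)
    · rcases hmem with ⟨hTa, -⟩ | ⟨hTa, -⟩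
      · refine Or.inl ⟨by rw [hTa]; congr 1; omega, ?_⟩
        rw [hTa, fLetter_num (by omega) rfl, hi]
      · refine Or.inr ⟨by rw [hTa, hi], ?_⟩
        rw [hTa, fLetter_bar (by omega) rfl]
        congr 1; omega
  · have hmem := mem_fPositions.1 ha.mem
    rw [box_eq_one_last hn (hT.mem a) hi, suffix_eq] at hmem
    have hq : q i (mT n ℓ h r T) = ℓ + n - 1 - 2 * xcoord h r a := by omega
    have hφ := φPart_mT_eq_spinSum_last (h := h) (r := r) hn hT.mem hi
    refine hT.update_spin hn (y := bar n) (y' := num n) ⟨Or.inr ⟨rfl, rfl⟩⟩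
      (fun M' hM' => ?_) ?_
    · rw [← hφ, ← hφ, ← hq, hq₁]
      exact hq₂ _ (by omega)
    · rcases hmem.1 with hTa | hTa
      · exact Or.inl ⟨hTa, by rw [hTa, hi, fLetter_last_pred]⟩
      · exact Or.inr ⟨hTa, by rw [hTa, hi, fLetter_last hn]⟩

/-- After the change, `ẽ_i` may have a second candidate at coordinate distance `n-1-i`. If `a`
became `i+1`, that candidate is a later barred `i`; by `same` it lies in the other column with `r ≠
0`, and `ẽ_i` takes the first. If `a` became a barred `i`, it is an earlier `i+1`; by `cross` the
pair is not crossing, and `ẽ_i` takes the last. -/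
theorem IsAdm.isEPos_of_f (hn : 4 ≤ n) (hr : r ≠ 0 ∨ h = 0 ∨ h = ℓ) {i : Idx n} {T : Tableau ℓ}
    (hT : IsAdm n ℓ h r T) (h₀ : φ i (mT n ℓ h r T) ≠ 0) {a : Idx ℓ}
    (ha : box n (T a) (suffix ℓ h r a) (i, q i (mT n ℓ h r T)) = 1)
    (hT' : ∀ b, Function.update T a (fLetter n i (T a)) b ∈ alphabet n)
    (hp : p i (mT n ℓ h r (Function.update T a (fLetter n i (T a)))) =
      q i (mT n ℓ h r T) + 2) :
    IsEPos n ℓ h r i (Function.update T a (fLetter n i (T a))) a := by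
  have hi₁ := i.2.1
  have hab₀ : ∀ b : Idx ℓ, 1 ≤ b.1 ∧ b.1 ≤ ℓ := fun b => ⟨b.2.1, b.2.2⟩
  generalize q i (mT n ℓ h r T) = Q at ha hp
  have hmem : ∀ b, b ∈ ePositions n ℓ h r i (Function.update T a (fLetter n i (T a))) ↔
      box n (Function.update T a (fLetter n i (T a)) b) (suffix ℓ h r b) (i, Q + 2) = -1 :=
    fun b => by rw [mem_ePositions, hp]
  -- Only the membership criterion matters, so the set of candidates becomes a variable. The claim
  -- is that every other candidate lies on the side rejected by the tie rule.
  suffices H : ∀ P : Finset (Idx ℓ), (∀ b, b ∈ P ↔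
      box n (Function.update T a (fLetter n i (T a)) b) (suffix ℓ h r b) (i, Q + 2) = -1) →
      a ∈ P ∧ ∀ b ∈ P, b ≠ a → (a.1 < b.1 ∧ Crossing h r P) ∨ (b.1 < a.1 ∧ ¬ Crossing h r P) by
    obtain ⟨H₁, H₂⟩ := H _ hmem
    refine ⟨H₁, fun b hb hC => ?_, fun b hb hC => ?_⟩
    · by_cases hba : b = a
      · exact hba.ge
      · rcases H₂ b hb hba with h₁ | h₁
        · exact Subtype.coe_le_coe.1 h₁.1.le
        · exact absurd hC h₁.2
    · by_cases hba : b = a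
      · exact hba.le
      · rcases H₂ b hb hba with h₁ | h₁
        · exact absurd h₁.2 hC
        · exact Subtype.coe_le_coe.1 h₁.1.le
  clear hmem hp
  intro P hmem
  rcases i.2.2.lt_or_eq with hi | hi
  · have hmem' : ∀ b, b ∈ P ↔ _ := fun b => by
      rw [hmem, box_eq_neg_one_of_lt hn (hT' b) hi, suffix_eq]
    rw [box_eq_one_of_lt hn (hT.mem a) hi, suffix_eq] at ha
    rcases ha with ⟨hTa, hQ⟩ | ⟨hTa, hQ⟩
    · rw [hTa, fLetter_num hi rfl] at hmem'
      have haP : a ∈ P := (hmem' a).2 (Or.inl ⟨Function.update_self .., by omega⟩)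
      refine ⟨haP, fun b hb hba => Or.inl ?_⟩
      have hb' := (hmem' b).1 hb
      rw [Function.update_of_ne hba] at hb'
      rcases hb' with ⟨-, hxb⟩ | ⟨hTb, hxb⟩
      · exact absurd (xcoord_injective (h := h) (r := r) (by omega)) hba
      have hxb' : xcoord h r b = xcoord h r a + (n - 1 - i) := by omega
      have hab : a.1 < b.1 := by
        rcases lt_trichotomy a.1 b.1 with g | g | g
        · exact g
        · exact absurd (Subtype.ext g).symm hba
        · have := xcoord_lt (h := h) (r := r) g; omega
      refine ⟨hab, ?_⟩
      by_cases hs : SameCol h a b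
      · exfalso
        have := hT.same a b i hab hs hTa hTb
        unfold SameCol at hs
        unfold xcoord at hxb'
        split_ifs at hxb' <;> omega
      · unfold SameCol at hs
        have h₁ := hab₀ a
        have h₂ := hab₀ b
        exact ⟨by omega, a, haP, b, hb, by omega, by omega⟩
    · rw [hTa, fLetter_bar hi rfl] at hmem'
      have haP : a ∈ P := (hmem' a).2 (Or.inr ⟨Function.update_self .., by omega⟩)
      refine ⟨haP, fun b hb hba => Or.inr ?_⟩
      have hb' := (hmem' b).1 hb
      rw [Function.update_of_ne hba] at hb'
      rcases hb' with ⟨hTb, hxb⟩ | ⟨-, hxb⟩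
      swap
      · exact absurd (xcoord_injective (h := h) (r := r) (by omega)) hba
      have hxb' : xcoord h r a = xcoord h r b + (n - 1 - i) := by omega
      have hab : b.1 < a.1 := by
        rcases lt_trichotomy b.1 a.1 with g | g | g
        · exact g
        · exact absurd (Subtype.ext g) hba
        · have := xcoord_lt (h := h) (r := r) g; omega
      refine ⟨hab, ?_⟩
      rintro ⟨hr', c, hc, d, hd, hch, hdh⟩
      have key : ∀ c ∈ P, c = a ∨ c = b := by
        intro c hc
        rcases (hmem' c).1 hc with ⟨-, h₂⟩ | ⟨-, h₂⟩
        · exact Or.inr (xcoord_injective (h := h) (r := r) (by omega))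
        · exact Or.inl (xcoord_injective (h := h) (r := r) (by omega))
      have hbh : b.1 ≤ h ∧ h < a.1 := by
        rcases key c hc with rfl | rfl <;> rcases key d hd with rfl | rfl <;> omega
      have := hT.cross b a (i + 1) hbh.1 hbh.2 hTb hTa
      rw [xcoord_of_le hbh.1, xcoord_of_lt hbh.2] at hxb'
      omega
  · rw [box_eq_one_last hn (hT.mem a) hi, suffix_eq] at ha
    obtain ⟨hTa, hQ⟩ := ha
    have hmem' : ∀ b, b ∈ P ↔ _ := fun b => by
      rw [hmem, box_eq_neg_one_last hn (hT' b) hi, suffix_eq]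
    refine ⟨(hmem' a).2 ⟨?_, by omega⟩, fun b hb hba => ?_⟩
    · rw [Function.update_self]
      rcases hTa with hTa | hTa
      · rw [hTa, hi, fLetter_last_pred]; exact Or.inl rfl
      · rw [hTa, hi, fLetter_last hn]; exact Or.inr rfl
    · have := ((hmem' b).1 hb).2
      exact absurd (xcoord_injective (h := h) (r := r) (by omega)) hba

theorem IsAdm.e_of_f (hn : 4 ≤ n) (hr : r ≠ 0 ∨ h = 0 ∨ h = ℓ) {i : Idx n} {T T' : Tableau ℓ}
    (hT : IsAdm n ℓ h r T) (hf : (tableauCrystal n ℓ h r).f i T = some T') :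
    (tableauCrystal n ℓ h r).e i T' = some T := by
  have hmono := (mT_f hn hT.mem hf).2
  have hT' := (mT_f hn hT.mem hf).1
  have hP := hasParity_mT (h := h) (r := r) hn hT.mem
  have he := (monomialCrystal_e_iff_f (HasParity.f hn hP hmono) hP).2 hmono
  obtain ⟨h₀, a, ha, rfl⟩ := tableauCrystal_f_eq.1 hf
  have hmem := mem_fPositions.1 ha.mem
  have hmono' := (monomialCrystal_f_eq.1 hmono).2
  refine tableauCrystal_e_eq.2 ⟨(monomialCrystal_e_eq.1 he).1, a,
    hT.isEPos_of_f hn hr h₀ hmem hT' (by rw [hmono']; exact p_f hP h₀), ?_⟩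
  rw [Function.update_self, (box_fLetter hn (hT.mem a) hmem).2.1, Function.update_idem,
    Function.update_eq_self]

/-- Stability under `f̃_i` of the reversed tableau; the condition on `r` and `h` is symmetric under
`h ↦ ℓ - h`. -/
theorem IsAdm.e_mem (hn : 4 ≤ n) (hh : h ≤ ℓ) (hr : r ≠ 0 ∨ h = 0 ∨ h = ℓ) {i : Idx n}
    {T T' : Tableau ℓ} (hT : IsAdm n ℓ h r T) (he : (tableauCrystal n ℓ h r).e i T = some T') :
    IsAdm n ℓ h r T' := by
  have h₁ := (hT.revT hh).f_mem hn (by omega) ((tableauCrystal_e_eq_revT hn hh i hT.mem).1 he)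
  have h₂ := h₁.revT (by omega)
  rwa [revT_revT, Nat.sub_sub_self hh] at h₂

theorem IsAdm.f_of_e (hn : 4 ≤ n) (hh : h ≤ ℓ) (hr : r ≠ 0 ∨ h = 0 ∨ h = ℓ) {i : Idx n}
    {T T' : Tableau ℓ} (hT : IsAdm n ℓ h r T) (he : (tableauCrystal n ℓ h r).e i T = some T') :
    (tableauCrystal n ℓ h r).f i T' = some T := by
  have h₁ := (hT.revT hh).e_of_f hn (by omega) ((tableauCrystal_e_eq_revT hn hh i hT.mem).1 he)
  rwa [tableauCrystal_e_eq_revT hn (by omega) i (revT_mem (hT.e_mem hn hh hr he).mem), revT_revT,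
    revT_revT, Nat.sub_sub_self hh] at h₁

theorem IsAdm.e_iff_f (hn : 4 ≤ n) (hh : h ≤ ℓ) (hr : r ≠ 0 ∨ h = 0 ∨ h = ℓ) {i : Idx n}
    {T T' : Tableau ℓ} (hT : IsAdm n ℓ h r T) (hT' : IsAdm n ℓ h r T') :
    (tableauCrystal n ℓ h r).e i T = some T' ↔ (tableauCrystal n ℓ h r).f i T' = some T :=
  ⟨hT.f_of_e hn hh hr, hT'.e_of_f hn hr⟩

theorem exists_e (hn : 4 ≤ n) (hh : h ≤ ℓ) (i : Idx n) {T : Tableau ℓ}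
    (hT : ∀ a, T a ∈ alphabet n) (h₀ : ε i (mT n ℓ h r T) ≠ 0) :
    ∃ T', (tableauCrystal n ℓ h r).e i T = some T' := by
  have hφ := φ_eq_ε (mT_revT (h := h) (r := r) hn hh hT i)
  obtain ⟨a, ha⟩ := exists_isFPos (h := ℓ - h) (r := r) hn (i := i) (revT_mem hT) (by rwa [hφ])
  refine ⟨revT (Function.update (revT T) a (fLetter n i (revT T a))), ?_⟩
  rw [tableauCrystal_e_eq_revT hn hh i hT, revT_revT, tableauCrystal_f_eq]
  exact ⟨by rwa [hφ], a, ha, rfl⟩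

theorem IsAdm.e_map_mT (hn : 4 ≤ n) (hh : h ≤ ℓ) (hr : r ≠ 0 ∨ h = 0 ∨ h = ℓ) (i : Idx n)
    {T : Tableau ℓ} (hT : IsAdm n ℓ h r T) :
    (monomialCrystal n).e i (mT n ℓ h r T) =
      ((tableauCrystal n ℓ h r).e i T).map (mT n ℓ h r) := by
  by_cases h₀ : ε i (mT n ℓ h r T) = 0
  · rw [Option.map_eq_none_iff.2]
    · simp [monomialCrystal, h₀]
    · rw [Option.eq_none_iff_forall_ne_some]
      intro T' hT'
      exact (tableauCrystal_e_eq.1 hT').1 h₀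
  · obtain ⟨T', hT'⟩ := exists_e hn hh i hT.mem h₀
    rw [hT', Option.map_some]
    have h₁ := hT.e_mem hn hh hr hT'
    exact (monomialCrystal_e_iff_f (hasParity_mT hn hT.mem) (hasParity_mT hn h₁.mem)).2
      (mT_f hn h₁.mem (hT.f_of_e hn hh hr hT')).2

theorem isCrystalOn_isAdm (hn : 4 ≤ n) (hh : h ≤ ℓ) (hr : r ≠ 0 ∨ h = 0 ∨ h = ℓ) :
    (tableauCrystal n ℓ h r).IsCrystalOn {T | IsAdm n ℓ h r T} := by
  refine CrystalData.IsCrystalOn.of_f (fun i b hb b' hf => IsAdm.e_mem hn hh hr hb hf)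
    (fun i b hb b' hf => IsAdm.f_mem hn hr hb hf) (fun i b _ => φ_eq_ε_add_wt i _) ?_ ?_ ?_
    fun i b hb b' hb' => IsAdm.e_iff_f hn hh hr hb hb'
  all_goals
    intro i b hb b' hf
    have hf' := (mT_f hn hb.mem hf).2
    have hc := isCrystalOn_monomialComponent hn (hasParity_mT (h := h) (r := r) hn hb.mem)
  · exact hc.wt_f i _ .base _ hf'
  · exact hc.ε_f i _ .base _ hf'
  · exact hc.φ_f i _ .base _ hf'

/-! ### Highest weight tableaux -/

theorem lt_of_xcoord_lt {a b : Idx ℓ} (hab : xcoord h r a < xcoord h r b) : a.1 < b.1 := by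
  by_contra hba
  rcases (not_lt.1 hba).lt_or_eq with g | g
  · exact absurd (xcoord_lt (h := h) (r := r) g) (by omega)
  · rw [Subtype.ext g] at hab
    exact lt_irrefl _ hab

theorem φPart_box_nonneg (hn : 4 ≤ n) {x : Letter} (hx : x ∈ alphabet n) {i : Idx n} {s L : ℤ}
    (hL : ∀ l ≤ L, box n x s (i, l) ≠ -1) : 0 ≤ φPart i (box n x s) L := by
  rcases i.2.2.lt_or_eq with hi | hi
  · have h₁ : ¬ (x = num (i + 1) ∧ s + i + 1 ≤ L) := fun g =>
      hL _ g.2 ((box_eq_neg_one_of_lt hn hx hi).2 (Or.inl ⟨g.1, rfl⟩))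
    have h₂ : ¬ (x = bar i ∧ s + 2 * n - 1 - i ≤ L) := fun g =>
      hL _ g.2 ((box_eq_neg_one_of_lt hn hx hi).2 (Or.inr ⟨g.1, rfl⟩))
    rw [φPart_box_of_lt hn hx hi, if_neg h₁, if_neg h₂]
    split_ifs <;> omega
  · have h₁ : ¬ ((x = bar n ∨ x = bar (n - 1)) ∧ s + n ≤ L) := fun g =>
      hL _ g.2 ((box_eq_neg_one_last hn hx hi).2 ⟨g.1, rfl⟩)
    rw [φPart_box_last hn hx hi, if_neg h₁]
    split_ifs <;> omega

/-- If no negative factor occurred up to index `l`, the partial sum at `l` would be positive,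
contrary to `φ_i = 0`. -/
theorem exists_box_eq_neg_one (hn : 4 ≤ n) {T : Tableau ℓ} (hT : ∀ a, T a ∈ alphabet n)
    {i : Idx n} (h₀ : φ i (mT n ℓ h r T) = 0) {a : Idx ℓ} {l : ℤ}
    (ha : box n (T a) (suffix ℓ h r a) (i, l) = 1) :
    ∃ b, ∃ l' ≤ l, box n (T b) (suffix ℓ h r b) (i, l') = -1 := by
  by_contra! hne
  have h₁ := φPart_le i (mT n ℓ h r T) l
  rw [φPart_mT, h₀] at h₁
  have h₂ : 0 < ∑ b : Idx ℓ, φPart i (box n (T b) (suffix ℓ h r b)) l := by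
    refine Finset.sum_pos' (fun b _ => φPart_box_nonneg hn (hT b) (hne b)) ⟨a, Finset.mem_univ a, ?_⟩
    rw [φPart_eq_add, ha]
    have := φPart_box_nonneg hn (hT a) (L := l - 1) fun l' hl' => hne a l' (by omega)
    omega
  omega

theorem exists_box_eq_one (hn : 4 ≤ n) (hh : h ≤ ℓ) {T : Tableau ℓ} (hT : ∀ a, T a ∈ alphabet n)
    {i : Idx n} (h₀ : ε i (mT n ℓ h r T) = 0) {a : Idx ℓ} {l : ℤ}
    (ha : box n (T a) (suffix ℓ h r a) (i, l) = -1) :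
    ∃ b, ∃ l' ≥ l, box n (T b) (suffix ℓ h r b) (i, l') = 1 := by
  rw [← φ_eq_ε (mT_revT hn hh hT i)] at h₀
  obtain ⟨b, l', hl', hb⟩ := exists_box_eq_neg_one (h := ℓ - h) (r := r) hn (revT_mem hT) h₀
    (a := revIdx a) (l := 2 * n - 2 - 2 * r - l)
    (by rw [box_revT hn hh hT, revIdx_revIdx, sub_sub_cancel, ha, neg_neg])
  rw [box_revT hn hh hT, neg_inj] at hb
  exact ⟨revIdx b, _, by omega, hb⟩

theorem exists_of_eq_num_succ (hn : 4 ≤ n) (hh : h ≤ ℓ) {T : Tableau ℓ}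
    (hT : ∀ a, T a ∈ alphabet n) {i : Idx n} (h₀ : ε i (mT n ℓ h r T) = 0) (hi : i.1 < n)
    {a : Idx ℓ} (ha : T a = num (i + 1)) :
    ∃ b, T b = num i ∧ xcoord h r b ≤ xcoord h r a - 1 ∨
      T b = bar (i + 1) ∧ xcoord h r b ≤ xcoord h r a + n - 2 - i := by
  obtain ⟨b, l', hl', hb⟩ := exists_box_eq_one hn hh hT h₀
    ((box_eq_neg_one_of_lt hn (hT a) hi).2 (Or.inl ⟨ha, rfl⟩))
  rw [box_eq_one_of_lt hn (hT b) hi, suffix_eq] at hb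
  rw [suffix_eq] at hl'
  rcases hb with ⟨hb, h₁⟩ | ⟨hb, h₁⟩
  · exact ⟨b, Or.inl ⟨hb, by omega⟩⟩
  · exact ⟨b, Or.inr ⟨hb, by omega⟩⟩

theorem exists_of_eq_bar (hn : 4 ≤ n) (hh : h ≤ ℓ) {T : Tableau ℓ}
    (hT : ∀ a, T a ∈ alphabet n) {i : Idx n} (h₀ : ε i (mT n ℓ h r T) = 0) (hi : i.1 < n)
    {a : Idx ℓ} (ha : T a = bar i) :
    ∃ b, T b = num i ∧ xcoord h r b ≤ xcoord h r a + i - n ∨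
      T b = bar (i + 1) ∧ xcoord h r b ≤ xcoord h r a - 1 := by
  obtain ⟨b, l', hl', hb⟩ := exists_box_eq_one hn hh hT h₀
    ((box_eq_neg_one_of_lt hn (hT a) hi).2 (Or.inr ⟨ha, rfl⟩))
  rw [box_eq_one_of_lt hn (hT b) hi, suffix_eq] at hb
  rw [suffix_eq] at hl'
  rcases hb with ⟨hb, h₁⟩ | ⟨hb, h₁⟩
  · exact ⟨b, Or.inl ⟨hb, by omega⟩⟩
  · exact ⟨b, Or.inr ⟨hb, by omega⟩⟩

theorem exists_of_eq_bar_last (hn : 4 ≤ n) (hh : h ≤ ℓ) {T : Tableau ℓ}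
    (hT : ∀ a, T a ∈ alphabet n) {i : Idx n} (h₀ : ε i (mT n ℓ h r T) = 0) (hi : i.1 = n)
    {a : Idx ℓ} (ha : T a = bar n) :
    ∃ b, (T b = num (n - 1) ∨ T b = num n) ∧ xcoord h r b < xcoord h r a := by
  obtain ⟨b, l', hl', hb⟩ := exists_box_eq_one hn hh hT h₀
    ((box_eq_neg_one_last hn (hT a) hi).2 ⟨Or.inl ha, rfl⟩)
  rw [box_eq_one_last hn (hT b) hi, suffix_eq] at hb
  rw [suffix_eq] at hl'
  exact ⟨b, hb.1, by omega⟩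

/-- The highest weight tableau `(1, …, ℓ)`. -/
def highestTableau (ℓ : ℕ) : Tableau ℓ := fun a => num a.1

/-- Induction on the position. As `ε_i = 0`, every negative factor is accompanied by a positive one
of no smaller index, that is, by a certain letter at a bounded coordinate. Entries before `c` are
known, and `r + ℓ < n` leaves no place for such a letter unless `c` carries its own number. -/
theorem IsAdm.eq_highestTableau (hn : 4 ≤ n) (hh : h ≤ ℓ) (hℓ : ℓ + 2 ≤ n) (hrℓ : r + ℓ + 1 ≤ n)
    {T : Tableau ℓ} (hT : IsAdm n ℓ h r T) (h₀ : ∀ i, ε i (mT n ℓ h r T) = 0) :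
    T = highestTableau ℓ := by
  suffices H : ∀ N, ∀ c : Idx ℓ, c.1 = N → T c = num c.1 from funext fun c => H _ c rfl
  intro N
  induction N using Nat.strong_induction_on with
  | _ N IH => ?_
  intro c hc
  subst hc
  have hc₁ := c.2.1
  have hc₂ := c.2.2
  have hlt : ∀ b : Idx ℓ, xcoord h r b < xcoord h r c → b.1 < c.1 ∧ T b = num b.1 := fun b hb =>
    ⟨lt_of_xcoord_lt hb, IH b.1 (lt_of_xcoord_lt hb) b rfl⟩
  obtain ⟨j, hj₁, hj₂, hj | hj⟩ := hT.mem c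
  · have hcj : c.1 ≤ j := by
      by_cases hc1 : c.1 = 1
      · omega
      let u : Idx ℓ := ⟨c.1 - 1, by constructor <;> omega⟩
      have hu : c.1 = u.1 + 1 := by change c.1 = c.1 - 1 + 1; omega
      have hTu := IH u.1 (by omega) u rfl
      have hLt : Lt n (T u) (T c) → c.1 ≤ j := by
        rw [hTu, hj]
        simp only [Lt, height]
        omega
      by_cases hs : SameCol h u c
      · exact hLt (hT.col u c hu hs)
      unfold SameCol at hs
      rcases hT.gap u c (by omega) (by omega) with h₁ | ⟨k', k, hk', hk, h₁, h₂⟩ |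
        ⟨k', k, hk', -⟩
      · exact hLt h₁
      · rw [hTu, num.injEq] at hk'
        rw [hj, num.injEq] at hk
        -- The window would begin beyond position `ℓ`, because `k ≤ h` and `r + ℓ < n`.
        obtain ⟨b, -, -, h₃, -⟩ := h₂ k le_rfl h₁
        have := b.2.2
        omega
      · rw [hTu] at hk'
        cases hk'
    by_contra hne
    have hne' : c.1 ≠ j := fun g => hne (by rw [hj, g])
    obtain ⟨b, ⟨hb, hxb⟩ | ⟨hb, hxb⟩⟩ := exists_of_eq_num_succ hn hh hT.mem
      (h₀ ⟨j - 1, by constructor <;> omega⟩) (by change j - 1 < n; omega) (a := c)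
      (by rw [hj]; congr 1; change j = j - 1 + 1; omega)
    · obtain ⟨h₁, h₂⟩ := hlt b (by omega)
      rw [hb, num.injEq] at h₂
      change j - 1 = b.1 at h₂
      omega
    · have hb' : T b = bar j := by rw [hb]; congr 1; change j - 1 + 1 = j; omega
      have hxb' : xcoord h r b ≤ xcoord h r c + n - 1 - j := by
        change _ ≤ xcoord h r c + n - 2 - ((j - 1 : ℕ) : ℤ) at hxb
        omega
      rcases hj₂.lt_or_eq with hj₂ | rfl
      swap
      · rw [(hlt b (by omega)).2] at hb'
        cases hb'
      -- Each barred letter forces the next one at a coordinate smaller by at least one. The barred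
      -- `n-1` then lies no further than `c`, where only unbarred letters stand.
      have chain : ∀ m, j ≤ m → m + 1 ≤ n →
          ∃ p, T p = bar m ∧ xcoord h r p ≤ xcoord h r c + n - 1 - m := by
        intro m hm
        induction m, hm using Nat.le_induction with
        | base => exact fun _ => ⟨b, hb', hxb'⟩
        | succ m hm ih =>
          intro hmn
          obtain ⟨p, hp, hxp⟩ := ih (by omega)
          obtain ⟨q, ⟨hq, hxq⟩ | ⟨hq, hxq⟩⟩ := exists_of_eq_bar hn hh hT.mem
            (h₀ ⟨m, by constructor <;> omega⟩) (by change m < n; omega) hp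
          · change T q = num m at hq
            change _ ≤ _ + (m : ℤ) - _ at hxq
            obtain ⟨h₁, h₂⟩ := hlt q (by omega)
            rw [hq, num.injEq] at h₂
            omega
          · exact ⟨q, hq, by push_cast; omega⟩
      obtain ⟨p, hp, hxp⟩ := chain (n - 1) (by omega) (by omega)
      rcases (by omega : xcoord h r p < xcoord h r c ∨ xcoord h r p = xcoord h r c) with g | g
      · rw [(hlt p g).2] at hp
        cases hp
      · rw [xcoord_injective g, hj] at hp
        cases hp
  · exfalso
    rcases hj₂.lt_or_eq with hj₂ | rfl
    · obtain ⟨b, ⟨hb, hxb⟩ | ⟨hb, hxb⟩⟩ := exists_of_eq_bar hn hh hT.mem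
        (h₀ ⟨j, by constructor <;> omega⟩) (by change j < n; omega) hj
      · change T b = num j at hb
        change _ ≤ _ + (j : ℤ) - _ at hxb
        obtain ⟨h₁, h₂⟩ := hlt b (by omega)
        rw [hb, num.injEq] at h₂
        unfold xcoord at hxb
        split_ifs at hxb <;> omega
      · rw [(hlt b (by omega)).2] at hb
        cases hb
    · obtain ⟨b, hb, hxb⟩ := exists_of_eq_bar_last hn hh hT.mem
        (h₀ ⟨j, by constructor <;> omega⟩) rfl hj
      obtain ⟨h₁, h₂⟩ := hlt b hxb
      rw [h₂, num.injEq, num.injEq] at hb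
      omega

theorem isAdm_highestTableau (hℓ : ℓ + 2 ≤ n) : IsAdm n ℓ h r (highestTableau ℓ) := by
  have hlt : ∀ a b : Idx ℓ, b.1 = a.1 + 1 → Lt n (highestTableau ℓ a) (highestTableau ℓ b) := by
    intro a b hab
    left
    simp only [highestTableau, height]
    omega
  refine ⟨fun a => ?_, fun a b hab _ => hlt a b hab, ?_, ?_,
    fun u v hu hv => Or.inl (hlt u v (by omega))⟩
  · have h₁ := a.2.1
    have h₂ := a.2.2
    exact num_mem_alphabet.2 ⟨h₁, by omega⟩
  · intro a b k _ _ _ hb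
    cases hb
  · intro a b k _ _ _ hb
    cases hb

/-- The product telescopes within each column; where the suffix jumps by `2r`, two factors at the
vertex `h` remain. -/
theorem sum_box_num (N : ℕ) (hN : N + 2 ≤ n) :
    ∑ a ∈ Finset.Icc 1 N, box n (num a)
        (if a ≤ h then (ℓ : ℤ) + 1 - 2 * a else (ℓ : ℤ) + 1 - 2 * a - 2 * r) =
      if N ≤ h then Y n N (ℓ - N)
      else Y n h (ℓ - h) - Y n h (ℓ - h - 2 * r) + Y n N (ℓ - N - 2 * r) := by
  induction N with
  | zero => simp [Y]
  | succ N ih =>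
    rw [Finset.sum_Icc_succ_top (by omega), ih (by omega)]
    have hbox : ∀ s : ℤ, box n (num (N + 1)) s = Y n (N + 1) (s + N) - Y n N (s + N + 1) := by
      intro s
      simp only [box]
      rw [if_pos (by omega)]
      congr 2 <;> push_cast <;> ring
    rw [hbox]
    rcases lt_trichotomy N h with g | g | g
    · rw [if_pos g.le, if_pos (by omega), if_pos (by omega),
        show (ℓ : ℤ) + 1 - 2 * (N + 1 : ℕ) + N = ℓ - (N + 1 : ℕ) by push_cast; ring,
        show (ℓ : ℤ) - (N + 1 : ℕ) + 1 = ℓ - N by push_cast; ring]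
      abel
    · subst g
      rw [if_pos le_rfl, if_neg (by omega), if_neg (by omega),
        show (ℓ : ℤ) + 1 - 2 * (N + 1 : ℕ) - 2 * r + N = ℓ - (N + 1 : ℕ) - 2 * r by
          push_cast; ring,
        show (ℓ : ℤ) - (N + 1 : ℕ) - 2 * r + 1 = ℓ - N - 2 * r by push_cast; ring]
      abel
    · rw [if_neg (by omega), if_neg (by omega), if_neg (by omega),
        show (ℓ : ℤ) + 1 - 2 * (N + 1 : ℕ) - 2 * r + N = ℓ - (N + 1 : ℕ) - 2 * r by
          push_cast; ring,
        show (ℓ : ℤ) - (N + 1 : ℕ) - 2 * r + 1 = ℓ - N - 2 * r by push_cast; ring]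
      abel

theorem mT_highestTableau (hh : h ≤ ℓ) (hℓ : ℓ + 2 ≤ n) :
    mT n ℓ h r (highestTableau ℓ) = highestMono n ℓ h r := by
  have h₁ := sum_box_num (h := h) (r := r) (ℓ := ℓ) ℓ hℓ
  rw [Finset.sum_subtype (Finset.Icc 1 ℓ) (p := fun a => a ∈ Set.Icc 1 ℓ) (by simp)] at h₁
  refine h₁.trans ?_
  unfold highestMono
  split_ifs with g
  · obtain rfl : h = ℓ := by omega
    rw [sub_self, zero_sub, sub_add_cancel]
  · rw [sub_self, zero_sub]

/-! ### The isomorphism -/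

/-- The sum of the heights of the entries. -/
def heightSum (n : ℕ) (T : Tableau ℓ) : ℤ := ∑ a, height n (T a)

theorem heightSum_nonneg {T : Tableau ℓ} (hT : ∀ a, T a ∈ alphabet n) : 0 ≤ heightSum n T := by
  refine Finset.sum_nonneg fun a _ => ?_
  obtain ⟨k, h₁, h₂, hk | hk⟩ := hT a <;> rw [hk] <;> simp only [height] <;> omega

theorem height_fLetter (hn : 4 ≤ n) {x : Letter} (hx : x ∈ alphabet n) {i : Idx n} {s l : ℤ}
    (hxi : box n x s (i, l) = 1) : height n (fLetter n i x) = height n x + 1 := by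
  rcases i.2.2.lt_or_eq with hi | hi
  · rcases (box_eq_one_of_lt hn hx hi).1 hxi with ⟨rfl, -⟩ | ⟨rfl, -⟩
    · rw [fLetter_num hi rfl]
      simp [height]
    · rw [fLetter_bar hi rfl]
      simp only [height]
      push_cast
      ring
  · rcases ((box_eq_one_last hn hx hi).1 hxi).1 with rfl | rfl
    · rw [hi, fLetter_last_pred]
      simp only [height]
      omega
    · rw [hi, fLetter_last hn]
      simp only [height]
      omega

theorem heightSum_f (hn : 4 ≤ n) {i : Idx n} {T T' : Tableau ℓ} (hT : ∀ a, T a ∈ alphabet n)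
    (hf : (tableauCrystal n ℓ h r).f i T = some T') : heightSum n T' = heightSum n T + 1 := by
  obtain ⟨-, a, ha, rfl⟩ := tableauCrystal_f_eq.1 hf
  have h₁ := height_fLetter hn (hT a) (mem_fPositions.1 ha.mem)
  unfold heightSum
  rw [← Finset.add_sum_erase _ _ (Finset.mem_univ a),
    ← Finset.add_sum_erase _ (fun b => height n (T b)) (Finset.mem_univ a), Function.update_self,
    Finset.sum_congr rfl fun b hb => by rw [Function.update_of_ne (Finset.ne_of_mem_erase hb)], h₁]
  ring

/-- Induction on admissible tableaux: from the highest weight tableau downwards. -/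
theorem IsAdm.induction (hn : 4 ≤ n) (hh : h ≤ ℓ) (hℓ : ℓ + 2 ≤ n) (hrℓ : r + ℓ + 1 ≤ n)
    (hr : r ≠ 0 ∨ h = 0 ∨ h = ℓ) {P : Tableau ℓ → Prop} (base : P (highestTableau ℓ))
    (step : ∀ i T T', IsAdm n ℓ h r T → IsAdm n ℓ h r T' →
      (tableauCrystal n ℓ h r).e i T = some T' → P T' → P T)
    {T : Tableau ℓ} (hT : IsAdm n ℓ h r T) : P T := by
  induction hN : (heightSum n T).toNat using Nat.strong_induction_on generalizing T with
  | _ N IH => ?_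
  by_cases h₀ : ∀ i, ε i (mT n ℓ h r T) = 0
  · rwa [hT.eq_highestTableau hn hh hℓ hrℓ h₀]
  · obtain ⟨i, hi⟩ := not_forall.1 h₀
    obtain ⟨T', hT'⟩ := exists_e hn hh i hT.mem hi
    have hadm := hT.e_mem hn hh hr hT'
    refine step i T T' hT hadm hT' (IH _ ?_ hadm rfl)
    have h₁ := heightSum_f hn hadm.mem (hT.f_of_e hn hh hr hT')
    have h₂ := heightSum_nonneg hadm.mem
    omega

/-- Every admissible tableau is reached from the highest one by steps that raise the height sum. -/
theorem heightSum_highestTableau_le (hn : 4 ≤ n) (hh : h ≤ ℓ) (hℓ : ℓ + 2 ≤ n)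
    (hrℓ : r + ℓ + 1 ≤ n) (hr : r ≠ 0 ∨ h = 0 ∨ h = ℓ) {T : Tableau ℓ} (hT : IsAdm n ℓ h r T) :
    heightSum n (highestTableau ℓ) ≤ heightSum n T := by
  refine IsAdm.induction hn hh hℓ hrℓ hr
    (P := fun T => heightSum n (highestTableau ℓ) ≤ heightSum n T) le_rfl ?_ hT
  intro i T T' hT hT' he hle
  have h₁ := heightSum_f hn hT'.mem (hT.f_of_e hn hh hr he)
  omega

theorem bijOn_mT (hn : 4 ≤ n) (hh : h ≤ ℓ) (hℓ : ℓ + 2 ≤ n) (hrℓ : r + ℓ + 1 ≤ n)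
    (hr : r ≠ 0 ∨ h = 0 ∨ h = ℓ) :
    Set.BijOn (mT n ℓ h r) {T | IsAdm n ℓ h r T} (monomialComponent n (highestMono n ℓ h r)) := by
  refine ⟨fun T hT => ?_, fun T hT => ?_, fun m hm => ?_⟩
  · refine IsAdm.induction hn hh hℓ hrℓ hr
      (P := fun T => mT n ℓ h r T ∈ monomialComponent n (highestMono n ℓ h r)) ?_ ?_ hT
    · rw [mT_highestTableau hh hℓ]
      exact .base
    · intro i T T' hT hT' he hm
      exact .f_step i hm (mT_f hn hT'.mem (hT.f_of_e hn hh hr he)).2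
  · refine IsAdm.induction hn hh hℓ hrℓ hr (P := fun T => ∀ ⦃S⦄, S ∈ {T | IsAdm n ℓ h r T} →
      mT n ℓ h r T = mT n ℓ h r S → T = S) ?_ ?_ hT
    · intro S hS hm
      -- If `S` is not the highest tableau, some `ε_i` is nonzero on the common monomial. Then `ẽ_i`
      -- of the highest tableau is an admissible tableau of smaller height sum, which is impossible.
      by_contra hne
      obtain ⟨i, hi⟩ : ∃ i, ε i (mT n ℓ h r S) ≠ 0 := by
        by_contra! h₀
        exact hne (hS.eq_highestTableau hn hh hℓ hrℓ h₀).symm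
      have hadm := isAdm_highestTableau (ℓ := ℓ) (h := h) (r := r) hℓ
      rw [← hm] at hi
      obtain ⟨T', hT'⟩ := exists_e hn hh i hadm.mem hi
      have hadm' := hadm.e_mem hn hh hr hT'
      have h₁ := heightSum_f hn hadm'.mem (hadm.f_of_e hn hh hr hT')
      have h₂ := heightSum_highestTableau_le hn hh hℓ hrℓ hr hadm'
      omega
    · intro i T T' hT hT' he ih S hS hm
      have hi := (tableauCrystal_e_eq.1 he).1
      rw [hm] at hi
      obtain ⟨S', hS'⟩ := exists_e hn hh i hS.mem hi
      have h₁ := hT.e_map_mT hn hh hr i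
      rw [hm, hS.e_map_mT hn hh hr i, he, hS', Option.map_some, Option.map_some,
        Option.some.injEq] at h₁
      obtain rfl := ih (hS.e_mem hn hh hr hS') h₁.symm
      have h₂ := hT.f_of_e hn hh hr he
      rwa [hS.f_of_e hn hh hr hS', Option.some.injEq, eq_comm] at h₂
  · induction hm with
    | base => exact ⟨_, isAdm_highestTableau hℓ, mT_highestTableau hh hℓ⟩
    | e_step i _ he ih =>
      obtain ⟨T, hT, rfl⟩ := ih
      rw [IsAdm.e_map_mT hn hh hr i hT, Option.map_eq_some_iff] at he
      obtain ⟨T', hT', rfl⟩ := he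
      exact ⟨T', IsAdm.e_mem hn hh hr hT hT', rfl⟩
    | f_step i _ hf ih =>
      obtain ⟨T, hT, rfl⟩ := ih
      rw [f_map_mT hn i (IsAdm.mem hT), Option.map_eq_some_iff] at hf
      obtain ⟨T', hT', rfl⟩ := hf
      exact ⟨T', IsAdm.f_mem hn hr hT hT', rfl⟩

theorem tableauSet_eq : tableauSet n ℓ h r = {T | IsAdm n ℓ h r T} :=
  Set.ext fun _ => isD_iff_isAdm

theorem isCrystalIso_mT (hn : 4 ≤ n) (hh : h ≤ ℓ) (hℓ : ℓ + 2 ≤ n) (hrℓ : r + ℓ + 1 ≤ n)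
    (hr : r ≠ 0 ∨ h = 0 ∨ h = ℓ) :
    CrystalData.IsCrystalIso (tableauCrystal n ℓ h r) (tableauSet n ℓ h r) (monomialCrystal n)
      (monomialComponent n (highestMono n ℓ h r)) (mT n ℓ h r) := by
  rw [tableauSet_eq]
  refine ⟨isCrystalOn_isAdm hn hh hr, ?_, bijOn_mT hn hh hℓ hrℓ hr, fun _ _ => rfl,
    fun _ _ _ => rfl, fun _ _ _ => rfl, fun i T hT => IsAdm.e_map_mT hn hh hr i hT,
    fun i T hT => f_map_mT hn i (IsAdm.mem hT)⟩
  rw [← mT_highestTableau hh hℓ]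
  exact isCrystalOn_monomialComponent hn (hasParity_mT hn
    (isAdm_highestTableau (h := h) (r := r) hℓ).mem)

/-! ### The case where the two columns are not shifted -/

theorem suffix_zero : suffix ℓ h 0 = suffix ℓ 0 0 := by
  funext a
  simp [suffix]

theorem mT_zero : mT n ℓ h 0 = mT n ℓ 0 0 := by
  funext T
  simp only [mT, suffix_zero (h := h)]

/-- For `r = 0` no pair counts as crossing and all suffixes agree, so the position of the column
break plays no role. -/
theorem tableauCrystal_zero : tableauCrystal n ℓ h 0 = tableauCrystal n ℓ 0 0 := by
  have hC : ∀ k s, ¬ Crossing (ℓ := ℓ) k 0 s := fun k s hs => hs.1 rfl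
  simp only [tableauCrystal, fPositions, ePositions, hC, if_false, mT_zero (h := h),
    suffix_zero (h := h)]

theorem highestMono_zero : highestMono n ℓ h 0 = highestMono n ℓ 0 0 := by
  simp [highestMono]

theorem tableauSet_zero : tableauSet n ℓ h 0 = tableauSet n ℓ 0 0 := by
  rw [tableauSet_eq, tableauSet_eq]
  exact Set.ext fun _ => isAdm_zero_iff

end TypeD

theorem mainTheorem7 (n ℓ h r : ℕ) (hn : 4 ≤ n) (hℓ₁ : 1 ≤ ℓ) (hℓ₂ : ℓ ≤ n - 2)
    (hr : r ≤ n - ℓ - 1) (hh : h ≤ ℓ) :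
    TypeD.CrystalData.IsCrystalIso
      (TypeD.tableauCrystal n ℓ h r) (TypeD.tableauSet n ℓ h r)
      (TypeD.monomialCrystal n) (TypeD.monomialComponent n (TypeD.highestMono n ℓ h r))
      (TypeD.mT n ℓ h r) := by
  rcases Nat.eq_zero_or_pos r with rfl | hr₀
  · rw [TypeD.tableauCrystal_zero, TypeD.tableauSet_zero, TypeD.highestMono_zero, TypeD.mT_zero]
    exact TypeD.isCrystalIso_mT hn (Nat.zero_le ℓ) (by omega) (by omega) (Or.inr (Or.inl rfl))
  · exact TypeD.isCrystalIso_mT hn hh (by omega) (by omega) (Or.inl hr₀.ne')
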